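/- **F-spectral curves.** An F-spectral curve $(\Sigma,x,y,\omega_{0,2}^{\mathrm{conn}},\omega_{0,2}^{\mathrm{disc}},w)$ consists of a Riemann surface $\Sigma$ (not necessarily compact or connected); meromorphic functions $x,y$ on $\Sigma$ such that the set $\mathfrak a$ of zeros of $\mathrm dx$ (at points where $x$ is holomorphic) is finite, these zeros are simple, and $\mathrm dy$ is holomorphic and non-zero at $\mathfrak a$; two (not necessarily symmetric) bidifferentials $\omega^{\star}_{0,2}(z_1|z_2)$, $\star\in\{\mathrm{conn},\mathrm{disc}\}$, on $\Sigma^2$, holomorphic off the diagonal and of the form $\frac{\mathrm d\zeta_1\mathrm d\zeta_2}{(\zeta_1-\zeta_2)^2}+\text{holomorphic}$ in a local coordinate near the diagonal; and scalars $w=(w^\alpha)_{\alpha\in\mathfrak a}$. Choose local coordinates $\zeta^\alpha=\sqrt{2(x-x(\alpha))}$ near $\alpha\in\mathfrak a$ and let $\sigma^\alpha$ be the local involution $\zeta^\alpha\mapsto-\zeta^\alpha$. Let $$\mathscr P^\star[\chi](z_0)=\sum_{\alpha\in\mathfrak a}\operatorname*{Res}_{z=\alpha}\Big(\int_\alpha^z\omega_{0,2}^\star(z_0|\cdot)\Big)\chi(z),\qquad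 K^{\star,\alpha}(z_0|z)=\frac{\frac12\int_{\sigma^\alpha(z)}^z\omega_{0,2}^\star(z_0|\cdot)}{\omega_{0,1}(z)-\omega_{0,1}(\sigma^\alpha(z))},\qquad\omega_{0,1}=y\,\mathrm dx$$ (with $z_0$ outside the contours). Put $\omega_{0,2}=\omega_{0,2}^{\mathrm{disc}}$ and, for $2g-2+(1+n)>0$, $$\begin{aligned}\omega_{g,1+n}(z_0|z_1,\dots,z_n)=&\sum_{\alpha}\operatorname*{Res}_{z=\alpha}w^\alpha K^{\mathrm{conn},\alpha}(z_0|z)\,(\mathscr P^{\mathrm{conn}})^{\otimes2}[\omega_{g-1,1+(n+1)}(\cdot|\cdot,z_1,\dots,z_n)](z,\sigma^\alpha(z))\\&+\sum_\alpha\operatorname*{Res}_{z=\alpha}K^{\mathrm{disc},\alpha}(z_0|z)\,(\mathscr P^{\mathrm{disc}})^{\otimes2}\Big[\sum^{*}_{h+h'=g,\,J\sqcup J'=[n]}\omega_{h,1+|J|}(\cdot|z_J)\otimes\omega_{h',1+|J'|}(\cdot|z_{J'})\Big](z,\sigma^\alpha(z)),\end{aligned}$$ where $*$ excludes the terms with a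 factor $\omega_{0,1}$, where $(\mathscr P^{\mathrm{conn}})^{\otimes2}[\omega_{0,2}]$ stands for $\omega_{0,2}^{\mathrm{conn}}$ when $(g,n)=(1,0)$, and where $\mathscr P^{\mathrm{disc}}$ acts as the identity on the factors $\omega_{0,2}(\cdot|z_i)$. **Up/down-morphisms and tensors.** Let $\mathscr V_+$ be the space of germs at $\mathfrak a$ of holomorphic functions that are odd under the local involutions, $\mathscr P^\star_{\mathrm{loc}}$ the operator on germs at $\mathfrak a$ of meromorphic forms given by the same formula as $\mathscr P^\star$, and $\mathscr V^\star_-$ the image under $\mathscr P^\star_{\mathrm{loc}}$ of the germs of meromorphic forms $\chi$ such that $\chi+\sigma^*\chi$ is holomorphic. Let ${\rm U}^\star:\mathscr V_-^\star\to\mathscr V_+$ be injective linear maps with a common image $\check{\mathscr V}_+$, with inverses $\Delta^\star:\check{\mathscr V}_+\to\mathscr V_-^\star$, such that $\mathscr P^{\mathrm{disc}}_{\mathrm{loc}}|_{\mathscr V^{\mathrm{conn}}_-}=\Delta^{\mathrm{disc}}\circ{\rm U}^{\mathrm{conn}}$ and $\mathscr P^{\mathrm{conn}}_{\mathrm{loc}}|_{\mathscr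 V^{\mathrm{disc}}_-}=\Delta^{\mathrm{conn}}\circ{\rm U}^{\mathrm{disc}}$. For $2g-2+(1+n)>0$ and $f_1,\dots,f_n\in\mathscr V_+$ put $$F_{g,1+n}(f_1\otimes\cdots\otimes f_n)=({\rm U}^\star\circ\mathscr P^\star_{\mathrm{loc}})\Big[\sum_{\alpha_1,\dots,\alpha_n\in\mathfrak a}\Big(\prod_{i=1}^n\operatorname*{Res}_{z_i=\alpha_i}f_i(z_i)\Big)\omega_{g,1+n}(z_0|z_1,\dots,z_n)\Big],$$ and $F_{0,1}=F_{0,2}=0$. **Formulae.** Let $\theta^\alpha(z)=-2/(\omega_{0,1}(z)-\omega_{0,1}(\sigma^\alpha(z)))$ and $\chi_1\cdot\chi_2=\chi_1\chi_2\theta^\alpha$ near $\alpha$. Let $\overline{{\rm U}}{}^\star$ be the extension of ${\rm U}^\star$ to germs of meromorphic forms that is zero on $\mathrm d\mathscr V_+$ and on forms that are even under the local involutions. Let $$\kappa[\chi](z_1,z_2)=\chi(z_1)\,w^\alpha\theta^\alpha(z_1)\,\tfrac12\int_{\sigma^\beta(z_2)}^{z_2}\omega_{0,2}^{\mathrm{conn}}(z_1|\cdot)\qquad(z_1\text{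 near }\alpha,\ z_2\text{ near }\beta,\ \alpha,\beta\in\mathfrak a),$$ expanded in $z_2\to\beta$ on the germs $\epsilon_{(\beta,k)}$ equal to $(\zeta^\beta)^{2k+1}/(2k+1)!!$ near $\beta$ and to $0$ near the other points of $\mathfrak a$. Set $$\begin{aligned}A(f_1\otimes f_2)&=\overline{{\rm U}}{}^{\mathrm{disc}}[\mathrm df_1\cdot\mathrm df_2],\qquad B(f_1\otimes f_2)=\overline{{\rm U}}{}^{\mathrm{disc}}[\mathrm df_1\cdot\Delta^{\mathrm{disc}}f_2],\\ C^{\mathrm{conn}}(f)&=(\overline{{\rm U}}{}^{\mathrm{conn}}\otimes\mathrm{id})\,\kappa[\Delta^{\mathrm{conn}}f]=\sum_{\beta,k}C^{\mathrm{conn}}_{(\beta,k)}(f)\otimes\epsilon_{(\beta,k)},\qquad C^{\mathrm{disc}}(f_1\otimes f_2)=\overline{{\rm U}}{}^{\mathrm{disc}}[\Delta^{\mathrm{disc}}f_1\cdot\Delta^{\mathrm{disc}}f_2],\\ D&={\rm U}^{\mathrm{conn}}\Big[\sum_{\alpha}w^\alpha\operatorname*{Res}_{z=\alpha}K^{\mathrm{conn},\alpha}(z_0|z)\,\omega^{\mathrm{conn}}_{0,2}(z|\sigma^\alpha(z))\Big].\end{aligned}$$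 **Proposition.** All these objects are well defined: every germ of meromorphic form is uniquely a sum of an element of $\mathscr V_-^\star$, an element of $\mathrm d\mathscr V_+$ and an even form; the maps ${\rm U}^\star$ are applied to elements of $\mathscr V_-^\star$; and $F_{g,1+n}$ is multilinear, symmetric and independent of $\star$. The tensors $(F_{g,1+n})$ are the amplitudes of the F-Airy structure $(A,B,C^{\mathrm{conn}},C^{\mathrm{disc}},D)$ on $\check{\mathscr V}_+$. That is: let $W\subseteq\mathscr V_+$ be a subspace that contains $\check{\mathscr V}_+$ and all $\epsilon_{(\beta,k)}$ (for instance $W=\mathscr V_+$, or $W=\check{\mathscr V}_+$ if $\check{\mathscr V}_+$ contains the $\epsilon_{(\beta,k)}$), and let $W_{>d}\subseteq W$ be the subspace of germs whose Taylor coefficients in the $\zeta^\beta$ of order at most $2d+1$ vanish. Let $(\check{\mathscr V}_{\le d})_{d\ge0}$ be any increasing exhaustive filtration of $\check{\mathscr V}_+$ by finite-dimensional subspaces. Then the formulae above define linear maps, with $A:W\otimes W\to\check{\mathscr V}_+$ and $C^{\mathrm{disc}}:\check{\mathscr V}_+^{\otimes2}\to\check{\mathscr V}_+$ symmetric, $B:W\otimes\check{\mathscr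 V}_+\to\check{\mathscr V}_+$ and $C^{\mathrm{conn}}:\check{\mathscr V}_+\to\check{\mathscr V}_+\widehat\otimes W$, such that: * for some $\tilde d$: $D\in\check{\mathscr V}_{\le\tilde d}$, $A$ takes values in $\check{\mathscr V}_{\le\tilde d}$ and vanishes when an argument is in $W_{>\tilde d}$; * for some strictly increasing $\varphi:\mathbb Z_{\ge0}\to\mathbb Z_{\ge0}$ and all $d$: $B(W\otimes\check{\mathscr V}_{\le d})\subseteq\check{\mathscr V}_{\le\varphi(d)}$, $B(W_{>\varphi(d)}\otimes\check{\mathscr V}_{\le d})=0$, $C^{\mathrm{conn}}_{(\beta,k)}(\check{\mathscr V}_{\le d})\subseteq\check{\mathscr V}_{\le\varphi(d)}$ for $k\le d$, and $C^{\mathrm{disc}}(\check{\mathscr V}_{\le d}^{\otimes2})\subseteq\check{\mathscr V}_{\le\varphi(d)}$; * $F_{0,3}=A$, $F_{1,1}=D$, and for $2g-2+(1+n)>1$ and $f_1,\dots,f_n\in W$ $$\begin{aligned}F_{g,1+n}(f_1\otimes\cdots\otimes f_n)=&\sum_{m=1}^nB\big(f_m\otimes F_{g,1+(n-1)}(f_1\otimes\cdots\widehat{f_m}\cdots\otimes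 f_n)\big)+\frac12\sum_{\beta,k}C^{\mathrm{conn}}_{(\beta,k)}\big(F_{g-1,1+(n+1)}(f_1\otimes\cdots\otimes f_n\otimes\epsilon_{(\beta,k)})\big)\\&+\frac12\sum_{h+h'=g,\;J\sqcup J'=[n]}C^{\mathrm{disc}}\big(F_{h,1+|J|}(f_J)\otimes F_{h',1+|J'|}(f_{J'})\big),\end{aligned}$$ where the middle term is absent for $g=0$ and has, for every $f_1,\dots,f_n$, only finitely many $(\beta,k)$ with $F_{g-1,1+(n+1)}(f_1\otimes\cdots\otimes f_n\otimes\epsilon_{(\beta,k)})\neq0$. -/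

import Mathlib

open Filter Topology
open scoped Manifold ContDiff Nat

/-!
Conventions.  A `1`-form on a Riemann surface `X` is recorded by its coefficient function `X → ℂ`:
the value at `p` is the value of the form on the tangent vector `1 ∈ T_p X = ℂ`
(`TangentSpace 𝓘(ℂ, ℂ) p` is trivialised by the preferred chart at `p`).  Multidifferentials are
recorded in the same way, in each variable.  A `1`-form near `0 ∈ ℂ` is recorded by its coefficient
with respect to `ds`.
-/

/-- The residue at `s = 0` of the `1`-form `f(s) ds`: the value of `(2πi)⁻¹ ∮ f(s) ds` over
arbitrarily small circles around `0`. -/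
noncomputable def resZero (f : ℂ → ℂ) : ℂ :=
  limUnder (𝓝[>] (0 : ℝ))
    fun r : ℝ => (2 * (Real.pi : ℂ) * Complex.I)⁻¹ * ∮ s in C(0, r), f s

/-- The primitive `∫_0^s g(t) dt`, along the segment from `0` to `s`. -/
noncomputable def primZero (g : ℂ → ℂ) (s : ℂ) : ℂ :=
  ∫ t in (0 : ℝ)..1, g ((t : ℂ) * s) * s

/-- Pullback of the `1`-form `χ(s) ds` under the involution `s ↦ -s`. -/
def sigmaPull (χ : ℂ → ℂ) (s : ℂ) : ℂ := -χ (-s)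

section Surface

variable {X : Type*} [TopologicalSpace X] [ChartedSpace ℂ X]

/-- The velocity vector of `γ : ℂ → X` at `s`, as a number in `T_{γ(s)} X = ℂ`. -/
noncomputable def velocity (γ : ℂ → X) (s : ℂ) : ℂ :=
  (mfderiv 𝓘(ℂ, ℂ) 𝓘(ℂ, ℂ) γ s : ℂ →L[ℂ] ℂ) (1 : ℂ)

/-- Pullback `γ^* χ` of a `1`-form on `X` (as a coefficient with respect to `ds`). -/
noncomputable def pullForm (γ : ℂ → X) (χ : X → ℂ) (s : ℂ) : ℂ := χ (γ s) * velocity γ s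

/-- The function `f` read in the preferred chart at `p`. -/
noncomputable def inChart (p : X) (f : X → ℂ) : ℂ → ℂ := fun s => f ((chartAt ℂ p).symm s)

/-- Meromorphic functions on `X`.  (Normal form: holomorphic at each point that is not a pole; the
value at a pole is `0` by convention.) -/
def IsMeromorphicFunction (f : X → ℂ) : Prop :=
  ∀ p : X, MeromorphicNFAt (inChart p f) (chartAt ℂ p p)

/-- Pullback of a bidifferential under a pair of parametrisations. -/
noncomputable def pullBidiff (γ γ' : ℂ → X) (b : X → X → ℂ) (q : ℂ × ℂ) : ℂ :=
  b (γ q.1) (γ' q.2) * velocity γ q.1 * velocity γ' q.2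

/-- Bidifferentials on `X × X`, not necessarily symmetric, that are holomorphic away from the
diagonal and of the form `ds dt / (s - t)^2 + holomorphic` in a local coordinate near each point of
the diagonal. -/
def IsFundamentalBidiff (b : X → X → ℂ) : Prop :=
  (∀ p q : X, p ≠ q →
    AnalyticAt ℂ (pullBidiff (chartAt ℂ p).symm (chartAt ℂ q).symm b)
      (chartAt ℂ p p, chartAt ℂ q q)) ∧
  ∀ p : X, ∃ h : ℂ × ℂ → ℂ, AnalyticAt ℂ h (chartAt ℂ p p, chartAt ℂ p p) ∧
    ∀ᶠ q : ℂ × ℂ in 𝓝 (chartAt ℂ p p, chartAt ℂ p p), q.1 ≠ q.2 →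
      pullBidiff (chartAt ℂ p).symm (chartAt ℂ p).symm b q = 1 / (q.1 - q.2) ^ 2 + h q

end Surface

/-- The two types of terms: connected and disconnected. -/
inductive Kind : Type
  | conn
  | disc

/-- F-spectral curves `(X, x, y, ω_{0,2}^conn, ω_{0,2}^disc, w)`. -/
structure FSpectralCurve (X : Type*) [TopologicalSpace X] [ChartedSpace ℂ X] where
  x : X → ℂ
  y : X → ℂ
  x_meromorphic : IsMeromorphicFunction x
  y_meromorphic : IsMeromorphicFunction y
  /-- the finite set of ramification points (zeros of `dx`) -/
  ram : Finset X
  mem_ram : ∀ p : X, p ∈ ram ↔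
    AnalyticAt ℂ (inChart p x) (chartAt ℂ p p) ∧ deriv (inChart p x) (chartAt ℂ p p) = 0
  /-- the ramification is simple -/
  ram_simple : ∀ p ∈ ram, deriv (deriv (inChart p x)) (chartAt ℂ p p) ≠ 0
  /-- `dy` is holomorphic and non-zero at the ramification points -/
  dy_ne_zero : ∀ p ∈ ram,
    AnalyticAt ℂ (inChart p y) (chartAt ℂ p p) ∧ deriv (inChart p y) (chartAt ℂ p p) ≠ 0
  /-- `ω_{0,2}^conn` and `ω_{0,2}^disc` -/
  bidiff : Kind → X → X → ℂ
  bidiff_fundamental : ∀ k, IsFundamentalBidiff (bidiff k)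
  /-- the weights -/
  w : ram → ℂ

/-! ### Local objects: families, indexed by the ramification points, of germs at `0 ∈ ℂ` -/

/-- Germs of functions. -/
abbrev LocFun (I : Type*) : Type _ := I → Germ (𝓝 (0 : ℂ)) ℂ

/-- Germs of forms `χ(s) ds` on a punctured neighbourhood. -/
abbrev LocForm (I : Type*) : Type _ := I → Germ (𝓝[≠] (0 : ℂ)) ℂ

/-- A function that represents a germ. -/
noncomputable def germRep {l : Filter ℂ} (f : Germ l ℂ) : ℂ → ℂ := Quotient.out f

/-- Germs of meromorphic forms. -/
def IsMeromorphicLocForm {I : Type*} (χ : LocForm I) : Prop :=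
  ∀ α, MeromorphicAt (germRep (χ α)) 0

/-- Germs of meromorphic forms that are even for the local involution, `σ^* χ = χ`. -/
def IsEvenLocForm {I : Type*} (χ : LocForm I) : Prop :=
  ∀ α, MeromorphicAt (germRep (χ α)) 0 ∧
    ∀ᶠ s in 𝓝[≠] (0 : ℂ), sigmaPull (germRep (χ α)) s = germRep (χ α) s

/-- A meromorphic form whose polar part is odd: `χ + σ^* χ` is holomorphic at `0`. -/
def HasOddPolarPart (χ : ℂ → ℂ) : Prop :=
  MeromorphicAt χ 0 ∧ ∃ h : ℂ → ℂ, AnalyticAt ℂ h 0 ∧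
    ∀ᶠ s in 𝓝[≠] (0 : ℂ), χ s + sigmaPull χ s = h s

/-- The space `V_+` of germs of odd holomorphic functions. -/
def Vplus (I : Type*) : Submodule ℂ (LocFun I) where
  carrier := {f | ∀ α, ∃ ph : ℂ → ℂ, AnalyticAt ℂ ph 0 ∧ (∀ᶠ s in 𝓝 (0 : ℂ), ph (-s) = -ph s) ∧
    f α = (ph : Germ (𝓝 (0 : ℂ)) ℂ)}
  zero_mem' := fun _ => ⟨fun _ => 0, analyticAt_const, by simp, rfl⟩
  add_mem' := by
    intro f g hf hg α
    obtain ⟨ph, h1, h2, h3⟩ := hf α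
    obtain ⟨ψ, k1, k2, k3⟩ := hg α
    refine ⟨ph + ψ, h1.add k1, ?_, ?_⟩
    · filter_upwards [h2, k2] with s hs ks
      simp only [Pi.add_apply, hs, ks]
      ring
    · rw [Pi.add_apply, h3, k3]
      rfl
  smul_mem' := by
    intro c f hf α
    obtain ⟨ph, h1, h2, h3⟩ := hf α
    refine ⟨c • ph, h1.const_smul, ?_, ?_⟩
    · filter_upwards [h2] with s hs
      simp [hs]
    · rw [Pi.smul_apply, h3]
      rfl

/-- The odd germs all of whose Taylor coefficients of order at most `2 d + 1` vanish. -/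
def VplusGt (I : Type*) (d : ℕ) : Submodule ℂ (Vplus I) where
  carrier := {f | ∀ α, ∃ ph : ℂ → ℂ, AnalyticAt ℂ ph 0 ∧
    (f : LocFun I) α = ((fun s => s ^ (2 * d + 2) * ph s : ℂ → ℂ) : Germ (𝓝 (0 : ℂ)) ℂ)}
  zero_mem' := fun _ => ⟨fun _ => 0, analyticAt_const, by simp; rfl⟩
  add_mem' := by
    intro f g hf hg α
    obtain ⟨ph, h1, h3⟩ := hf α
    obtain ⟨ψ, k1, k3⟩ := hg α
    refine ⟨ph + ψ, h1.add k1, ?_⟩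
    rw [Submodule.coe_add, Pi.add_apply, h3, k3, ← Germ.coe_add]
    congr 1
    funext s
    simp only [Pi.add_apply]
    ring
  smul_mem' := by
    intro c f hf α
    obtain ⟨ph, h1, h3⟩ := hf α
    refine ⟨c • ph, h1.const_smul, ?_⟩
    rw [Submodule.coe_smul, Pi.smul_apply, h3, ← Germ.coe_smul]
    congr 1
    funext s
    simp only [Pi.smul_apply, smul_eq_mul]
    ring

/-- The differential `d f` of a germ of function. -/
noncomputable def locD {I : Type*} (f : LocFun I) : LocForm I :=
  fun α => ((deriv (germRep (f α)) : ℂ → ℂ) : Germ (𝓝[≠] (0 : ℂ)) ℂ)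

/-- The odd germ `ε_{(β,k)}`, equal to `s^{2k+1} / (2k+1)!!` at `β` and to `0` elsewhere. -/
noncomputable def epsGerm {I : Type*} [DecidableEq I] (b : I × ℕ) : Vplus I :=
  ⟨fun α => if α = b.1 then
      ((fun s => s ^ (2 * b.2 + 1) / ((2 * b.2 + 1)‼ : ℂ) : ℂ → ℂ) : Germ (𝓝 (0 : ℂ)) ℂ) else 0, by
    change ∀ α, _
    intro α
    by_cases h : α = b.1
    · refine ⟨fun s => s ^ (2 * b.2 + 1) / ((2 * b.2 + 1)‼ : ℂ), ?_, ?_, ?_⟩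
      · fun_prop
      · refine Eventually.of_forall fun s => ?_
        simp only [Odd.neg_pow (⟨b.2, rfl⟩ : Odd (2 * b.2 + 1))]
        ring
      · simp [h]
    · exact ⟨fun _ => 0, analyticAt_const, by simp, by simp [h]; rfl⟩⟩

/-! ### F-Airy structures and their amplitudes -/

/-- The restriction `w_J` of a family `w = (w_0, …, w_{n-1})` to a set of indices, in increasing
order. -/
def subFamily {n : ℕ} {W : Type*} (w : Fin n → W) (J : Finset (Fin n)) : Fin J.card → W :=
  fun i => w (J.orderEmbOfFin rfl i)

/-- F-Airy structures on a (possibly infinite-dimensional) vector space `V` filtered by subspaces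
`V_{≤ d}`.

The inputs are taken in a space `W`, with subspaces `W_{> d}` and elements `e b` of degree `deg b`.
For `W = V = ⨁ V_d`, `W_{> d} = ⨁_{d' > d} V_{d'}` and `e` a homogeneous basis of `V`, this is an
F-Airy structure on the graded space `V`; in general `W` may be larger than `V`, e.g. a completion
of `V`.  A family `(v_b)_b` in `V` stands for the element `∑ v_b ⊗ e_b` of the completed tensor
product of `V` and `W`, where `C^conn` takes its values. -/
structure FAiryStructure {V W J : Type*} [AddCommGroup V] [Module ℂ V] [AddCommGroup W]
    [Module ℂ W] (Vle : ℕ → Submodule ℂ V) (Wgt : ℕ → Submodule ℂ W) (deg : J → ℕ) where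
  A : W →ₗ[ℂ] W →ₗ[ℂ] V
  B : W →ₗ[ℂ] V →ₗ[ℂ] V
  Cconn : V →ₗ[ℂ] (J → V)
  Cdisc : V →ₗ[ℂ] V →ₗ[ℂ] V
  D : V
  A_symm : ∀ w w', A w w' = A w' w
  Cdisc_symm : ∀ v v', Cdisc v v' = Cdisc v' v
  /-- `A` factors through `W / W_{> d}` and `A`, `D` take values in `V_{≤ d}` for some `d` -/
  finite_AD : ∃ d, D ∈ Vle d ∧ (∀ w w', A w w' ∈ Vle d) ∧ ∀ w ∈ Wgt d, ∀ w', A w w' = 0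
  /-- the finiteness conditions on `B`, `C^conn`, `C^disc` -/
  finite_BC : ∃ ph : ℕ → ℕ, StrictMono ph ∧ ∀ d,
    (∀ w, ∀ v ∈ Vle d, B w v ∈ Vle (ph d)) ∧
    (∀ w ∈ Wgt (ph d), ∀ v ∈ Vle d, B w v = 0) ∧
    (∀ v ∈ Vle d, ∀ b, deg b ≤ d → Cconn v b ∈ Vle (ph d)) ∧
    (∀ v ∈ Vle d, ∀ v' ∈ Vle d, Cdisc v v' ∈ Vle (ph d))

/-- The connected term `(id ⊗ tr) (C^conn ∘ F_{g-1,1+(n+1)}(w ⊗ -))` of F-topological recursion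
(zero for `g = 0`). -/
noncomputable def FAiryStructure.connTerm {V W J : Type*} [AddCommGroup V] [Module ℂ V]
    [AddCommGroup W] [Module ℂ W] {Vle : ℕ → Submodule ℂ V} {Wgt : ℕ → Submodule ℂ W}
    {deg : J → ℕ} (T : FAiryStructure Vle Wgt deg) (e : J → W)
    (F : ∀ _ n : ℕ, (Fin n → W) → V) : ∀ _ n : ℕ, (Fin n → W) → V
  | 0, _, _ => 0
  | g + 1, n, w => ∑ᶠ b : J, T.Cconn (F g (n + 1) (Fin.snoc w (e b))) b

/-- `F` is the family of amplitudes of the F-Airy structure `T`: the unstable terms `F_{0,1}` and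
`F_{0,2}` are zero, `F_{0,3} = A`, `F_{1,1} = D`, and the recursion holds for
`2g - 2 + (1 + n) > 1`; the trace in its connected term is a finite sum. -/
def FAiryStructure.IsAmplitudes {V W J : Type*} [AddCommGroup V] [Module ℂ V]
    [AddCommGroup W] [Module ℂ W] {Vle : ℕ → Submodule ℂ V} {Wgt : ℕ → Submodule ℂ W}
    {deg : J → ℕ} (T : FAiryStructure Vle Wgt deg) (e : J → W)
    (F : ∀ _ n : ℕ, (Fin n → W) → V) : Prop :=
  (∀ w, F 0 0 w = 0) ∧ (∀ w, F 0 1 w = 0) ∧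
  (∀ w, F 0 2 w = T.A (w 0) (w 1)) ∧ (∀ w, F 1 0 w = T.D) ∧
  (∀ g n, 2 ≤ 2 * g + (n + 1) → ∀ w : Fin n → W,
    {b : J | F g (n + 1) (Fin.snoc w (e b)) ≠ 0}.Finite) ∧
  ∀ g n, 3 ≤ 2 * g + n → ∀ w : Fin n → W,
    F g n w =
      ∑ m : Fin n, T.B (w m) (F g (({m}ᶜ : Finset (Fin n)).card) (subFamily w {m}ᶜ))
      + (1 / 2 : ℂ) • T.connTerm e F g n w
      + (1 / 2 : ℂ) • ∑ h ∈ Finset.range (g + 1), ∑ J : Finset (Fin n),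
          T.Cdisc (F h J.card (subFamily w J)) (F (g - h) Jᶜ.card (subFamily w Jᶜ))

namespace FSpectralCurve

variable {X : Type*} [TopologicalSpace X] [ChartedSpace ℂ X]

/-- A choice, for each ramification point `α`, of a determination of the local coordinate
`ζ^α = √(2 (x - x(α)))`, given by the inverse parametrisation `s ↦ γ_α(s)` (so `ζ^α(γ_α(s)) = s`).
In this coordinate the local involution `σ^α` is `γ_α(s) ↦ γ_α(-s)`. -/
structure SqrtCoordinates (S : FSpectralCurve X) where
  γ : S.ram → ℂ → X
  γ_zero : ∀ α, γ α 0 = α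
  γ_holomorphic : ∀ α, ∀ᶠ s in 𝓝 (0 : ℂ), MDifferentiableAt 𝓘(ℂ, ℂ) 𝓘(ℂ, ℂ) (γ α) s
  x_γ : ∀ α, ∀ᶠ s in 𝓝 (0 : ℂ), S.x (γ α s) = S.x α + s ^ 2 / 2

/-- Square roots of non-vanishing analytic germs. -/
theorem exists_analytic_sqrt (G : ℂ → ℂ) (a : ℂ) (hG : AnalyticAt ℂ G a) (h0 : G a ≠ 0) :
    ∃ r : ℂ → ℂ, AnalyticAt ℂ r a ∧ r a ≠ 0 ∧ ∀ᶠ z in 𝓝 a, r z ^ 2 = G z := by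
  refine ⟨fun z => (G a) ^ (1 / 2 : ℂ) * (G z / G a) ^ (1 / 2 : ℂ), ?_, ?_, ?_⟩
  · refine analyticAt_const.mul ((hG.div analyticAt_const h0).cpow analyticAt_const ?_)
    simp [div_self h0, Complex.slitPlane]
  · simp [div_self h0, Complex.cpow_eq_zero_iff, h0]
  · have hne : ∀ᶠ z in 𝓝 a, G z ≠ 0 := hG.continuousAt.eventually_ne h0
    filter_upwards [hne] with z hz
    have e : ∀ t : ℂ, t ≠ 0 → (t ^ (1 / 2 : ℂ)) ^ 2 = t := by
      intro t _
      rw [← Complex.cpow_nat_mul]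
      norm_num
    rw [mul_pow, e _ h0, e _ (div_ne_zero hz h0), mul_div_cancel₀ _ h0]

/-- Near a simple critical point `a`, `f = f(a) + s^2 / 2` in a suitable parametrisation. -/
theorem exists_sqrt_parametrisation (f : ℂ → ℂ) (a : ℂ) (hf : AnalyticAt ℂ f a) (h1 : deriv f a = 0)
    (h2 : deriv (deriv f) a ≠ 0) :
    ∃ ρ : ℂ → ℂ, AnalyticAt ℂ ρ 0 ∧ ρ 0 = a ∧ ∀ᶠ s in 𝓝 0, f (ρ s) = f a + s ^ 2 / 2 := by
  have hg : AnalyticAt ℂ (fun z => f z - f a) a := hf.sub analyticAt_const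
  have hord : analyticOrderAt (fun z => f z - f a) a = (2 : ℕ) := by
    rw [analyticOrderAt_eq_nat_iff_iteratedDeriv_eq_zero hg]
    have hd : deriv (fun z => f z - f a) = deriv f := by
      funext z; simp
    refine ⟨?_, ?_⟩
    · intro k hk
      interval_cases k
      · simp
      · simp [iteratedDeriv_one, hd, h1]
    · rw [iteratedDeriv_succ, iteratedDeriv_one, hd]
      exact h2
  obtain ⟨G, hG, hG0, hfG⟩ := hg.analyticOrderAt_eq_natCast.1 hord
  obtain ⟨r, hr, hr0, hrG⟩ := exists_analytic_sqrt (fun z => 2 * G z) a (analyticAt_const.mul hG)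
    (by simpa using hG0)
  obtain ⟨Z, hZ⟩ : ∃ Z : ℂ → ℂ, ∀ z, Z z = (z - a) * r z := ⟨_, fun _ => rfl⟩
  have hZf : Z = fun z => (z - a) * r z := funext hZ
  have hz : AnalyticAt ℂ Z a := by rw [hZf]; fun_prop
  have hzd : HasDerivAt Z (r a) a := by
    rw [hZf]
    have := ((hasDerivAt_id a).sub_const a).fun_mul hr.differentiableAt.hasDerivAt
    simpa using this
  have hz' : deriv Z a ≠ 0 := by rw [hzd.deriv]; exact hr0
  have e0 : Z a = 0 := by simp [hZ]
  have hl := hz.analyticAt_localInverse hz'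
  have hla : hz.hasStrictDerivAt.localInverse _ _ _ hz' (Z a) = a :=
    HasStrictFDerivAt.localInverse_apply_image ..
  have hre := hz.hasStrictDerivAt.eventually_right_inverse hz'
  rw [e0] at hl hla hre
  set ρ := hz.hasStrictDerivAt.localInverse _ _ _ hz'
  refine ⟨ρ, hl, hla, ?_⟩
  have hc : Tendsto ρ (𝓝 0) (𝓝 a) := by
    have := hl.continuousAt.tendsto
    rwa [hla] at this
  filter_upwards [hre, hc.eventually hfG, hc.eventually hrG] with s h1 h2 h3
  simp only [smul_eq_mul] at h2
  have h4 : f (ρ s) = f a + (ρ s - a) ^ 2 * G (ρ s) := by linear_combination h2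
  have h5 : s ^ 2 = (ρ s - a) ^ 2 * r (ρ s) ^ 2 := by rw [← mul_pow, ← hZ, h1]
  rw [h4, h5, h3]
  ring

/-- Local coordinates `√(2 (x - x(α)))` exist at all ramification points. -/
theorem SqrtCoordinates.nonempty [IsManifold 𝓘(ℂ, ℂ) ω X] (S : FSpectralCurve X) :
    Nonempty S.SqrtCoordinates := by
  have key : ∀ α : S.ram, ∃ ρ : ℂ → ℂ, AnalyticAt ℂ ρ 0 ∧ ρ 0 = chartAt ℂ (α : X) α ∧
      ∀ᶠ s in 𝓝 0, inChart (α : X) S.x (ρ s) = S.x α + s ^ 2 / 2 := by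
    intro α
    have h := (S.mem_ram α).1 α.2
    have := exists_sqrt_parametrisation _ _ h.1 h.2 (S.ram_simple α α.2)
    simpa [inChart] using this
  choose ρ h1 h2 h3 using key
  refine ⟨⟨fun α s => (chartAt ℂ (α : X)).symm (ρ α s), fun α => by simp [h2], ?_, fun α => h3 α⟩⟩
  intro α
  have hc : Tendsto (ρ α) (𝓝 0) (𝓝 (chartAt ℂ (α : X) α)) := by
    have := (h1 α).continuousAt.tendsto
    rwa [h2] at this
  have ht : ∀ᶠ s in 𝓝 (0 : ℂ), ρ α s ∈ (chartAt ℂ (α : X)).target :=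
    hc.eventually ((chartAt ℂ (α : X)).open_target.mem_nhds (mem_chart_target ℂ _))
  filter_upwards [ht, (h1 α).eventually_analyticAt] with s hs ha
  have hsymm := mdifferentiableAt_atlas_symm (I := 𝓘(ℂ, ℂ)) (chart_mem_atlas ℂ (α : X)) hs
  exact hsymm.comp s ha.differentiableAt.mdifferentiableAt

/-- The form `ω_{0,1} = y dx`. -/
noncomputable def omega01 (S : FSpectralCurve X) (p : X) : ℂ :=
  let dx : ℂ →L[ℂ] ℂ := mfderiv 𝓘(ℂ, ℂ) 𝓘(ℂ, ℂ) S.x p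
  S.y p * dx 1

variable {S : FSpectralCurve X} (c : S.SqrtCoordinates)

namespace SqrtCoordinates

/-! ### Residue kernels and multidifferentials -/

/-- Restriction of a form on `X` to (functions that represent) germs at the ramification points. -/
noncomputable def restr (χ : X → ℂ) : S.ram → ℂ → ℂ := fun α => pullForm (c.γ α) χ

/-- The form `z₀ ↦ ∑_α Res_{z = α} (∫_α^z ω_{0,2}(z₀ | ·)) χ(z)` on `X`, for `χ` given near the
ramification points. -/
noncomputable def projAux (k : Kind) (χ : S.ram → ℂ → ℂ) (z₀ : X) : ℂ :=
  ∑ α : S.ram, resZero fun s => primZero (pullForm (c.γ α) (S.bidiff k z₀)) s * χ α s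

/-- The projector `P` on forms on `X`. -/
noncomputable def proj (k : Kind) (χ : X → ℂ) : X → ℂ := c.projAux k (c.restr χ)

/-- `P ⊗ P` on bidifferentials. -/
noncomputable def proj2 (k : Kind) (χ : X → X → ℂ) (z z' : X) : ℂ :=
  c.proj k (fun u => c.proj k (fun v => χ u v) z') z

/-- `ω_{0,1}(z) - ω_{0,1}(σ^α(z))` at `z = γ_α(s)`, as a coefficient of `ds`. -/
noncomputable def deltaOmega01 (α : S.ram) (s : ℂ) : ℂ :=
  pullForm (c.γ α) S.omega01 s - sigmaPull (pullForm (c.γ α) S.omega01) s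

/-- The integral `½ ∫_{σ^α(z)}^z ω_{0,2}(z₀ | ·)` at `z = γ_α(s)`. -/
noncomputable def halfInt (k : Kind) (α : S.ram) (z₀ : X) (s : ℂ) : ℂ :=
  (1 / 2 : ℂ) * (primZero (pullForm (c.γ α) (S.bidiff k z₀)) s -
    primZero (pullForm (c.γ α) (S.bidiff k z₀)) (-s))

/-- The recursion kernel `K^α(z₀ | z)` at `z = γ_α(s)`, as a coefficient of `1 / ds`. -/
noncomputable def kernel (k : Kind) (α : S.ram) (z₀ : X) (s : ℂ) : ℂ :=
  c.halfInt k α z₀ s / c.deltaOmega01 α s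

/-- `χ(z, σ^α(z))` at `z = γ_α(s)`, as a coefficient of `ds²`. -/
noncomputable def diagPull (α : S.ram) (χ : X → X → ℂ) (s : ℂ) : ℂ :=
  pullForm (c.γ α) (fun z => sigmaPull (pullForm (c.γ α) (χ z)) s) s

/-- The weights in front of the recursion kernels: `w^α` (connected) and `1` (disconnected). -/
noncomputable def weight (S : FSpectralCurve X) : Kind → S.ram → ℂ
  | Kind.conn, α => S.w α
  | Kind.disc, _ => 1

/-- `∑_α Res_{z = α} weight^α K^α(z₀ | z) χ(z, σ^α(z))`. -/
noncomputable def kernelOp (k : Kind) (χ : X → X → ℂ) (z₀ : X) : ℂ :=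
  ∑ α : S.ram, resZero fun s => weight S k α * c.kernel k α z₀ s * c.diagPull α χ s

/-- The multidifferentials `ω_{g,1+n}(z₀ | z_1, …, z_n)`.  In the connected term, `P ⊗ P` of
`ω_{0,2}` is replaced by `ω_{0,2}^conn`; in the disconnected term, the terms with a factor
`ω_{0,1}` are excluded and `P` acts as the identity on factors `ω_{0,2}(· | z_i)`. -/
noncomputable def omega (g n : ℕ) (z₀ : X) (z : Fin n → X) : ℂ :=
  if g = 0 ∧ n = 0 then S.omega01 z₀
  else if h2 : g = 0 ∧ n = 1 then S.bidiff Kind.disc z₀ (z ⟨0, by omega⟩)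
  else
    (match hg : g with
      | 0 => 0
      | g' + 1 => c.kernelOp Kind.conn
          (if g' = 0 ∧ n = 0 then S.bidiff Kind.conn
            else c.proj2 Kind.conn fun u v => omega g' (n + 1) u (Fin.cons v z)) z₀)
    + c.kernelOp Kind.disc
        (fun u v => ∑ h : Fin (g + 1), ∑ J : Finset (Fin n),
          if hst : ¬ ((h : ℕ) = 0 ∧ J.card = 0) ∧ ¬ (g - (h : ℕ) = 0 ∧ Jᶜ.card = 0) then
            (if (h : ℕ) = 0 ∧ J.card = 1 then omega h J.card u (subFamily z J)
              else c.proj Kind.disc (fun p => omega h J.card p (subFamily z J)) u) *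
            (if g - (h : ℕ) = 0 ∧ Jᶜ.card = 1 then omega (g - h) Jᶜ.card v (subFamily z Jᶜ)
              else c.proj Kind.disc (fun p => omega (g - h) Jᶜ.card p (subFamily z Jᶜ)) v)
          else 0) z₀
termination_by 2 * g + n
decreasing_by
  all_goals
    first
    | omega
    | (have hJ := Finset.card_add_card_compl J
       rw [Fintype.card_fin] at hJ
       have hh := h.2
       omega)

/-! ### Local projectors and up/down-morphisms -/

/-- The local projector `P_loc` on germs of forms at the ramification points. -/
noncomputable def projLoc (k : Kind) (χ : LocForm S.ram) : LocForm S.ram :=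
  fun β => ((c.restr (c.projAux k fun α => germRep (χ α)) β : ℂ → ℂ) : Germ (𝓝[≠] (0 : ℂ)) ℂ)

/-- The germs at the ramification points of a form on `X`. -/
noncomputable def toLoc (χ : X → ℂ) : LocForm S.ram :=
  fun α => ((c.restr χ α : ℂ → ℂ) : Germ (𝓝[≠] (0 : ℂ)) ℂ)

/-- The space `V_-`: the image by `P_loc` of the space of germs of meromorphic forms whose polar
part is odd.  (`P_loc` being linear on it, the image is already a subspace.) -/
noncomputable def Vminus (k : Kind) : Submodule ℂ (LocForm S.ram) :=
  Submodule.span ℂ (c.projLoc k '' {χ | ∀ α, HasOddPolarPart (germRep (χ α))})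

/-- Compatible up/down-morphisms: injective linear maps `U : V_- → V_+` of both kinds with the same
image `Vcheck`, with the down-morphisms `Δ = U⁻¹ : Vcheck → V_-`. -/
structure UpDown where
  Vcheck : Submodule ℂ (Vplus S.ram)
  U : ∀ k, c.Vminus k ≃ₗ[ℂ] Vcheck
  compat_disc : ∀ v : c.Vminus Kind.conn,
    c.projLoc Kind.disc v = (U Kind.disc).symm (U Kind.conn v)
  compat_conn : ∀ v : c.Vminus Kind.disc,
    c.projLoc Kind.conn v = (U Kind.conn).symm (U Kind.disc v)

/-- `θ^α = -2 / (ω_{0,1}(z) - ω_{0,1}(σ^α(z)))`, as a coefficient of `1 / ds`. -/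
noncomputable def theta (α : S.ram) (s : ℂ) : ℂ := -2 / c.deltaOmega01 α s

/-- The product `χ₁ · χ₂ = χ₁ χ₂ θ` of germs of forms. -/
noncomputable def dotProd (χ₁ χ₂ : LocForm S.ram) : LocForm S.ram :=
  fun α => χ₁ α * χ₂ α * ((c.theta α : ℂ → ℂ) : Germ (𝓝[≠] (0 : ℂ)) ℂ)

/-- `κ[χ](z_1, z_2) = χ(z_1) w^α θ^α(z_1) ½ ∫_{σ(z_2)}^{z_2} ω_{0,2}^conn(z_1 | ·)` for
`z_1 = γ_α(s_1)` and `z_2 = γ_β(s_2)`, as a coefficient of `ds_1`. -/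
noncomputable def kappa (χ : LocForm S.ram) (α : S.ram) (s₁ : ℂ) (β : S.ram) (s₂ : ℂ) : ℂ :=
  germRep (χ α) s₁ * S.w α * c.theta α s₁ *
    (c.halfInt Kind.conn β (c.γ α s₁) s₂ * velocity (c.γ α) s₁)

/-- The coefficient of `κ[χ](z_1, z_2)` on `ε_{(β,k)}(z_2)`, in the Taylor expansion in `z_2` near
`β` (i.e. with `z_2` closer to `β` than `z_1`). -/
noncomputable def kappaCoeff (χ : LocForm S.ram) (b : S.ram × ℕ) : LocForm S.ram :=
  fun α => ((fun s₁ => ((2 * b.2 + 1)‼ : ℂ) *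
    (iteratedDeriv (2 * b.2 + 1) (c.kappa χ α s₁ b.1) 0 / ((2 * b.2 + 1)! : ℂ)) : ℂ → ℂ) :
      Germ (𝓝[≠] (0 : ℂ)) ℂ)

/-- The form `∑_α w^α Res_{z = α} K^{conn,α}(z₀ | z) ω_{0,2}^conn(z | σ^α(z))`. -/
noncomputable def formD : X → ℂ := c.kernelOp Kind.conn (S.bidiff Kind.conn)

/-- The iterated residue `∑_{α_1, …, α_n} (∏_i Res_{z_i = α_i} f_i(z_i)) Φ(z_1, …, z_n)`. -/
noncomputable def iterRes : ∀ n : ℕ, ((Fin n → X) → ℂ) → (Fin n → Vplus S.ram) → ℂ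
  | 0, Φ, _ => Φ Fin.elim0
  | n + 1, Φ, f => ∑ α : S.ram, resZero fun s => germRep ((f 0 : LocFun S.ram) α) s *
      pullForm (c.γ α) (fun p => iterRes n (fun z => Φ (Fin.cons p z)) (Fin.tail f)) s

/-- The form `z₀ ↦ ∑_{α_1, …, α_n} (∏_i Res_{z_i = α_i} f_i(z_i)) ω_{g,1+n}(z₀ | z_1, …, z_n)`. -/
noncomputable def smeared (g n : ℕ) (f : Fin n → Vplus S.ram) (z₀ : X) : ℂ :=
  c.iterRes n (fun z => c.omega g n z₀ z) f

end SqrtCoordinates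

namespace SqrtCoordinates.UpDown

variable {c} (u : c.UpDown)

open Classical in
/-- `U` applied to a germ of form (which has to lie in `V_-`; else the value is `0`). -/
noncomputable def up (k : Kind) (χ : LocForm S.ram) : u.Vcheck :=
  if h : χ ∈ c.Vminus k then u.U k ⟨χ, h⟩ else 0

/-- The down-morphism `Δ`. -/
noncomputable def down (k : Kind) (v : u.Vcheck) : LocForm S.ram := (u.U k).symm v

open Classical in
/-- The extension `Ū` of `U` to all germs of meromorphic forms that is zero on `d V_+` and on the
even forms. -/
noncomputable def upBar (k : Kind) (χ : LocForm S.ram) : u.Vcheck :=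
  if h : ∃ v : c.Vminus k, ∃ f : Vplus S.ram, ∃ e : LocForm S.ram,
      IsEvenLocForm e ∧ χ = (v : LocForm S.ram) + locD (f : LocFun S.ram) + e
    then u.U k h.choose else 0

open Classical in
/-- The tensors `F_{g,1+n}(f_1 ⊗ ⋯ ⊗ f_n)`, computed with the projector and up-morphism of the given
kind; the unstable ones are zero by convention.  The definition makes sense for all `f_i` in
`V_+`. -/
noncomputable def tensorF (k : Kind) (g n : ℕ) (f : Fin n → Vplus S.ram) : u.Vcheck :=
  if 2 ≤ 2 * g + n then u.up k (c.projLoc k (c.toLoc (c.smeared g n f))) else 0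

end SqrtCoordinates.UpDown

end FSpectralCurve

/-! ### Residues of meromorphic germs at `0` -/

/-! Everything factors through odd principal parts: the finitely supported families of coefficients
of `s ^ (-2 j - 2)` at the ramification points (`PrincipalPart`, `pp`). The kernel `½ ∫ ω_{0,2}` is
odd in `s`, so a residue against it sees only these coefficients (`res_odd_mul`, `sum_res_halfInt`),
and on forms with odd polar part the even half of the primitive in the projector contributes nothing
(`projAux_eq`). Each projector therefore acts as `Lam k ∘ pp`, where `Lam k` combines basic forms
`xi k b` with prescribed double-pole-type singularities, and `pp` is a left inverse of each `Lam k`.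
Both spaces `V_-` are thus copies of one space of principal parts (`Vminus_eq`), and the
compatibility of the up-morphisms makes `U^conn` and `U^disc` induce the same isomorphism `ppEquiv`
onto `Vcheck` (`U_LamEquiv`).

The vector field coefficient `θ` is even with a double pole. For two forms with odd polar part this
lets the reflection in `χ(z) χ'(σ(z))` be dropped up to a sign (`oddCoeff_mul_comp_neg`), so the
residue operators of the recursion become one symmetric bilinear map, `quad`: the principal part of
`χ χ' θ`. The tensors `A`, `B`, `C^conn`, `C^disc` are `quad` evaluated on differentials `d f` and
on lifts `Lam k v`, transported by `ppEquiv`.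

The recursion is then solved on principal parts. Its solution `amp` takes a multiset of odd germs,
so it is symmetric by construction; linearity, bounded poles and dependence on finitely many Taylor
coefficients are propagated together (`IsAmplitudePP`), and the last property makes every expansion
and trace finite. By induction `ω_{g,1+n}` is the lift of the connected step by forms of kind `conn`
plus that of the disconnected step by forms of kind `disc`, evaluated on germs `inp z_i`
(`omega_eq`). As forms in `z`, the Taylor coefficients of `inp z` have singular parts `sing b`, so
iterated residues against the `f_i` replace `inp z_i` by `f_i` (`iterRes_eq`). Either projector
merges the two lifts, whence `F = ppEquiv (amp …)` for both kinds (`tensorF_eq`).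

Sorting the disconnected step by the number of factors `ω_{0,2}` gives the F-Airy form: two such
factors give `A`, one gives `B`, none gives `C^disc` (`discStep_amp`). -/

theorem eventually_forall_mem_sphere {p : ℂ → Prop} (h : ∀ᶠ s in 𝓝[≠] (0 : ℂ), p s) :
    ∀ᶠ r in 𝓝[>] (0 : ℝ), ∀ s ∈ Metric.sphere (0 : ℂ) r, p s := by
  rw [eventually_nhdsWithin_iff, Metric.eventually_nhds_iff] at h
  obtain ⟨ε, hε, h⟩ := h
  filter_upwards [Ioo_mem_nhdsGT hε] with r hr s hs
  have hs' : ‖s‖ = r := by simpa using hs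
  refine h (by simpa [hs'] using hr.2) ?_
  intro h0
  rw [Set.mem_singleton_iff.1 h0, norm_zero] at hs'
  exact hr.1.ne hs'

theorem tendsto_neg_punctured : Tendsto (fun s : ℂ => -s) (𝓝[≠] 0) (𝓝[≠] 0) := by
  refine tendsto_nhdsWithin_iff.2 ⟨?_, ?_⟩
  · have h : Tendsto (fun s : ℂ => -s) (𝓝 0) (𝓝 (-0)) := tendsto_neg 0
    rw [neg_zero] at h
    exact h.mono_left nhdsWithin_le_nhds
  · filter_upwards [self_mem_nhdsWithin] with s hs
    simpa using hs

theorem tendsto_neg_zero : Tendsto (fun s : ℂ => -s) (𝓝 0) (𝓝 0) := by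
  simpa using (tendsto_neg (0 : ℂ))

/-- On all small circles, `f` is integrable with `(2πi)⁻¹ ∮ f = a`. -/
def HasRes (f : ℂ → ℂ) (a : ℂ) : Prop :=
  ∀ᶠ r in 𝓝[>] (0 : ℝ), CircleIntegrable f 0 r ∧
    (2 * (Real.pi : ℂ) * Complex.I)⁻¹ * ∮ s in C(0, r), f s = a

theorem HasRes.resZero_eq {f : ℂ → ℂ} {a : ℂ} (h : HasRes f a) : resZero f = a := by
  refine Tendsto.limUnder_eq (tendsto_const_nhds.congr' ?_)
  filter_upwards [h] with r hr using hr.2.symm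

theorem HasRes.congr {f g : ℂ → ℂ} {a : ℂ} (h : HasRes f a) (hfg : f =ᶠ[𝓝[≠] 0] g) :
    HasRes g a := by
  filter_upwards [h, eventually_forall_mem_sphere hfg, self_mem_nhdsWithin] with r hr he h0
  have h0' : (0 : ℝ) ≤ r := le_of_lt h0
  refine ⟨(circleIntegrable_congr fun s hs => he s (by simpa [abs_of_nonneg h0'] using hs)).1 hr.1,
    ?_⟩
  · rw [← hr.2, circleIntegral.integral_congr h0' (fun s hs => (he s hs).symm)]

theorem HasRes.add {f g : ℂ → ℂ} {a b : ℂ} (hf : HasRes f a) (hg : HasRes g b) :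
    HasRes (fun s => f s + g s) (a + b) := by
  filter_upwards [hf, hg] with r h1 h2
  refine ⟨h1.1.add h2.1, ?_⟩
  rw [circleIntegral.integral_add h1.1 h2.1, mul_add, h1.2, h2.2]

theorem HasRes.const_mul {f : ℂ → ℂ} {a : ℂ} (hf : HasRes f a) (k : ℂ) :
    HasRes (fun s => k * f s) (k * a) := by
  filter_upwards [hf] with r h1
  refine ⟨h1.1.const_smul (a := k), ?_⟩
  rw [circleIntegral.integral_const_mul, mul_left_comm, h1.2]

theorem hasRes_zero : HasRes (fun _ => 0) 0 := by
  refine Eventually.of_forall fun r => ⟨?_, ?_⟩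
  · exact circleIntegrable_const 0 0 r
  · simp [circleIntegral]

theorem HasRes.sum {ι : Type*} (t : Finset ι) {f : ι → ℂ → ℂ} {a : ι → ℂ}
    (h : ∀ i ∈ t, HasRes (f i) (a i)) : HasRes (fun s => ∑ i ∈ t, f i s) (∑ i ∈ t, a i) := by
  classical
  induction t using Finset.induction_on with
  | empty => simpa using hasRes_zero
  | insert i t hi ih =>
    simp only [Finset.sum_insert hi]
    exact (h i (Finset.mem_insert_self _ _)).add
      (ih fun j hj => h j (Finset.mem_insert_of_mem hj))

theorem hasRes_of_analyticAt {f : ℂ → ℂ} (hf : AnalyticAt ℂ f 0) : HasRes f 0 := by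
  obtain ⟨ε, hε, h⟩ := Metric.eventually_nhds_iff.1 hf.eventually_analyticAt
  filter_upwards [Ioo_mem_nhdsGT hε] with r hr
  have hd : ∀ z ∈ Metric.closedBall (0 : ℂ) r, DifferentiableAt ℂ f z := fun z hz =>
    (h (lt_of_le_of_lt (Metric.mem_closedBall.1 hz) hr.2)).differentiableAt
  have hc : ContinuousOn f (Metric.closedBall 0 r) := fun z hz =>
    (hd z hz).continuousAt.continuousWithinAt
  refine ⟨(hc.mono Metric.sphere_subset_closedBall).circleIntegrable hr.1.le, ?_⟩
  rw [Complex.circleIntegral_eq_zero_of_differentiable_on_off_countable hr.1.le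
    Set.countable_empty hc fun z hz => hd z (Metric.ball_subset_closedBall hz.1), mul_zero]

theorem hasRes_inv_pow (n : ℕ) :
    HasRes (fun s => (s ^ (n + 1))⁻¹) (if n = 0 then 1 else 0) := by
  filter_upwards [self_mem_nhdsWithin] with r hr
  have hr' : (0 : ℝ) < r := hr
  refine ⟨?_, ?_⟩
  · refine ContinuousOn.circleIntegrable hr'.le ?_
    refine ContinuousOn.inv₀ (by fun_prop) fun s hs => pow_ne_zero _ ?_
    rintro rfl
    simp only [mem_sphere_iff_norm, sub_zero, norm_zero] at hs
    exact hr'.ne hs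
  · have hz : ∀ s : ℂ, (s ^ (n + 1))⁻¹ = (s - 0) ^ (-(n + 1 : ℕ) : ℤ) := by
      intro s
      rw [sub_zero, zpow_neg, zpow_natCast]
    simp only [hz]
    by_cases hn : n = 0
    · subst hn
      have := circleIntegral.integral_sub_center_inv (0 : ℂ) hr'.ne'
      simp only [zero_add, Nat.cast_one, zpow_neg, zpow_one, if_true, this]
      exact inv_mul_cancel₀ Complex.two_pi_I_ne_zero
    · rw [circleIntegral.integral_sub_zpow_of_ne (by omega), if_neg hn, mul_zero]

/-- Decomposition of a meromorphic function into its polar part and a holomorphic part. -/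
theorem MeromorphicAt.exists_polar_decomposition {f : ℂ → ℂ} (hf : MeromorphicAt f 0) :
    ∃ (N : ℕ) (a b : ℕ → ℂ) (h : ℂ → ℂ), AnalyticAt ℂ h 0 ∧ ∀ᶠ s in 𝓝[≠] (0 : ℂ),
      f s = (∑ j ∈ Finset.range N, (a j * (s ^ (2 * j + 1))⁻¹ + b j * (s ^ (2 * j + 2))⁻¹)) + h s := by
  obtain ⟨n, hn⟩ := hf
  have key : ∀ (N : ℕ) (g : ℂ → ℂ), AnalyticAt ℂ g 0 → ∃ (a b : ℕ → ℂ) (h : ℂ → ℂ),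
      AnalyticAt ℂ h 0 ∧ ∀ s : ℂ, s ≠ 0 → (s ^ (2 * N))⁻¹ * g s =
        (∑ j ∈ Finset.range N, (a j * (s ^ (2 * j + 1))⁻¹ + b j * (s ^ (2 * j + 2))⁻¹)) + h s := by
    intro N
    induction N with
    | zero => exact fun g hg => ⟨0, 0, g, hg, fun s _ => by simp⟩
    | succ N ih =>
      intro g hg
      obtain ⟨G, hG, hgG⟩ := hg.exists_eq_sum_add_pow_mul (n := 2)
      obtain ⟨a, b, h, hh, he⟩ := ih G hG
      -- Dividing the Taylor expansion of `g` by `s ^ (2 * N + 2)` puts `g 0` at order `-2 N - 2`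
      -- and `g' 0` at order `-2 N - 1`; the remainder `G` goes to the induction hypothesis.
      refine ⟨Function.update a N (deriv g 0), Function.update b N (g 0), h, hh, fun s hs => ?_⟩
      rw [Finset.sum_range_succ]
      have e1 : ∑ j ∈ Finset.range N, (Function.update a N (deriv g 0) j * (s ^ (2 * j + 1))⁻¹ +
          Function.update b N (g 0) j * (s ^ (2 * j + 2))⁻¹) =
          ∑ j ∈ Finset.range N, (a j * (s ^ (2 * j + 1))⁻¹ + b j * (s ^ (2 * j + 2))⁻¹) := by
        refine Finset.sum_congr rfl fun j hj => ?_
        have : j ≠ N := (Finset.mem_range.1 hj).ne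
        simp [Function.update_of_ne this]
      have e2 := he s hs
      have e3 := hgG s
      simp only [Finset.sum_range_succ, Finset.sum_range_zero, iteratedDeriv_zero,
        iteratedDeriv_one, smul_eq_mul] at e3
      rw [e1, add_right_comm, ← e2, e3]
      simp only [Function.update_self]
      field_simp
      norm_num
      ring
  -- The extra factor `s ^ n` makes the exponent the even number `2 n`, as `key` requires.
  have hg : AnalyticAt ℂ (fun s : ℂ => s ^ n * ((s - 0) ^ n • f s)) 0 := by fun_prop
  obtain ⟨a, b, h, hh, he⟩ := key n _ hg
  refine ⟨n, a, b, h, hh, ?_⟩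
  filter_upwards [self_mem_nhdsWithin] with s hs
  have hs' : s ≠ 0 := by simpa using hs
  rw [← he s hs']
  simp only [sub_zero, smul_eq_mul]
  field_simp
  ring

/-- In the polar decomposition only `s⁻¹` has a residue. Under `s ↦ -s` the odd powers change sign
and the even ones are fixed, so the residue of the coefficient function changes sign. -/
theorem MeromorphicAt.exists_hasRes {f : ℂ → ℂ} (hf : MeromorphicAt f 0) :
    ∃ a, HasRes f a ∧ HasRes (fun s => f (-s)) (-a) := by
  obtain ⟨N, a, b, h, hh, he⟩ := hf.exists_polar_decomposition
  have hb : ∀ j, HasRes (fun s => (s ^ (2 * j + 2))⁻¹) 0 := fun j => by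
    simpa using hasRes_inv_pow (2 * j + 1)
  have h1 := (HasRes.sum (Finset.range N) (fun j _ => ((hasRes_inv_pow (2 * j)).const_mul (a j)).add
    ((hb j).const_mul (b j)))).add (hasRes_of_analyticAt hh)
  have hh' : AnalyticAt ℂ (fun s => h (-s)) 0 := by
    have : AnalyticAt ℂ h (-0) := by simpa using hh
    exact this.fun_comp analyticAt_id.neg
  have h2 := (HasRes.sum (Finset.range N) (fun j _ => ((hasRes_inv_pow (2 * j)).const_mul
    (-a j)).add ((hb j).const_mul (b j)))).add (hasRes_of_analyticAt hh')
  refine ⟨_, h1.congr (he.mono fun s hs => hs.symm), ?_⟩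
  have h3 := h2.congr (g := fun s => f (-s)) ?_
  · convert h3 using 1
    simp only [neg_mul, mul_zero, add_zero, Finset.sum_neg_distrib]
  · filter_upwards [tendsto_neg_punctured.eventually he] with s hs
    rw [hs]
    congr 1
    refine Finset.sum_congr rfl fun j _ => ?_
    rw [Odd.neg_pow ⟨j, rfl⟩, Even.neg_pow ⟨j + 1, by ring⟩, inv_neg]
    ring

theorem germRep_coe {l : Filter ℂ} (f : ℂ → ℂ) : germRep (f : Germ l ℂ) =ᶠ[l] f :=
  Germ.coe_eq.1 (Quotient.out_eq _)

theorem coe_germRep {l : Filter ℂ} (f : Germ l ℂ) : (germRep f : Germ l ℂ) = f :=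
  Quotient.out_eq _

/-- Meromorphic germs. -/
def merGerm : Submodule ℂ (Germ (𝓝[≠] (0 : ℂ)) ℂ) where
  carrier := {χ | MeromorphicAt (germRep χ) 0}
  zero_mem' := (MeromorphicAt.const (0 : ℂ) 0).congr (germRep_coe (fun _ => (0 : ℂ))).symm
  add_mem' := by
    intro χ ψ h1 h2
    refine (h1.add h2).congr (Germ.coe_eq.1 ?_)
    rw [coe_germRep, Germ.coe_add, coe_germRep, coe_germRep]
  smul_mem' := by
    intro k χ h
    refine ((MeromorphicAt.const k 0).smul h).congr (Germ.coe_eq.1 ?_)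
    rw [coe_germRep]
    change ((k • germRep χ : ℂ → ℂ) : Germ (𝓝[≠] (0 : ℂ)) ℂ) = _
    rw [Germ.coe_smul, coe_germRep]

theorem coe_mem_merGerm {f : ℂ → ℂ} : (f : Germ (𝓝[≠] (0 : ℂ)) ℂ) ∈ merGerm ↔ MeromorphicAt f 0 :=
  ⟨fun h => MeromorphicAt.congr h (germRep_coe f), fun h => h.congr (germRep_coe f).symm⟩

theorem merGerm_mul {χ ψ : Germ (𝓝[≠] (0 : ℂ)) ℂ} (h1 : χ ∈ merGerm) (h2 : ψ ∈ merGerm) :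
    χ * ψ ∈ merGerm := by
  rw [← coe_germRep χ, ← coe_germRep ψ, ← Germ.coe_mul, coe_mem_merGerm]
  exact MeromorphicAt.mul h1 h2

/-- No convergence is needed: the integrals agree on all small circles, so both limits are taken
along the same filter, junk values included. -/
theorem resZero_congr {f g : ℂ → ℂ} (hfg : f =ᶠ[𝓝[≠] 0] g) : resZero f = resZero g := by
  unfold resZero limUnder
  congr 1
  refine Filter.map_congr ?_
  filter_upwards [eventually_forall_mem_sphere hfg, self_mem_nhdsWithin] with r he h0
  rw [circleIntegral.integral_congr (le_of_lt h0) he]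

/-- The residue of meromorphic germs. -/
noncomputable def resMer : merGerm →ₗ[ℂ] ℂ where
  toFun χ := resZero (germRep (χ : Germ (𝓝[≠] (0 : ℂ)) ℂ))
  map_add' := by
    intro χ ψ
    obtain ⟨a, ha, _⟩ := MeromorphicAt.exists_hasRes χ.2
    obtain ⟨b, hb, _⟩ := MeromorphicAt.exists_hasRes ψ.2
    rw [ha.resZero_eq, hb.resZero_eq]
    refine ((ha.add hb).congr (Germ.coe_eq.1 ?_)).resZero_eq
    rw [coe_germRep]
    change ((germRep χ.1 + germRep ψ.1 : ℂ → ℂ) : Germ (𝓝[≠] (0 : ℂ)) ℂ) = _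
    rw [Germ.coe_add, coe_germRep, coe_germRep]
    rfl
  map_smul' := by
    intro k χ
    obtain ⟨a, ha, _⟩ := MeromorphicAt.exists_hasRes χ.2
    rw [ha.resZero_eq]
    refine ((ha.const_mul k).congr (Germ.coe_eq.1 ?_)).resZero_eq
    rw [coe_germRep]
    change ((k • germRep χ.1 : ℂ → ℂ) : Germ (𝓝[≠] (0 : ℂ)) ℂ) = _
    rw [Germ.coe_smul, coe_germRep]
    rfl

/-- A linear extension of the residue to all germs. -/
noncomputable def res : Germ (𝓝[≠] (0 : ℂ)) ℂ →ₗ[ℂ] ℂ := (LinearMap.exists_extend resMer).choose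

theorem res_coe {f : ℂ → ℂ} (hf : MeromorphicAt f 0) : res (f : Germ (𝓝[≠] (0 : ℂ)) ℂ) = resZero f := by
  have h := (LinearMap.exists_extend resMer).choose_spec
  have h' := LinearMap.congr_fun h ⟨f, coe_mem_merGerm.2 hf⟩
  exact h'.trans (resZero_congr (germRep_coe f))

theorem res_eq_of_hasRes {f : ℂ → ℂ} {a : ℂ} (hf : MeromorphicAt f 0) (h : HasRes f a) :
    res (f : Germ (𝓝[≠] (0 : ℂ)) ℂ) = a := (res_coe hf).trans h.resZero_eq

theorem res_analytic {f : ℂ → ℂ} (hf : AnalyticAt ℂ f 0) : res (f : Germ (𝓝[≠] (0 : ℂ)) ℂ) = 0 :=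
  res_eq_of_hasRes hf.meromorphicAt (hasRes_of_analyticAt hf)

theorem res_inv_pow (n : ℕ) : res ((fun s => (s ^ (n + 1))⁻¹ : ℂ → ℂ) : Germ (𝓝[≠] (0 : ℂ)) ℂ) =
    if n = 0 then 1 else 0 :=
  res_eq_of_hasRes (by fun_prop) (hasRes_inv_pow n)

theorem MeromorphicAt.comp_neg_zero {f : ℂ → ℂ} (hf : MeromorphicAt f 0) :
    MeromorphicAt (fun s => f (-s)) 0 := by
  have : MeromorphicAt f (-0) := by simpa using hf
  exact this.comp_analyticAt (g := fun s : ℂ => -s) analyticAt_id.neg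

theorem AnalyticAt.comp_neg_zero {f : ℂ → ℂ} (hf : AnalyticAt ℂ f 0) :
    AnalyticAt ℂ (fun s => f (-s)) 0 := by
  have : AnalyticAt ℂ f (-0) := by simpa using hf
  exact this.fun_comp analyticAt_id.neg

theorem res_comp_neg {f : ℂ → ℂ} (hf : MeromorphicAt f 0) :
    res ((fun s => f (-s) : ℂ → ℂ) : Germ (𝓝[≠] (0 : ℂ)) ℂ) =
      -res (f : Germ (𝓝[≠] (0 : ℂ)) ℂ) := by
  obtain ⟨a, h1, h2⟩ := hf.exists_hasRes
  rw [res_eq_of_hasRes hf h1, res_eq_of_hasRes hf.comp_neg_zero h2]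

/-! ### Orders of meromorphic germs -/

/-- The germ at the punctured point of a function. -/
noncomputable abbrev pgerm (f : ℂ → ℂ) : Germ (𝓝[≠] (0 : ℂ)) ℂ := f

theorem pgerm_eq {f g : ℂ → ℂ} (h : ∀ s : ℂ, s ≠ 0 → f s = g s) : pgerm f = pgerm g :=
  Germ.coe_eq.2 (by filter_upwards [self_mem_nhdsWithin] with s hs using h s (by simpa using hs))

theorem pgerm_add (f g : ℂ → ℂ) : pgerm (fun s => f s + g s) = pgerm f + pgerm g := rfl

theorem pgerm_mul (f g : ℂ → ℂ) : pgerm (fun s => f s * g s) = pgerm f * pgerm g := rfl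

theorem pgerm_const_mul (k : ℂ) (f : ℂ → ℂ) : pgerm (fun s => k * f s) = k • pgerm f := rfl

theorem pgerm_sum {ι : Type*} (t : Finset ι) (f : ι → ℂ → ℂ) :
    pgerm (fun s => ∑ i ∈ t, f i s) = ∑ i ∈ t, pgerm (f i) := by
  classical
  induction t using Finset.induction_on with
  | empty => simp; rfl
  | insert i t hi ih =>
    simp only [Finset.sum_insert hi]
    rw [pgerm_add, ih]

/-- Germs of the form `s ^ n h(s)` with `h` holomorphic at `0`. -/
def ordGe (n : ℤ) : Submodule ℂ (Germ (𝓝[≠] (0 : ℂ)) ℂ) where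
  carrier := {χ | ∃ h : ℂ → ℂ, AnalyticAt ℂ h 0 ∧ χ = pgerm fun s => s ^ n * h s}
  zero_mem' := ⟨fun _ => 0, analyticAt_const, by simp; rfl⟩
  add_mem' := by
    rintro _ _ ⟨h, hh, rfl⟩ ⟨k, hk, rfl⟩
    refine ⟨fun s => h s + k s, hh.fun_add hk, ?_⟩
    rw [← pgerm_add]
    simp only [mul_add]
  smul_mem' := by
    rintro c _ ⟨h, hh, rfl⟩
    refine ⟨fun s => c * h s, analyticAt_const.fun_mul hh, ?_⟩
    rw [← pgerm_const_mul]
    simp only [mul_left_comm]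

theorem mem_ordGe_mul {n m : ℤ} {χ ψ : Germ (𝓝[≠] (0 : ℂ)) ℂ} (h1 : χ ∈ ordGe n)
    (h2 : ψ ∈ ordGe m) : χ * ψ ∈ ordGe (n + m) := by
  obtain ⟨h, hh, rfl⟩ := h1
  obtain ⟨k, hk, rfl⟩ := h2
  refine ⟨fun s => h s * k s, hh.fun_mul hk, ?_⟩
  rw [← pgerm_mul]
  refine pgerm_eq fun s hs => ?_
  rw [zpow_add₀ hs]
  ring

theorem zpow_mem_ordGe (n : ℤ) : pgerm (fun s => s ^ n) ∈ ordGe n :=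
  ⟨fun _ => 1, analyticAt_const, by simp⟩

theorem pow_mem_ordGe (n : ℕ) : pgerm (fun s => s ^ n) ∈ ordGe n := by
  simpa using zpow_mem_ordGe n

theorem inv_pow_mem_ordGe (n : ℕ) : pgerm (fun s => (s ^ n)⁻¹) ∈ ordGe (-n) := by
  simpa using zpow_mem_ordGe (-n)

theorem mem_ordGe_zero {χ : Germ (𝓝[≠] (0 : ℂ)) ℂ} :
    χ ∈ ordGe 0 ↔ ∃ h : ℂ → ℂ, AnalyticAt ℂ h 0 ∧ χ = pgerm h := by
  simp [ordGe]

theorem analytic_mem_ordGe {h : ℂ → ℂ} (hh : AnalyticAt ℂ h 0) : pgerm h ∈ ordGe 0 :=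
  mem_ordGe_zero.2 ⟨h, hh, rfl⟩

theorem ordGe_anti {n m : ℤ} (h : n ≤ m) : ordGe m ≤ ordGe n := by
  rintro _ ⟨k, hk, rfl⟩
  obtain ⟨d, rfl⟩ := Int.le.dest h
  refine ⟨fun s => s ^ d * k s, by fun_prop, pgerm_eq fun s hs => ?_⟩
  rw [zpow_add₀ hs, zpow_natCast, mul_assoc]

theorem ordGe_le_merGerm (n : ℤ) : ordGe n ≤ merGerm := by
  rintro _ ⟨k, hk, rfl⟩
  exact coe_mem_merGerm.2 (by fun_prop)

theorem exists_mem_ordGe {χ : Germ (𝓝[≠] (0 : ℂ)) ℂ} (h : χ ∈ merGerm) :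
    ∃ n : ℕ, χ ∈ ordGe (-n) := by
  obtain ⟨n, hn⟩ := h
  refine ⟨n, _, hn, ?_⟩
  rw [← coe_germRep χ]
  refine Germ.coe_eq.2 ?_
  filter_upwards [germRep_coe (germRep χ), self_mem_nhdsWithin] with s h1 hs
  have hs' : s ≠ 0 := by simpa using hs
  rw [coe_germRep]
  simp [hs']

theorem res_of_mem_ordGe_zero {χ : Germ (𝓝[≠] (0 : ℂ)) ℂ} (h : χ ∈ ordGe 0) : res χ = 0 := by
  obtain ⟨k, hk, rfl⟩ := mem_ordGe_zero.1 h
  exact res_analytic hk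

theorem germ_mul_smul (c : ℂ) (χ ψ : Germ (𝓝[≠] (0 : ℂ)) ℂ) : χ * c • ψ = c • (χ * ψ) := by
  induction χ using Germ.inductionOn with | _ f
  induction ψ using Germ.inductionOn with | _ g
  exact congrArg pgerm (mul_smul_comm c f g)

/-- The coefficient of `s ^ (-2 j - 2)`. -/
noncomputable def oddCoeff (j : ℕ) : Germ (𝓝[≠] (0 : ℂ)) ℂ →ₗ[ℂ] ℂ where
  toFun χ := res (pgerm (fun s => s ^ (2 * j + 1)) * χ)
  map_add' χ ψ := by rw [mul_add, map_add]
  map_smul' c χ := by rw [germ_mul_smul, map_smul, RingHom.id_apply]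

theorem oddCoeff_apply (j : ℕ) (χ : Germ (𝓝[≠] (0 : ℂ)) ℂ) :
    oddCoeff j χ = res (pgerm (fun s => s ^ (2 * j + 1)) * χ) := rfl

theorem oddCoeff_eq_zero {j : ℕ} {n : ℤ} {χ : Germ (𝓝[≠] (0 : ℂ)) ℂ} (h : χ ∈ ordGe n)
    (hn : 0 ≤ 2 * j + 1 + n) : oddCoeff j χ = 0 := by
  refine res_of_mem_ordGe_zero (ordGe_anti ?_ (mem_ordGe_mul (pow_mem_ordGe (2 * j + 1)) h))
  push_cast
  exact hn

theorem oddCoeff_inv_pow (i j : ℕ) :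
    oddCoeff j (pgerm fun s => (s ^ (2 * i + 2))⁻¹) = if i = j then 1 else 0 := by
  rcases lt_or_ge i j with h | h
  · rw [if_neg h.ne]
    refine oddCoeff_eq_zero (inv_pow_mem_ordGe _) ?_
    push_cast
    omega
  · obtain ⟨k, rfl⟩ := Nat.exists_eq_add_of_le h
    rw [oddCoeff_apply, ← pgerm_mul, pgerm_eq (g := fun s => (s ^ (2 * k + 1))⁻¹) ?_, res_inv_pow]
    · simp
    · intro s hs
      field_simp
      ring

/-- An odd coefficient times `s ^ (2 * j + 1)` is an even function, whose residue equals its own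
negative by `res_comp_neg`. -/
theorem oddCoeff_eq_zero_of_neg {f : ℂ → ℂ} (hf : MeromorphicAt f 0)
    (h : ∀ᶠ s in 𝓝[≠] (0 : ℂ), f (-s) = -f s) (j : ℕ) : oddCoeff j (pgerm f) = 0 := by
  rw [oddCoeff_apply, ← pgerm_mul]
  have h1 := res_comp_neg (f := fun s => s ^ (2 * j + 1) * f s) (by fun_prop)
  have h2 : pgerm (fun s => (-s) ^ (2 * j + 1) * f (-s)) = pgerm fun s => s ^ (2 * j + 1) * f s := by
    refine Germ.coe_eq.2 ?_
    filter_upwards [h] with s hs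
    rw [hs, Odd.neg_pow ⟨j, rfl⟩]
    ring
  change res (pgerm fun s => (-s) ^ (2 * j + 1) * f (-s)) = _ at h1
  rw [h2] at h1
  exact self_eq_neg.1 h1

theorem HasOddPolarPart.congr {f g : ℂ → ℂ} (hf : HasOddPolarPart f) (h : f =ᶠ[𝓝[≠] 0] g) :
    HasOddPolarPart g := by
  obtain ⟨h1, k, hk, he⟩ := hf
  refine ⟨h1.congr h, k, hk, ?_⟩
  filter_upwards [he, h, tendsto_neg_punctured.eventually h] with s h1 h2 h3
  rw [← h1, sigmaPull, sigmaPull, h2, h3]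

/-- Germs with odd polar part. -/
def oddPolar : Submodule ℂ (Germ (𝓝[≠] (0 : ℂ)) ℂ) where
  carrier := {χ | ∃ f, χ = pgerm f ∧ HasOddPolarPart f}
  zero_mem' := ⟨fun _ => 0, rfl, MeromorphicAt.const 0 0, fun _ => 0, analyticAt_const,
    by simp [sigmaPull]⟩
  add_mem' := by
    rintro _ _ ⟨f, rfl, h1, k, hk, he⟩ ⟨g, rfl, h2, l, hl, hf⟩
    refine ⟨fun s => f s + g s, rfl, h1.fun_add h2, fun s => k s + l s, hk.fun_add hl, ?_⟩
    filter_upwards [he, hf] with s h1 h2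
    rw [← h1, ← h2, sigmaPull, sigmaPull, sigmaPull]
    ring
  smul_mem' := by
    rintro c _ ⟨f, rfl, h1, k, hk, he⟩
    refine ⟨fun s => c * f s, rfl, (MeromorphicAt.const c 0).fun_mul h1, fun s => c * k s,
      analyticAt_const.fun_mul hk, ?_⟩
    filter_upwards [he] with s h1
    rw [← h1, sigmaPull, sigmaPull]
    ring

theorem mem_oddPolar {f : ℂ → ℂ} : pgerm f ∈ oddPolar ↔ HasOddPolarPart f :=
  ⟨fun ⟨_, hg, h⟩ => h.congr (Germ.coe_eq.1 hg.symm), fun h => ⟨f, rfl, h⟩⟩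

theorem mem_oddPolar_iff_germRep {χ : Germ (𝓝[≠] (0 : ℂ)) ℂ} :
    χ ∈ oddPolar ↔ HasOddPolarPart (germRep χ) := by
  rw [← mem_oddPolar, pgerm, coe_germRep]

theorem oddPolar_le_merGerm : oddPolar ≤ merGerm := by
  rintro _ ⟨f, rfl, h⟩
  exact coe_mem_merGerm.2 h.1

/-- The difference is the coefficient of `χ + σ^* χ`: holomorphic by hypothesis and odd by
construction, hence divisible by `s`. -/
theorem HasOddPolarPart.exists_odd_part {f : ℂ → ℂ} (hf : HasOddPolarPart f) :
    ∃ h : ℂ → ℂ, AnalyticAt ℂ h 0 ∧ ∀ᶠ s in 𝓝[≠] (0 : ℂ), f s - f (-s) = s * h s := by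
  obtain ⟨_, k, hk, he⟩ := hf
  have hodd : ∀ᶠ s in 𝓝[≠] (0 : ℂ), k (-s) = -k s := by
    filter_upwards [he, tendsto_neg_punctured.eventually he] with s h1 h2
    rw [← h1, ← h2, sigmaPull, sigmaPull, neg_neg]
    ring
  -- Oddness of `k` is known only off `0`; the value at `0` follows by passing to the limit.
  have h0 : k 0 = 0 := by
    have t1 : Tendsto (fun s => k (-s)) (𝓝[≠] 0) (𝓝 (k 0)) := by
      simpa using (hk.comp_neg_zero.continuousAt.tendsto).mono_left nhdsWithin_le_nhds
    have t2 : Tendsto (fun s => -k s) (𝓝[≠] 0) (𝓝 (-k 0)) :=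
      (hk.continuousAt.tendsto.mono_left nhdsWithin_le_nhds).neg
    exact self_eq_neg.1 (tendsto_nhds_unique (t1.congr' hodd) t2)
  obtain ⟨h, hh, e⟩ := hk.exists_eq_sum_add_pow_mul (n := 1)
  refine ⟨h, hh, ?_⟩
  filter_upwards [he] with s h1
  have e1 := e s
  simp only [Finset.sum_range_one, iteratedDeriv_zero, h0, smul_eq_mul] at e1
  rw [sub_eq_add_neg, ← sigmaPull, h1, e1]
  simp

theorem oddPolar_of_analyticAt {h : ℂ → ℂ} (hh : AnalyticAt ℂ h 0) : HasOddPolarPart h :=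
  ⟨hh.meromorphicAt, fun s => h s + sigmaPull h s, hh.fun_add hh.comp_neg_zero.fun_neg,
    Eventually.of_forall fun _ => rfl⟩

theorem ordGe_zero_le_oddPolar : ordGe 0 ≤ oddPolar := by
  intro χ h
  obtain ⟨k, hk, rfl⟩ := mem_ordGe_zero.1 h
  exact mem_oddPolar.2 (oddPolar_of_analyticAt hk)

theorem inv_pow_mem_oddPolar (j : ℕ) : pgerm (fun s => (s ^ (2 * j + 2))⁻¹) ∈ oddPolar := by
  refine mem_oddPolar.2 ⟨by fun_prop, fun _ => 0, analyticAt_const, Eventually.of_forall fun s => ?_⟩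
  rw [sigmaPull, Even.neg_pow ⟨j + 1, by ring⟩]
  ring

/-- Pairing of two forms with odd polar part with an even bivector with a double pole. -/
theorem oddCoeff_mul_comp_neg {θ a b : ℂ → ℂ} (hθ : pgerm θ ∈ ordGe (-2))
    (hθe : ∀ s, θ (-s) = θ s) (ha : HasOddPolarPart a) (hb : HasOddPolarPart b) (j : ℕ) :
    oddCoeff j (pgerm fun s => a s * b (-s) * θ s) = oddCoeff j (pgerm fun s => a s * b s * θ s) := by
  obtain ⟨A, hA, ea⟩ := ha.exists_odd_part
  obtain ⟨B, hB, eb⟩ := hb.exists_odd_part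
  have hma := ha.1
  have hmb := hb.1
  have hmb' := hmb.comp_neg_zero
  have hmθ : MeromorphicAt θ 0 := coe_mem_merGerm.1 (ordGe_le_merGerm _ hθ)
  have h1 := res_comp_neg (f := fun s => s ^ (2 * j + 1) * (a s * (b s - b (-s)) * θ s))
    (.fun_mul (by fun_prop) ((hma.fun_mul (hmb.fun_sub hmb')).fun_mul hmθ))
  -- Subtracting the reflection antisymmetrises `a` as well. The two antisymmetrised factors are
  -- each divisible by `s`, which cancels the double pole of `θ`; combined with `h1`, twice the
  -- residue is zero.
  have h2 : res (pgerm fun s => s ^ (2 * j + 1) * (a s * (b s - b (-s)) * θ s)) -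
      res (pgerm fun s => (-s) ^ (2 * j + 1) * (a (-s) * (b (-s) - b (- -s)) * θ (-s))) = 0 := by
    rw [← map_sub]
    refine res_of_mem_ordGe_zero ?_
    have e : pgerm (fun s => s ^ (2 * j + 1) * (a s * (b s - b (-s)) * θ s)) -
        pgerm (fun s => (-s) ^ (2 * j + 1) * (a (-s) * (b (-s) - b (- -s)) * θ (-s))) =
        pgerm (fun s => s ^ (2 * j + 1)) * (pgerm θ * ((pgerm (fun s => s ^ 1) * pgerm A) *
          (pgerm (fun s => s ^ 1) * pgerm B))) := by
      simp only [← pgerm_mul]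
      refine Germ.coe_eq.2 ?_
      filter_upwards [ea, eb] with s h1 h2
      rw [pow_one, ← h1, ← h2, Odd.neg_pow ⟨j, rfl⟩, neg_neg, hθe]
      ring
    rw [e]
    refine ordGe_anti ?_ (mem_ordGe_mul (pow_mem_ordGe _) (mem_ordGe_mul hθ (mem_ordGe_mul
      (mem_ordGe_mul (pow_mem_ordGe _) (analytic_mem_ordGe hA))
      (mem_ordGe_mul (pow_mem_ordGe _) (analytic_mem_ordGe hB)))))
    push_cast
    omega
  change res (pgerm fun s => (-s) ^ (2 * j + 1) * (a (-s) * (b (-s) - b (- -s)) * θ (-s))) = _ at h1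
  rw [h1, sub_neg_eq_add, add_self_eq_zero] at h2
  rw [← sub_eq_zero, ← map_sub, ← neg_eq_zero, ← map_neg, neg_sub, oddCoeff_apply]
  refine Eq.trans (congrArg res (pgerm_eq fun s _ => ?_)) h2
  change s ^ (2 * j + 1) * (a s * b s * θ s - a s * b (-s) * θ s) = _
  ring

/-! ### Primitives -/

/-- On a disc where `g` is holomorphic it has a primitive `G`, and the fundamental theorem of
calculus along the segment evaluates the integral as `G s - G 0`. -/
theorem primZero_analytic {g : ℂ → ℂ} (hg : AnalyticAt ℂ g 0) :
    AnalyticAt ℂ (primZero g) 0 ∧ ∀ᶠ s in 𝓝 0, deriv (primZero g) s = g s := by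
  obtain ⟨ε, hε, h⟩ := Metric.eventually_nhds_iff.1 hg.eventually_analyticAt
  have hd : DifferentiableOn ℂ g (Metric.ball 0 ε) := fun z hz =>
    (h hz).differentiableAt.differentiableWithinAt
  obtain ⟨G, hG⟩ := hd.isExactOn_ball
  have hmem : ∀ s ∈ Metric.ball (0 : ℂ) ε, ∀ t ∈ Set.uIcc (0 : ℝ) 1,
      (t : ℂ) * s ∈ Metric.ball (0 : ℂ) ε := by
    intro s hs t ht
    rw [Set.uIcc_of_le zero_le_one] at ht
    have hs' : ‖s‖ < ε := by simpa using hs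
    have : ‖(t : ℂ) * s‖ ≤ ‖s‖ := by
      rw [norm_mul, Complex.norm_real, Real.norm_of_nonneg ht.1]
      exact mul_le_of_le_one_left (norm_nonneg s) ht.2
    simpa using this.trans_lt hs'
  have key : ∀ s ∈ Metric.ball (0 : ℂ) ε, primZero g s = G s - G 0 := by
    intro s hs
    have e := intervalIntegral.integral_eq_sub_of_hasDerivAt (a := 0) (b := 1)
      (f := fun t : ℝ => G ((t : ℂ) * s)) (f' := fun t : ℝ => g ((t : ℂ) * s) * s) ?_ ?_
    · rw [primZero, e]
      simp
    · intro t ht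
      have h1 := hG _ (hmem s hs t ht)
      have h2 : HasDerivAt (fun t : ℝ => (t : ℂ) * s) s t := by
        simpa using (Complex.ofRealCLM.hasDerivAt (x := t)).mul_const s
      exact h1.comp t h2
    · refine ContinuousOn.intervalIntegrable ?_
      refine ContinuousOn.mul ?_ continuousOn_const
      exact hd.continuousOn.comp (by fun_prop) (fun t ht => hmem s hs t ht)
  have hb : Metric.ball (0 : ℂ) ε ∈ 𝓝 0 := Metric.ball_mem_nhds 0 hε
  have hdP : ∀ s ∈ Metric.ball (0 : ℂ) ε, HasDerivAt (primZero g) (g s) s := fun s hs =>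
    ((hG s hs).sub_const (G 0)).congr_of_eventuallyEq
      (by filter_upwards [Metric.isOpen_ball.mem_nhds hs] with t ht using key t ht)
  refine ⟨?_, ?_⟩
  · exact (DifferentiableOn.analyticAt (fun s hs => (hdP s hs).differentiableAt.differentiableWithinAt)
      hb)
  · filter_upwards [hb] with s hs using (hdP s hs).deriv

theorem primZero_neg {g : ℂ → ℂ} (h : ∀ s, g (-s) = g s) (s : ℂ) :
    primZero g (-s) = -primZero g s := by
  rw [primZero, primZero, ← intervalIntegral.integral_neg]
  congr 1
  funext t
  rw [mul_neg (t : ℂ), h, mul_neg]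

/-! ### Principal parts -/

section Loc

variable (I : Type*)

/-- Families of germs in `ordGe n`. -/
noncomputable def ordLoc (n : ℤ) : Submodule ℂ (LocForm I) := Submodule.pi Set.univ fun _ => ordGe n

/-- Families of meromorphic germs. -/
noncomputable def merLoc : Submodule ℂ (LocForm I) := Submodule.pi Set.univ fun _ => merGerm

/-- Families of germs with odd polar part. -/
noncomputable def oddLoc : Submodule ℂ (LocForm I) := Submodule.pi Set.univ fun _ => oddPolar

variable {I}

theorem mem_ordLoc {n : ℤ} {χ : LocForm I} : χ ∈ ordLoc I n ↔ ∀ α, χ α ∈ ordGe n := by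
  simp [ordLoc]

theorem mem_merLoc {χ : LocForm I} : χ ∈ merLoc I ↔ ∀ α, χ α ∈ merGerm := by
  simp [merLoc]

theorem mem_oddLoc {χ : LocForm I} : χ ∈ oddLoc I ↔ ∀ α, χ α ∈ oddPolar := by
  simp [oddLoc]

theorem oddLoc_le_merLoc : oddLoc I ≤ merLoc I := fun _ h =>
  mem_merLoc.2 fun α => oddPolar_le_merGerm (mem_oddLoc.1 h α)

theorem ordLoc_zero_le_oddLoc : ordLoc I 0 ≤ oddLoc I := fun _ h =>
  mem_oddLoc.2 fun α => ordGe_zero_le_oddPolar (mem_ordLoc.1 h α)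

theorem ordLoc_le_merLoc (n : ℤ) : ordLoc I n ≤ merLoc I := fun _ h =>
  mem_merLoc.2 fun α => ordGe_le_merGerm n (mem_ordLoc.1 h α)

theorem ordLoc_anti {n m : ℤ} (h : n ≤ m) : ordLoc I m ≤ ordLoc I n := fun _ hχ =>
  mem_ordLoc.2 fun α => ordGe_anti h (mem_ordLoc.1 hχ α)

theorem mem_ordLoc_mul {n m : ℤ} {χ ψ : LocForm I} (h1 : χ ∈ ordLoc I n) (h2 : ψ ∈ ordLoc I m) :
    χ * ψ ∈ ordLoc I (n + m) :=
  mem_ordLoc.2 fun α => mem_ordGe_mul (mem_ordLoc.1 h1 α) (mem_ordLoc.1 h2 α)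

theorem mem_merLoc_mul {χ ψ : LocForm I} (h1 : χ ∈ merLoc I) (h2 : ψ ∈ merLoc I) :
    χ * ψ ∈ merLoc I :=
  mem_merLoc.2 fun α => merGerm_mul (mem_merLoc.1 h1 α) (mem_merLoc.1 h2 α)

/-- Odd principal parts. -/
abbrev PrincipalPart (I : Type*) : Type _ := I × ℕ →₀ ℂ

/-- Principal parts with poles of order at most `2 N` (`N > 0`). -/
noncomputable def ppLt (I : Type*) (N : ℕ) : Submodule ℂ (PrincipalPart I) :=
  Finsupp.supported ℂ ℂ {b | b.2 < N}

theorem mem_ppLt {N : ℕ} {v : PrincipalPart I} : v ∈ ppLt I N ↔ ∀ b : I × ℕ, N ≤ b.2 → v b = 0 := by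
  rw [ppLt, Finsupp.mem_supported']
  simp

theorem ppLt_mono {N M : ℕ} (h : N ≤ M) : ppLt I N ≤ ppLt I M := fun _ hv =>
  mem_ppLt.2 fun b hb => mem_ppLt.1 hv b (h.trans hb)

theorem exists_mem_ppLt (v : PrincipalPart I) : ∃ N, v ∈ ppLt I N := by
  refine ⟨v.support.sup (fun b => b.2 + 1), mem_ppLt.2 fun b hb => ?_⟩
  by_contra h
  have := Finset.le_sup (f := fun b : I × ℕ => b.2 + 1) (Finsupp.mem_support_iff.2 h)
  omega

theorem ppLt_finite [Finite I] (N : ℕ) : Module.Finite ℂ (ppLt I N) := by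
  have : Finite ({b | b.2 < N} : Set (I × ℕ)) := by
    have h : ({b | b.2 < N} : Set (I × ℕ)) = Set.univ ×ˢ Set.Iio N := by
      ext b
      simp
    rw [h]
    exact (Set.finite_univ.prod (Set.finite_Iio N)).to_subtype
  exact Module.Finite.equiv (Finsupp.supportedEquivFinsupp (R := ℂ) (M := ℂ) _).symm

theorem exists_mem_ordLoc [Finite I] {χ : LocForm I} (h : χ ∈ merLoc I) : ∃ n : ℕ, χ ∈ ordLoc I (-n) := by
  cases nonempty_fintype I
  choose n hn using fun α => exists_mem_ordGe (mem_merLoc.1 h α)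
  refine ⟨Finset.univ.sup n, mem_ordLoc.2 fun α => ordGe_anti ?_ (hn α)⟩
  have := Finset.le_sup (f := n) (Finset.mem_univ α)
  omega

/-- The odd principal part of meromorphic forms. -/
noncomputable def ppMer [Finite I] : merLoc I →ₗ[ℂ] PrincipalPart I where
  toFun χ := Finsupp.ofSupportFinite (fun b => oddCoeff b.2 (χ.1 b.1)) (by
    obtain ⟨n, hn⟩ := exists_mem_ordLoc χ.2
    refine (Set.finite_univ.prod (Set.finite_Iio n)).subset fun b hb => ?_
    refine ⟨trivial, ?_⟩
    by_contra h
    refine hb (oddCoeff_eq_zero (mem_ordLoc.1 hn b.1) ?_)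
    have : n ≤ b.2 := not_lt.1 h
    omega)
  map_add' χ ψ := by
    ext b
    exact map_add (oddCoeff b.2) _ _
  map_smul' c χ := by
    ext b
    exact map_smul (oddCoeff b.2) c _

/-- A linear extension of the odd principal part to all families of germs. -/
noncomputable def pp [Finite I] : LocForm I →ₗ[ℂ] PrincipalPart I := (LinearMap.exists_extend ppMer).choose

theorem pp_apply [Finite I] {χ : LocForm I} (h : χ ∈ merLoc I) (b : I × ℕ) :
    pp χ b = oddCoeff b.2 (χ b.1) :=
  congrArg (fun v : PrincipalPart I => v b)
    (LinearMap.congr_fun (LinearMap.exists_extend (ppMer (I := I))).choose_spec ⟨χ, h⟩)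

theorem pp_mem_ppLt [Finite I] {χ : LocForm I} {n : ℤ} (h : χ ∈ ordLoc I n) {N : ℕ} (hN : 0 ≤ 2 * N + 1 + n) :
    pp χ ∈ ppLt I N := by
  refine mem_ppLt.2 fun b hb => ?_
  rw [pp_apply (ordLoc_le_merLoc n h)]
  exact oddCoeff_eq_zero (mem_ordLoc.1 h b.1) (by omega)

/-- The bound is `-1` rather than `0` because a simple pole has no odd principal part. -/
theorem pp_eq_zero [Finite I] {χ : LocForm I} {n : ℤ} (h : χ ∈ ordLoc I n) (hn : 0 ≤ n + 1) : pp χ = 0 := by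
  ext b
  exact mem_ppLt.1 (pp_mem_ppLt (N := 0) h (by omega)) b (Nat.zero_le _)

theorem pp_congr [Finite I] {χ ψ : LocForm I} (h : χ - ψ ∈ ordLoc I 0) : pp χ = pp ψ := by
  rw [← sub_eq_zero, ← map_sub]
  exact pp_eq_zero h (by norm_num)

/-- The form equal to `s ^ (-2 k - 2) ds` at `β` and zero elsewhere, for `b = (β, k)`. -/
noncomputable def sing [DecidableEq I] (b : I × ℕ) : LocForm I := Pi.single b.1 (pgerm fun s => (s ^ (2 * b.2 + 2))⁻¹)

theorem single_mem_ordLoc [DecidableEq I] {α : I} {n : ℤ} {χ : Germ (𝓝[≠] (0 : ℂ)) ℂ} (h : χ ∈ ordGe n) :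
    (Pi.single α χ : LocForm I) ∈ ordLoc I n := by
  refine mem_ordLoc.2 fun β => ?_
  rcases eq_or_ne β α with rfl | hβ
  · rwa [Pi.single_eq_same]
  · rw [Pi.single_eq_of_ne hβ]
    exact zero_mem _

theorem sing_mem_ordLoc [DecidableEq I] (b : I × ℕ) : sing b ∈ ordLoc I (-(2 * b.2 + 2 : ℕ)) :=
  single_mem_ordLoc (inv_pow_mem_ordGe _)

theorem sing_mem_oddLoc [DecidableEq I] (b : I × ℕ) : sing b ∈ oddLoc I := by
  refine mem_oddLoc.2 fun β => ?_
  rcases eq_or_ne β b.1 with rfl | hβ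
  · rw [sing, Pi.single_eq_same]
    exact inv_pow_mem_oddPolar _
  · rw [sing, Pi.single_eq_of_ne hβ]
    exact zero_mem _

theorem pp_sing [Finite I] [DecidableEq I] (b : I × ℕ) : pp (sing b) = Finsupp.single b 1 := by
  ext a
  rw [pp_apply (ordLoc_le_merLoc _ (sing_mem_ordLoc b)), Finsupp.single_apply]
  rcases eq_or_ne a.1 b.1 with h | h
  · rw [sing, h, Pi.single_eq_same, oddCoeff_inv_pow]
    congr 1
    rw [Prod.ext_iff, eq_comm (a := b.1), eq_comm (a := b.2)]
    simp [h, eq_comm]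
  · rw [sing, Pi.single_eq_of_ne h, map_zero, if_neg]
    rintro rfl
    exact h rfl

end Loc

/-! ### Families of forms with prescribed principal parts -/

section Lift

variable {I : Type*} [DecidableEq I] {ξ : I × ℕ → LocForm I}

/-- The combination of the forms `ξ b` with coefficients `v b`. -/
noncomputable abbrev liftPP (ξ : I × ℕ → LocForm I) : PrincipalPart I →ₗ[ℂ] LocForm I :=
  Finsupp.linearCombination ℂ ξ

theorem liftPP_sub_mem (hξ : ∀ b, ξ b - sing b ∈ ordLoc I 0) (v : PrincipalPart I) : liftPP ξ v - liftPP sing v ∈ ordLoc I 0 := by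
  rw [liftPP, liftPP, Finsupp.linearCombination_apply, Finsupp.linearCombination_apply, Finsupp.sum,
    Finsupp.sum, ← Finset.sum_sub_distrib]
  refine Submodule.sum_mem _ fun b _ => ?_
  rw [← smul_sub]
  exact Submodule.smul_mem _ _ (hξ b)

theorem pp_liftPP_sing [Finite I] (v : PrincipalPart I) : pp (liftPP sing v) = v := by
  rw [liftPP, Finsupp.linearCombination_apply, Finsupp.sum, map_sum]
  simp only [map_smul, pp_sing]
  exact (Finset.sum_congr rfl fun b _ => by simp).trans (Finsupp.sum_single v)

/-- The corrections `ξ b - sing b` are holomorphic, so `pp` does not see them. Applied to both kinds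
of basic forms, this identifies each `V_-` with the principal parts. -/
theorem pp_liftPP [Finite I] (hξ : ∀ b, ξ b - sing b ∈ ordLoc I 0)
    (v : PrincipalPart I) : pp (liftPP ξ v) = v := by
  rw [pp_congr (liftPP_sub_mem hξ v), pp_liftPP_sing]

theorem liftPP_mem_oddLoc [Finite I] (hξ : ∀ b, ξ b - sing b ∈ ordLoc I 0)
    (v : PrincipalPart I) : liftPP ξ v ∈ oddLoc I := by
  rw [← sub_add_cancel (liftPP ξ v) (liftPP sing v)]
  refine add_mem (ordLoc_zero_le_oddLoc (liftPP_sub_mem hξ v)) ?_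
  rw [liftPP, Finsupp.linearCombination_apply]
  exact Submodule.sum_mem _ fun b _ => Submodule.smul_mem _ _ (sing_mem_oddLoc b)

theorem liftPP_mem_ordLoc (hξ : ∀ b, ξ b - sing b ∈ ordLoc I 0) {N : ℕ} {v : PrincipalPart I} (hv : v ∈ ppLt I N) :
    liftPP ξ v ∈ ordLoc I (-(2 * N : ℕ)) := by
  rw [← sub_add_cancel (liftPP ξ v) (liftPP sing v)]
  refine add_mem (ordLoc_anti (by omega) (liftPP_sub_mem hξ v)) ?_
  rw [liftPP, Finsupp.linearCombination_apply]
  refine Submodule.sum_mem _ fun b hb => Submodule.smul_mem _ _ ?_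
  refine ordLoc_anti ?_ (sing_mem_ordLoc b)
  have : b.2 < N := by
    by_contra h
    exact Finsupp.mem_support_iff.1 hb (mem_ppLt.1 hv b (not_lt.1 h))
  omega

end Lift

/-! ### Odd holomorphic germs -/

section Odd

variable {I : Type*}

theorem Vplus_exists_rep (f : Vplus I) (α : I) : ∃ ph : ℂ → ℂ, AnalyticAt ℂ ph 0 ∧
    (∀ᶠ s in 𝓝 (0 : ℂ), ph (-s) = -ph s) ∧ germRep (f.1 α) =ᶠ[𝓝 0] ph := by
  obtain ⟨ph, h1, h2, h3⟩ := f.2 α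
  exact ⟨ph, h1, h2, h3 ▸ germRep_coe ph⟩

theorem pgerm_congr {f g : ℂ → ℂ} (h : f =ᶠ[𝓝 0] g) : pgerm f = pgerm g :=
  Germ.coe_eq.2 (h.filter_mono nhdsWithin_le_nhds)

theorem locD_eq {f : LocFun I} {α : I} {ph : ℂ → ℂ} (h : germRep (f α) =ᶠ[𝓝 0] ph) :
    locD f α = pgerm (deriv ph) := pgerm_congr h.deriv

theorem germRep_add {l : Filter ℂ} (f g : Germ l ℂ) :
    germRep (f + g) =ᶠ[l] fun s => germRep f s + germRep g s := by
  refine Germ.coe_eq.1 ?_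
  rw [coe_germRep]
  change _ = ((germRep f + germRep g : ℂ → ℂ) : Germ l ℂ)
  rw [Germ.coe_add, coe_germRep, coe_germRep]

theorem germRep_smul {l : Filter ℂ} (c : ℂ) (f : Germ l ℂ) :
    germRep (c • f) =ᶠ[l] fun s => c * germRep f s := by
  refine Germ.coe_eq.1 ?_
  rw [coe_germRep]
  change _ = ((c • germRep f : ℂ → ℂ) : Germ l ℂ)
  rw [Germ.coe_smul, coe_germRep]

/-- The family of germs of odd functions. -/
noncomputable def ofOdd (ph : I → ℂ → ℂ) (h1 : ∀ α, AnalyticAt ℂ (ph α) 0)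
    (h2 : ∀ α, ∀ᶠ s in 𝓝 (0 : ℂ), ph α (-s) = -ph α s) : Vplus I :=
  ⟨fun α => (ph α : Germ (𝓝 (0 : ℂ)) ℂ), fun α => ⟨ph α, h1 α, h2 α, rfl⟩⟩

theorem germRep_ofOdd {ph : I → ℂ → ℂ} (h1 : ∀ α, AnalyticAt ℂ (ph α) 0)
    (h2 : ∀ α, ∀ᶠ s in 𝓝 (0 : ℂ), ph α (-s) = -ph α s) (α : I) :
    germRep ((ofOdd ph h1 h2).1 α) =ᶠ[𝓝 0] ph α := germRep_coe _

/-- The differential on odd germs. -/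
noncomputable def diffPlus : Vplus I →ₗ[ℂ] LocForm I where
  toFun f := locD f.1
  map_add' f g := by
    funext α
    obtain ⟨ph, h1, -, h3⟩ := Vplus_exists_rep f α
    obtain ⟨ψ, k1, -, k3⟩ := Vplus_exists_rep g α
    have e : germRep ((f + g).1 α) =ᶠ[𝓝 0] fun s => ph s + ψ s :=
      (germRep_add (f.1 α) (g.1 α)).trans (by filter_upwards [h3, k3] with s h k; rw [h, k])
    rw [locD_eq e, Pi.add_apply, locD_eq h3, locD_eq k3]
    refine pgerm_congr ?_
    filter_upwards [h1.eventually_analyticAt, k1.eventually_analyticAt] with s h k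
    exact deriv_fun_add h.differentiableAt k.differentiableAt
  map_smul' c f := by
    funext α
    obtain ⟨ph, h1, -, h3⟩ := Vplus_exists_rep f α
    have e : germRep ((c • f).1 α) =ᶠ[𝓝 0] fun s => c * ph s :=
      (germRep_smul c (f.1 α)).trans (by filter_upwards [h3] with s h; rw [h])
    rw [locD_eq e, RingHom.id_apply, Pi.smul_apply, locD_eq h3]
    refine pgerm_congr ?_
    filter_upwards [h1.eventually_analyticAt] with s h
    exact deriv_const_mul _ h.differentiableAt

theorem diffPlus_apply (f : Vplus I) : diffPlus f = locD f.1 := rfl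

theorem diffPlus_mem (f : Vplus I) : diffPlus f ∈ ordLoc I 0 := by
  refine mem_ordLoc.2 fun α => ?_
  obtain ⟨ph, h1, -, h3⟩ := Vplus_exists_rep f α
  rw [diffPlus_apply, locD_eq h3]
  exact analytic_mem_ordGe h1.deriv

theorem diffPlus_mem_of_mem_VplusGt {f : Vplus I} {d : ℕ} (hf : f ∈ VplusGt I d) :
    diffPlus f ∈ ordLoc I (2 * d + 1 : ℕ) := by
  refine mem_ordLoc.2 fun α => ?_
  obtain ⟨ph, h1, h2⟩ := hf α
  have h3 : germRep (f.1 α) =ᶠ[𝓝 0] fun s => s ^ (2 * d + 2) * ph s := by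
    rw [h2]
    exact germRep_coe _
  rw [diffPlus_apply, locD_eq h3]
  refine ⟨fun s => (2 * d + 2 : ℕ) * ph s + s * deriv ph s, ?_, pgerm_congr ?_⟩
  · have := h1.deriv
    fun_prop
  · filter_upwards [h1.eventually_analyticAt] with s hs
    rw [deriv_fun_mul (by fun_prop) hs.differentiableAt, zpow_natCast]
    simp only [deriv_pow_field]
    rw [pow_succ s (2 * d + 1)]
    simp
    ring

/-- The coefficient of `s ^ (2 k + 1)` at `β`, for `b = (β, k)`. -/
noncomputable def plusCoeff (b : I × ℕ) : Vplus I →ₗ[ℂ] ℂ where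
  toFun f := res (pgerm fun s => germRep (f.1 b.1) s * (s ^ (2 * b.2 + 2))⁻¹)
  map_add' f g := by
    rw [← map_add, ← pgerm_add]
    congr 1
    refine Germ.coe_eq.2 ?_
    filter_upwards [(germRep_add (f.1 b.1) (g.1 b.1)).filter_mono nhdsWithin_le_nhds] with s hs
    rw [← add_mul, ← hs]
    rfl
  map_smul' c f := by
    rw [RingHom.id_apply, ← map_smul, ← pgerm_const_mul]
    congr 1
    refine Germ.coe_eq.2 ?_
    filter_upwards [(germRep_smul c (f.1 b.1)).filter_mono nhdsWithin_le_nhds] with s hs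
    rw [← mul_assoc, ← hs]
    rfl

theorem AnalyticAt.exists_taylor_two_mul {g : ℂ → ℂ} (hg : AnalyticAt ℂ g 0) (M : ℕ) :
    ∃ (a b : ℕ → ℂ) (R : ℂ → ℂ), AnalyticAt ℂ R 0 ∧ ∀ s,
      g s = (∑ j ∈ Finset.range M, (a j * s ^ (2 * j) + b j * s ^ (2 * j + 1))) + s ^ (2 * M) * R s := by
  induction M with
  | zero => exact ⟨0, 0, g, hg, by simp⟩
  | succ M ih =>
    obtain ⟨a, b, R, hR, e⟩ := ih
    obtain ⟨G, hG, e'⟩ := hR.exists_eq_sum_add_pow_mul (n := 2)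
    refine ⟨Function.update a M (R 0), Function.update b M (deriv R 0), G, hG, fun s => ?_⟩
    have e1 : ∑ j ∈ Finset.range M, (Function.update a M (R 0) j * s ^ (2 * j) +
        Function.update b M (deriv R 0) j * s ^ (2 * j + 1)) =
        ∑ j ∈ Finset.range M, (a j * s ^ (2 * j) + b j * s ^ (2 * j + 1)) := by
      refine Finset.sum_congr rfl fun j hj => ?_
      have : j ≠ M := (Finset.mem_range.1 hj).ne
      simp [Function.update_of_ne this]
    have e2 := e' s
    simp only [Finset.sum_range_succ, Finset.sum_range_zero, iteratedDeriv_zero,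
      iteratedDeriv_one, smul_eq_mul] at e2
    rw [Finset.sum_range_succ, e1, e s, e2]
    simp only [Function.update_self]
    norm_num
    ring

/-- Antisymmetrising the Taylor expansion of an odd representative kills the even coefficients and
replaces the remainder by its odd part. -/
theorem Vplus_exists_taylor (f : Vplus I) (α : I) (M : ℕ) :
    ∃ (c : ℕ → ℂ) (R : ℂ → ℂ), AnalyticAt ℂ R 0 ∧ ∀ᶠ s in 𝓝 0,
      germRep (f.1 α) s = (∑ j ∈ Finset.range M, c j * s ^ (2 * j + 1)) + s ^ (2 * M) * R s := by
  obtain ⟨ph, h1, h2, h3⟩ := Vplus_exists_rep f α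
  obtain ⟨a, b, R, hR, e⟩ := h1.exists_taylor_two_mul M
  refine ⟨b, fun s => (1 / 2 : ℂ) * (R s - R (-s)),
    analyticAt_const.fun_mul (hR.fun_sub hR.comp_neg_zero), ?_⟩
  filter_upwards [h2, h3] with s h2 h3
  have h4 : ph s = (1 / 2 : ℂ) * (ph s - ph (-s)) := by rw [h2]; ring
  rw [h3, h4, e s, e (-s)]
  have h5 : ∑ j ∈ Finset.range M, b j * s ^ (2 * j + 1) = (1 / 2 : ℂ) *
      ((∑ j ∈ Finset.range M, (a j * s ^ (2 * j) + b j * s ^ (2 * j + 1))) -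
        ∑ j ∈ Finset.range M, (a j * (-s) ^ (2 * j) + b j * (-s) ^ (2 * j + 1))) := by
    rw [← Finset.sum_sub_distrib, Finset.mul_sum]
    refine Finset.sum_congr rfl fun j _ => ?_
    rw [Odd.neg_pow ⟨j, rfl⟩, Even.neg_pow ⟨j, by ring⟩]
    ring
  rw [h5, Even.neg_pow ⟨M, by ring⟩]
  ring

theorem res_taylor_mul {M k : ℕ} (hk : k < M) (c : ℕ → ℂ) {R : ℂ → ℂ} (hR : AnalyticAt ℂ R 0) :
    res (pgerm fun s => ((∑ j ∈ Finset.range M, c j * s ^ (2 * j + 1)) + s ^ (2 * M) * R s) *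
      (s ^ (2 * k + 2))⁻¹) = c k := by
  have e : pgerm (fun s => ((∑ j ∈ Finset.range M, c j * s ^ (2 * j + 1)) + s ^ (2 * M) * R s) *
      (s ^ (2 * k + 2))⁻¹) = (∑ j ∈ Finset.range M, c j • pgerm fun s =>
        s ^ (2 * j + 1) * (s ^ (2 * k + 2))⁻¹) +
      pgerm (fun s => s ^ (2 * M)) * pgerm (fun s => (s ^ (2 * k + 2))⁻¹) * pgerm R := by
    simp only [← pgerm_const_mul, ← pgerm_sum, ← pgerm_mul]
    rw [← pgerm_add]
    refine pgerm_eq fun s _ => ?_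
    rw [add_mul, Finset.sum_mul]
    congr 1
    · exact Finset.sum_congr rfl fun j _ => by ring
    · ring
  have h1 : ∀ j, res (pgerm fun s => s ^ (2 * j + 1) * (s ^ (2 * k + 2))⁻¹) =
      if k = j then 1 else 0 := fun j => by
    rw [← oddCoeff_inv_pow k j]
    rfl
  have h2 : res (pgerm (fun s => s ^ (2 * M)) * pgerm (fun s => (s ^ (2 * k + 2))⁻¹) * pgerm R) = 0 := by
    refine res_of_mem_ordGe_zero (ordGe_anti ?_ (mem_ordGe_mul (mem_ordGe_mul (pow_mem_ordGe _)
      (inv_pow_mem_ordGe _)) (analytic_mem_ordGe hR)))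
    push_cast
    omega
  rw [e, map_add, h2, map_sum, add_zero]
  simp [h1, hk]

theorem plusCoeff_eq {f : Vplus I} {α : I} {M k : ℕ} (hk : k < M) {c : ℕ → ℂ} {R : ℂ → ℂ}
    (hR : AnalyticAt ℂ R 0) (h : ∀ᶠ s in 𝓝 0,
      germRep (f.1 α) s = (∑ j ∈ Finset.range M, c j * s ^ (2 * j + 1)) + s ^ (2 * M) * R s) :
    plusCoeff (α, k) f = c k := by
  rw [← res_taylor_mul hk c hR]
  change res _ = _
  congr 1
  refine Germ.coe_eq.2 ?_
  filter_upwards [h.filter_mono nhdsWithin_le_nhds] with s hs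
  rw [hs]

/-- A vanishing derivative leaves a constant on a disc, and oddness forces the constant to be zero.
-/
theorem odd_zero {f : Vplus I} (h : diffPlus f = 0) : f = 0 := by
  refine Subtype.ext (funext fun α => ?_)
  obtain ⟨ph, h1, h2, h3⟩ := Vplus_exists_rep f α
  have h4 : deriv ph =ᶠ[𝓝[≠] 0] fun _ => 0 := by
    have := congrFun h α
    rw [diffPlus_apply, locD_eq h3] at this
    exact Germ.coe_eq.1 this
  -- The hypothesis concerns germs on the punctured neighbourhood; analyticity extends the vanishing
  -- across `0`.
  have h5 : ∀ᶠ s in 𝓝 0, deriv ph s = 0 := by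
    have := (h1.deriv.frequently_zero_iff_eventually_zero).1
      (Eventually.frequently h4)
    exact this
  have h0 : ph 0 = 0 := by
    have := h2.self_of_nhds
    rw [neg_zero] at this
    exact self_eq_neg.1 this
  obtain ⟨ε, hε, hb⟩ := Metric.eventually_nhds_iff.1 (h5.and h1.eventually_analyticAt)
  have h6 : ∀ s ∈ Metric.ball (0 : ℂ) ε, ph s = 0 := by
    intro s hs
    rw [← h0]
    exact Metric.isOpen_ball.is_const_of_deriv_eq_zero (convex_ball (0 : ℂ) ε).isPreconnected
      (fun z hz => (hb hz).2.differentiableAt.differentiableWithinAt)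
      (fun z hz => (hb hz).1) hs (Metric.mem_ball_self hε)
  rw [← coe_germRep (f.1 α)]
  refine Germ.coe_eq.2 ?_
  filter_upwards [h3, Metric.ball_mem_nhds (0 : ℂ) hε] with s h7 h8
  rw [h7, h6 s h8]

theorem mem_VplusGt_of_taylor {f : Vplus I} {N : ℕ} (h : ∀ α, ∀ k ≤ N, plusCoeff (α, k) f = 0) :
    f ∈ VplusGt I N := by
  intro α
  obtain ⟨c, R, hR, e⟩ := Vplus_exists_taylor f α (N + 1)
  refine ⟨R, hR, ?_⟩
  rw [← coe_germRep (f.1 α)]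
  refine Germ.coe_eq.2 ?_
  filter_upwards [e] with s hs
  rw [hs, Finset.sum_eq_zero, zero_add, Nat.mul_succ]
  intro j hj
  rw [← plusCoeff_eq (Finset.mem_range.1 hj) hR e, h α j (Nat.lt_succ_iff.1 (Finset.mem_range.1 hj)),
    zero_mul]

variable [DecidableEq I]

theorem germRep_epsGerm (b : I × ℕ) (α : I) : germRep ((epsGerm b : Vplus I).1 α) =ᶠ[𝓝 0]
    fun s => if α = b.1 then s ^ (2 * b.2 + 1) / ((2 * b.2 + 1)‼ : ℂ) else 0 := by
  by_cases h : α = b.1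
  · simp only [epsGerm, h, if_true]
    exact germRep_coe _
  · simp only [epsGerm, h, if_false]
    exact germRep_coe (fun _ => 0)

theorem plusCoeff_epsGerm (a b : I × ℕ) :
    plusCoeff a (epsGerm b) = if a = b then ((2 * b.2 + 1)‼ : ℂ)⁻¹ else 0 := by
  have h := plusCoeff_eq (f := epsGerm b) (α := a.1) (M := a.2 + b.2 + 1) (k := a.2) (by omega)
    (c := fun j => if a.1 = b.1 ∧ j = b.2 then ((2 * b.2 + 1)‼ : ℂ)⁻¹ else 0) (R := fun _ => 0)
    analyticAt_const ?_
  · rw [h]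
    exact if_congr Prod.ext_iff.symm rfl rfl
  · filter_upwards [germRep_epsGerm b a.1] with s hs
    rw [hs, mul_zero, add_zero]
    split_ifs with h1
    · simp only [h1, true_and]
      rw [Finset.sum_eq_single b.2]
      · rw [if_pos rfl]
        ring
      · intro j _ hj
        rw [if_neg hj, zero_mul]
      · intro h2
        exact absurd (Finset.mem_range.2 (by omega)) h2
    · simp [h1]

theorem doubleFactorial_ne_zero (k : ℕ) : ((2 * k + 1)‼ : ℂ) ≠ 0 :=
  Nat.cast_ne_zero.2 (Nat.ne_of_gt (Nat.doubleFactorial_pos _))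

/-- The germ equal to `s ^ (2 k + 1)` at `β` and zero elsewhere. -/
noncomputable def monoGerm (b : I × ℕ) : Vplus I := ((2 * b.2 + 1)‼ : ℂ) • epsGerm b

theorem plusCoeff_monoGerm (a b : I × ℕ) :
    plusCoeff a (monoGerm b : Vplus I) = if a = b then 1 else 0 := by
  rw [monoGerm, map_smul, plusCoeff_epsGerm, smul_ite, smul_zero, smul_eq_mul,
    mul_inv_cancel₀ (doubleFactorial_ne_zero _)]

theorem monoGerm_mem_VplusGt {b : I × ℕ} {N : ℕ} (h : N < b.2) : monoGerm b ∈ VplusGt I N := by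
  refine mem_VplusGt_of_taylor fun α k hk => ?_
  rw [plusCoeff_monoGerm, if_neg]
  rintro rfl
  exact absurd h (not_lt.2 hk)

theorem sub_sum_monoGerm_mem [Fintype I] (f : Vplus I) (N : ℕ) :
    f - ∑ b ∈ Finset.univ ×ˢ Finset.range (N + 1), plusCoeff b f • monoGerm b ∈ VplusGt I N := by
  refine mem_VplusGt_of_taylor fun α k hk => ?_
  rw [map_sub, map_sum]
  simp only [map_smul, plusCoeff_monoGerm]
  rw [Finset.sum_eq_single (α, k)]
  · simp
  · intro b _ hb
    rw [if_neg hb.symm, smul_zero]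
  · intro h
    exact absurd (Finset.mem_product.2 ⟨Finset.mem_univ _, Finset.mem_range.2 (by
      change k < N + 1
      omega)⟩) h

end Odd

/-! ### Decomposition of meromorphic forms -/

section Decomposition

variable {I : Type*}

/-- The pullback of `ds` contributes a sign, so even forms are those with odd coefficient functions.
-/
theorem isEvenLocForm_iff {e : LocForm I} : IsEvenLocForm e ↔ ∀ α, ∃ g : ℂ → ℂ, e α = pgerm g ∧
    MeromorphicAt g 0 ∧ ∀ᶠ s in 𝓝[≠] (0 : ℂ), g (-s) = -g s := by
  refine forall_congr' fun α => ⟨fun ⟨h1, h2⟩ => ⟨_, (coe_germRep _).symm, h1, ?_⟩, ?_⟩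
  · filter_upwards [h2] with s hs
    rw [← hs, sigmaPull, neg_neg]
  · rintro ⟨g, h1, h2, h3⟩
    have h4 : germRep (e α) =ᶠ[𝓝[≠] 0] g := h1 ▸ germRep_coe g
    refine ⟨h2.congr h4.symm, ?_⟩
    filter_upwards [h4, tendsto_neg_punctured.eventually h4, h3] with s h5 h6 h7
    rw [sigmaPull, h5, h6, h7, neg_neg]

theorem IsEvenLocForm.mem_merLoc {e : LocForm I} (h : IsEvenLocForm e) : e ∈ merLoc I :=
  _root_.mem_merLoc.2 fun α => (h α).1

theorem IsEvenLocForm.pp_eq_zero [Finite I] {e : LocForm I} (h : IsEvenLocForm e) : pp e = 0 := by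
  ext b
  obtain ⟨g, h1, h2, h3⟩ := isEvenLocForm_iff.1 h b.1
  rw [pp_apply h.mem_merLoc, h1, oddCoeff_eq_zero_of_neg h2 h3]
  rfl

theorem IsEvenLocForm.sub {e e' : LocForm I} (h : IsEvenLocForm e) (h' : IsEvenLocForm e') :
    IsEvenLocForm (e - e') := by
  refine isEvenLocForm_iff.2 fun α => ?_
  obtain ⟨g, h1, h2, h3⟩ := isEvenLocForm_iff.1 h α
  obtain ⟨k, k1, k2, k3⟩ := isEvenLocForm_iff.1 h' α
  refine ⟨fun s => g s - k s, by rw [Pi.sub_apply, h1, k1]; rfl, h2.fun_sub k2, ?_⟩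
  filter_upwards [h3, k3] with s h k
  rw [h, k]
  ring

/-- The derivative of an odd function is an even function, so `d f` is an odd form; being even too,
it vanishes, and `odd_zero` applies. -/
theorem eq_zero_of_isEvenLocForm_diffPlus {f : Vplus I} (h : IsEvenLocForm (diffPlus f)) : f = 0 := by
  refine odd_zero (funext fun α => ?_)
  obtain ⟨g, h1, -, h3⟩ := isEvenLocForm_iff.1 h α
  obtain ⟨ph, k1, k2, k3⟩ := Vplus_exists_rep f α
  rw [h1]
  rw [diffPlus_apply, locD_eq k3] at h1
  have h4 := Germ.coe_eq.1 h1
  have h5 : ∀ᶠ s in 𝓝 0, deriv ph (-s) = deriv ph s := by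
    filter_upwards [k2.eventually_nhds] with s hs
    have e : (fun s => ph (-s)) =ᶠ[𝓝 s] fun s => -ph s := hs
    have e' := e.deriv_eq
    rw [deriv_comp_neg, deriv.fun_neg] at e'
    exact neg_injective e'
  refine Germ.coe_eq.2 ?_
  filter_upwards [h3, h4, tendsto_neg_punctured.eventually h4,
    h5.filter_mono nhdsWithin_le_nhds] with s e1 e2 e3 e4
  rw [← e2, ← e3, e4] at e1
  rw [← e2]
  exact self_eq_neg.1 e1

/-- The even part of the coefficient integrates to an odd function. In the decomposition below, the
odd part is absorbed by the even form. -/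
theorem exists_odd_primitive {h : ℂ → ℂ} (hh : AnalyticAt ℂ h 0) :
    ∃ ph : ℂ → ℂ, AnalyticAt ℂ ph 0 ∧ (∀ s, ph (-s) = -ph s) ∧
      ∀ᶠ s in 𝓝 0, deriv ph s = (1 / 2 : ℂ) * (h s + h (-s)) := by
  have ha : AnalyticAt ℂ (fun s => (1 / 2 : ℂ) * (h s + h (-s))) 0 :=
    analyticAt_const.fun_mul (hh.fun_add hh.comp_neg_zero)
  obtain ⟨h1, h2⟩ := primZero_analytic ha
  refine ⟨_, h1, primZero_neg fun s => ?_, h2⟩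
  rw [neg_neg, add_comm]

theorem oddCoeff_polar {N j : ℕ} (hj : j < N) (a b : ℕ → ℂ) {h : ℂ → ℂ} (hh : AnalyticAt ℂ h 0) :
    oddCoeff j (pgerm fun s => (∑ j ∈ Finset.range N,
      (a j * (s ^ (2 * j + 1))⁻¹ + b j * (s ^ (2 * j + 2))⁻¹)) + h s) = b j := by
  have h1 : ∀ i, oddCoeff j (pgerm fun s => (s ^ (2 * i + 1))⁻¹) = 0 := fun i =>
    oddCoeff_eq_zero_of_neg (by fun_prop) (Eventually.of_forall fun s => by
      rw [Odd.neg_pow ⟨i, rfl⟩, inv_neg]) j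
  rw [pgerm_add, map_add, oddCoeff_eq_zero (analytic_mem_ordGe hh) (by omega), pgerm_sum, map_sum]
  simp only [pgerm_add, pgerm_const_mul, map_add, map_smul, h1, oddCoeff_inv_pow]
  simp [hj]

variable [Finite I] [DecidableEq I] {ξ : I × ℕ → LocForm I}

/-- Once the lift of `pp χ` is subtracted, the polar part has only odd powers of `s`, which are even
forms. The holomorphic part splits by parity of its coefficient into the differential of an odd germ
and an even form. -/
theorem exists_decomposition (hξ : ∀ b, ξ b - sing b ∈ ordLoc I 0) {χ : LocForm I}
    (hχ : χ ∈ merLoc I) : ∃ (f : Vplus I) (e : LocForm I), IsEvenLocForm e ∧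
      χ = liftPP ξ (pp χ) + diffPlus f + e := by
  set y := χ - liftPP ξ (pp χ) with hy
  have hy1 : y ∈ merLoc I := sub_mem hχ (oddLoc_le_merLoc (liftPP_mem_oddLoc hξ _))
  have hy2 : pp y = 0 := by rw [hy, map_sub, pp_liftPP hξ, sub_self]
  have key : ∀ α, ∃ (ph g : ℂ → ℂ), AnalyticAt ℂ ph 0 ∧ (∀ s, ph (-s) = -ph s) ∧
      MeromorphicAt g 0 ∧ (∀ᶠ s in 𝓝[≠] (0 : ℂ), g (-s) = -g s) ∧ y α = pgerm (deriv ph) + pgerm g := by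
    intro α
    obtain ⟨N, a, b, h, hh, he⟩ :=
      MeromorphicAt.exists_polar_decomposition (mem_merLoc.1 hy1 α)
    have hya : y α = pgerm (germRep (y α)) := (coe_germRep _).symm
    have hb : ∀ j < N, b j = 0 := by
      intro j hj
      rw [← oddCoeff_polar hj a b hh]
      refine (congrArg (oddCoeff j) (hya.trans (Germ.coe_eq.2 he))).symm.trans ?_
      have := congrArg (fun v : PrincipalPart I => v (α, j)) hy2
      change pp y (α, j) = 0 at this
      rwa [pp_apply hy1] at this
    obtain ⟨ph, h1, h2, h3⟩ := exists_odd_primitive hh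
    refine ⟨ph, fun s => (∑ j ∈ Finset.range N, a j * (s ^ (2 * j + 1))⁻¹) +
      (1 / 2 : ℂ) * (h s - h (-s)), h1, h2, ?_, Eventually.of_forall fun s => ?_, ?_⟩
    · have h5 : AnalyticAt ℂ (fun s => (1 / 2 : ℂ) * (h s - h (-s))) 0 :=
        analyticAt_const.fun_mul (hh.fun_sub hh.comp_neg_zero)
      refine MeromorphicAt.fun_add ?_ h5.meromorphicAt
      exact MeromorphicAt.fun_sum fun j _ => by fun_prop
    · simp only [neg_neg]
      rw [neg_add, ← Finset.sum_neg_distrib]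
      congr 1
      · refine Finset.sum_congr rfl fun j _ => ?_
        rw [Odd.neg_pow ⟨j, rfl⟩, inv_neg, mul_neg]
      · ring
    · rw [hya, ← pgerm_add]
      refine Germ.coe_eq.2 ?_
      filter_upwards [he, h3.filter_mono nhdsWithin_le_nhds] with s e1 e2
      have e3 : ∑ j ∈ Finset.range N, (a j * (s ^ (2 * j + 1))⁻¹ + b j * (s ^ (2 * j + 2))⁻¹) =
          ∑ j ∈ Finset.range N, a j * (s ^ (2 * j + 1))⁻¹ := by
        refine Finset.sum_congr rfl fun j hj => ?_
        rw [hb j (Finset.mem_range.1 hj), zero_mul, add_zero]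
      rw [e1, e2, e3]
      ring
  choose ph g h1 h2 h3 h4 h5 using key
  refine ⟨ofOdd ph h1 fun α => .of_forall (h2 α),
    fun α => pgerm (g α), isEvenLocForm_iff.2 fun α => ⟨g α, rfl, h3 α, h4 α⟩, ?_⟩
  rw [add_assoc, ← sub_eq_iff_eq_add', ← hy]
  funext α
  rw [h5, Pi.add_apply, diffPlus_apply, locD_eq (germRep_ofOdd h1 _ α)]

/-- `pp` vanishes on differentials of odd germs and on even forms, so it recovers `v`. The remaining
ambiguity is a differential that is also even, hence zero. -/
theorem decomposition_unique (hξ : ∀ b, ξ b - sing b ∈ ordLoc I 0) {v v' : PrincipalPart I}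
    {f f' : Vplus I} {e e' : LocForm I} (he : IsEvenLocForm e) (he' : IsEvenLocForm e')
    (h : liftPP ξ v + diffPlus f + e = liftPP ξ v' + diffPlus f' + e') :
    v = v' ∧ f = f' ∧ e = e' := by
  have hd : ∀ f : Vplus I, pp (diffPlus f) = 0 := fun f => pp_eq_zero (diffPlus_mem f) (by norm_num)
  have h1 := congrArg pp h
  simp only [map_add, pp_liftPP hξ, hd, he.pp_eq_zero, he'.pp_eq_zero, add_zero] at h1
  subst h1
  rw [add_assoc, add_assoc, add_right_inj] at h
  have h2 : diffPlus (f - f') = e' - e := by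
    rw [map_sub, sub_eq_sub_iff_add_eq_add, h, add_comm]
  have h3 : f - f' = 0 := eq_zero_of_isEvenLocForm_diffPlus (h2 ▸ he'.sub he)
  have h4 : f = f' := sub_eq_zero.1 h3
  subst h4
  exact ⟨rfl, rfl, add_left_cancel h⟩

end Decomposition

/-! ### Divided differences and double poles -/

open FormalMultilinearSeries in
/-- Functional calculus for a convergent power series on the algebra of operators of `ℂ × ℂ`. -/
theorem exists_functional_calculus {ρ : ℂ → ℂ} (hρ : AnalyticAt ℂ ρ 0) :
    ∃ (r : ℝ) (F : ((ℂ × ℂ) →L[ℂ] (ℂ × ℂ)) → ((ℂ × ℂ) →L[ℂ] (ℂ × ℂ))), 0 < r ∧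
      (∀ M, ‖M‖ < r → AnalyticAt ℂ F M) ∧
      ∀ M, ‖M‖ < r → ∀ (l : ℂ) (v : ℂ × ℂ), ‖l‖ < r → M v = l • v → F M v = ρ l • v := by
  set c : ℕ → ℂ := fun n => iteratedDeriv n ρ 0 / n.factorial with hc
  have h := hρ.hasFPowerSeriesAt
  obtain ⟨R, hR⟩ := h
  set p := ofScalars ((ℂ × ℂ) →L[ℂ] (ℂ × ℂ)) c with hp
  -- Coefficients of the scalar and the operator series have equal norms, so the operator series
  -- converges at least as far.
  have hrad : R ≤ p.radius := by
    refine hR.r_le.trans ?_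
    refine ENNReal.le_of_forall_nnreal_lt fun r hr => ?_
    obtain ⟨C, _, hC⟩ := (ofScalars ℂ c).norm_mul_pow_le_of_lt_radius hr
    refine p.le_radius_of_bound C fun n => ?_
    have := hC n
    rw [ofScalars_norm] at this
    rwa [hp, ofScalars_norm]
  have hpos : 0 < p.radius := hR.r_pos.trans_le hrad
  have hb := p.hasFPowerSeriesOnBall hpos
  obtain ⟨r, hr0, hrR⟩ := ENNReal.lt_iff_exists_nnreal_btwn.1 hR.r_pos
  have hr0' : (0 : ℝ) < r := by exact_mod_cast hr0
  have hmem : ∀ {E : Type} [NormedAddCommGroup E] {x : E} {R' : ENNReal}, (r : ENNReal) < R' →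
      ‖x‖ < r → x ∈ Metric.eball (0 : E) R' := by
    intro E _ x R' h1 h2
    rw [Metric.mem_eball, edist_zero_right, ← ofReal_norm]
    refine lt_of_lt_of_le ((ENNReal.ofReal_lt_ofReal_iff hr0').2 h2) ?_
    rw [ENNReal.ofReal_coe_nnreal]
    exact h1.le
  refine ⟨r, p.sum, hr0', fun M hM => ?_, fun M hM l v hl hv => ?_⟩
  · exact hb.analyticAt_of_mem (hmem (hrR.trans_le hrad) hM)
  · have h1 := hb.hasSum (hmem (hrR.trans_le hrad) hM)
    have h2 := hR.hasSum (hmem hrR hl)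
    simp only [zero_add] at h1 h2
    -- On an eigenvector the powers of `M` act by scalars, so the operator series collapses to the
    -- scalar series of `ρ l`.
    have hpow : ∀ n : ℕ, (M ^ n) v = l ^ n • v := by
      intro n
      induction n with
      | zero => simp
      | succ n ih => rw [pow_succ, mul_apply_eq_comp, hv, map_smul, ih, smul_smul,
          pow_succ, mul_comm]
    have h3 := (ContinuousLinearMap.apply ℂ (ℂ × ℂ) v).hasSum h1
    have h4 := h2.smul_const v
    have e : (fun n => p n (fun _ => M) v) = fun n =>
        (ofScalars ℂ (fun n => iteratedDeriv n ρ 0 / n.factorial) n fun _ => l) • v := by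
      funext n
      rw [hp, ofScalars_apply_eq, ofScalars_apply_eq]
      change c n • (M ^ n) v = _
      rw [hpow, smul_smul, smul_eq_mul]
    have h5 : HasSum (fun n => p n (fun _ => M) v) (p.sum M v) := h3
    rw [e] at h5
    exact h5.unique h4

/-- The divided difference is read off from a function of a triangular matrix: for `M z` with
diagonal `z.1, z.2` and upper corner `δ`, the upper corner of `ρ (M z)` is `δ` times the quotient
`(ρ z.1 - ρ z.2) / (z.1 - z.2)`. It is analytic in `z` because `M z` is affine in `z`, so no
separate argument on the diagonal is needed. -/
theorem exists_divided_difference {ρ : ℂ → ℂ} (hρ : AnalyticAt ℂ ρ 0) :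
    ∃ q : ℂ × ℂ → ℂ, AnalyticAt ℂ q (0, 0) ∧
      ∀ᶠ z : ℂ × ℂ in 𝓝 (0, 0), ρ z.1 - ρ z.2 = (z.1 - z.2) * q z := by
  obtain ⟨r, F, hr, hF, hFv⟩ := exists_functional_calculus hρ
  obtain ⟨N, hN⟩ : ∃ N : (ℂ × ℂ) →L[ℂ] (ℂ × ℂ), ∀ v, N v = (v.2, 0) :=
    ⟨(ContinuousLinearMap.inl ℂ ℂ ℂ).comp (ContinuousLinearMap.snd ℂ ℂ ℂ), fun _ => rfl⟩
  obtain ⟨P₁, hP₁⟩ : ∃ N : (ℂ × ℂ) →L[ℂ] (ℂ × ℂ), ∀ v, N v = (v.1, 0) :=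
    ⟨(ContinuousLinearMap.inl ℂ ℂ ℂ).comp (ContinuousLinearMap.fst ℂ ℂ ℂ), fun _ => rfl⟩
  obtain ⟨P₂, hP₂⟩ : ∃ N : (ℂ × ℂ) →L[ℂ] (ℂ × ℂ), ∀ v, N v = (0, v.2) :=
    ⟨(ContinuousLinearMap.inr ℂ ℂ ℂ).comp (ContinuousLinearMap.snd ℂ ℂ ℂ), fun _ => rfl⟩
  have hz : ∀ A : (ℂ × ℂ) →L[ℂ] (ℂ × ℂ), (0 : ℂ) • A = 0 := fun A =>
    ContinuousLinearMap.ext fun v => zero_smul ℂ (A v)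
  -- `δ` is divided out at the end, so it must be non-zero, yet small enough that `M (0, 0) = δ • N`
  -- lies in the domain of the functional calculus.
  obtain ⟨δ, hδ0, hδ⟩ : ∃ δ : ℂ, δ ≠ 0 ∧ ‖δ • N‖ < r := by
    have ht : Tendsto (fun δ : ℂ => ‖δ • N‖) (𝓝[≠] 0) (𝓝 0) := by
      have : Continuous (fun δ : ℂ => ‖δ • N‖) := by fun_prop
      have h0 : ‖(0 : ℂ) • N‖ = 0 := by rw [hz, norm_zero]
      exact h0 ▸ (this.tendsto 0).mono_left nhdsWithin_le_nhds
    obtain ⟨δ, h1, h2⟩ := ((ht.eventually (gt_mem_nhds hr)).and self_mem_nhdsWithin).exists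
    exact ⟨δ, by simpa using h2, h1⟩
  set M : ℂ × ℂ → ((ℂ × ℂ) →L[ℂ] (ℂ × ℂ)) := fun z => δ • N + z.1 • P₁ + z.2 • P₂ with hM
  have hM0 : M (0, 0) = δ • N := by
    change δ • N + (0 : ℂ) • P₁ + (0 : ℂ) • P₂ = _
    rw [hz, hz, add_zero, add_zero]
  have hMa : AnalyticAt ℂ M (0, 0) :=
    (analyticAt_const.fun_add (analyticAt_fst.fun_smul analyticAt_const)).fun_add
      (analyticAt_snd.fun_smul analyticAt_const)
  have hFa : AnalyticAt ℂ F (M (0, 0)) := hF _ (by rwa [hM0])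
  have hFM : AnalyticAt ℂ (fun z => F (M z)) (0, 0) := hFa.fun_comp hMa
  refine ⟨fun z => δ⁻¹ * (ContinuousLinearMap.fst ℂ ℂ ℂ)
    ((ContinuousLinearMap.apply ℂ (ℂ × ℂ) ((0, 1) : ℂ × ℂ)) (F (M z))), ?_, ?_⟩
  · refine analyticAt_const.fun_mul ?_
    exact ((ContinuousLinearMap.fst ℂ ℂ ℂ).analyticAt _).fun_comp
      (((ContinuousLinearMap.apply ℂ (ℂ × ℂ) ((0, 1) : ℂ × ℂ)).analyticAt _).fun_comp hFM)
  · have h1 : ∀ᶠ z in 𝓝 ((0, 0) : ℂ × ℂ), ‖M z‖ < r := by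
      have : Tendsto (fun z => ‖M z‖) (𝓝 (0, 0)) (𝓝 ‖M (0, 0)‖) := hMa.continuousAt.norm.tendsto
      exact this.eventually (gt_mem_nhds (by rwa [hM0]))
    have h2 : ∀ᶠ z in 𝓝 ((0, 0) : ℂ × ℂ), ‖z.1‖ < r := by
      have : Tendsto (fun z : ℂ × ℂ => ‖z.1‖) (𝓝 (0, 0)) (𝓝 ‖(0 : ℂ)‖) :=
        (continuous_fst.norm).tendsto (0, 0)
      exact this.eventually (gt_mem_nhds (by simpa using hr))
    have h3 : ∀ᶠ z in 𝓝 ((0, 0) : ℂ × ℂ), ‖z.2‖ < r := by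
      have : Tendsto (fun z : ℂ × ℂ => ‖z.2‖) (𝓝 (0, 0)) (𝓝 ‖(0 : ℂ)‖) :=
        (continuous_snd.norm).tendsto (0, 0)
      exact this.eventually (gt_mem_nhds (by simpa using hr))
    filter_upwards [h1, h2, h3] with z h1 h2 h3
    have e1 := hFv _ h1 z.1 (1, 0) h2 (by simp [hM, hN, hP₁, hP₂])
    -- This is an eigenvector for `z.2` even on the diagonal, where it is proportional to `(1, 0)`.
    -- Comparing first components in the basis `(1, 0)`, `(0, 1)` gives the quotient.
    have e2 := hFv _ h1 z.2 (δ, z.2 - z.1) h3 (by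
      simp [hM, hN, hP₁, hP₂]
      ring)
    have e3 : ((δ, z.2 - z.1) : ℂ × ℂ) = δ • (1, 0) + (z.2 - z.1) • (0, 1) := by simp
    rw [e3, map_add, map_smul, map_smul, e1] at e2
    have e4 := congrArg Prod.fst e2
    simp only [Prod.smul_mk, smul_eq_mul, mul_one, mul_zero, Prod.fst_add, Prod.smul_fst,
      Prod.fst_add, Prod.mk_add_mk, add_zero] at e4
    simp only [ContinuousLinearMap.apply_apply, ContinuousLinearMap.coe_fst']
    field_simp
    linear_combination e4

theorem AnalyticAt.fderiv_apply_const {q : ℂ × ℂ → ℂ} {z : ℂ × ℂ} (hq : AnalyticAt ℂ q z)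
    (v : ℂ × ℂ) : AnalyticAt ℂ (fun z => fderiv ℂ q z v) z :=
  ((ContinuousLinearMap.apply ℂ ℂ v).analyticAt _).fun_comp hq.fderiv

theorem hasDerivAt_fst {q : ℂ × ℂ → ℂ} {z : ℂ × ℂ} (hq : DifferentiableAt ℂ q z) :
    HasDerivAt (fun s => q (s, z.2)) (fderiv ℂ q z (1, 0)) z.1 := by
  have h : HasDerivAt (fun s : ℂ => (s, z.2)) ((1 : ℂ), (0 : ℂ)) z.1 :=
    (hasDerivAt_id z.1).prodMk (hasDerivAt_const _ _)
  exact hq.hasFDerivAt.comp_hasDerivAt (f := fun s : ℂ => (s, z.2)) z.1 h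

theorem hasDerivAt_snd {q : ℂ × ℂ → ℂ} {z : ℂ × ℂ} (hq : DifferentiableAt ℂ q z) :
    HasDerivAt (fun t => q (z.1, t)) (fderiv ℂ q z (0, 1)) z.2 := by
  have h : HasDerivAt (fun t : ℂ => (z.1, t)) ((0 : ℂ), (1 : ℂ)) z.2 :=
    (hasDerivAt_const _ _).prodMk (hasDerivAt_id z.2)
  exact hq.hasFDerivAt.comp_hasDerivAt (f := fun t : ℂ => (z.1, t)) z.2 h

/-- The double pole on the diagonal does not depend on the local coordinate. -/
theorem exists_double_pole {ρ : ℂ → ℂ} (hρ : AnalyticAt ℂ ρ 0) (h0 : deriv ρ 0 ≠ 0) :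
    (∀ᶠ z : ℂ × ℂ in 𝓝 (0, 0), z.1 ≠ z.2 → ρ z.1 ≠ ρ z.2) ∧
    ∃ h : ℂ × ℂ → ℂ, AnalyticAt ℂ h (0, 0) ∧ ∀ᶠ z : ℂ × ℂ in 𝓝 (0, 0), z.1 ≠ z.2 →
      1 / (ρ z.1 - ρ z.2) ^ 2 * deriv ρ z.1 * deriv ρ z.2 = 1 / (z.1 - z.2) ^ 2 + h z := by
  obtain ⟨q, hq, he⟩ := exists_divided_difference hρ
  set qs : ℂ × ℂ → ℂ := fun z => fderiv ℂ q z (1, 0) with hqs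
  set qt : ℂ × ℂ → ℂ := fun z => fderiv ℂ q z (0, 1) with hqt
  set qst : ℂ × ℂ → ℂ := fun z => fderiv ℂ qt z (1, 0) with hqst
  have as : AnalyticAt ℂ qs (0, 0) := hq.fderiv_apply_const _
  have at' : AnalyticAt ℂ qt (0, 0) := hq.fderiv_apply_const _
  have ast : AnalyticAt ℂ qst (0, 0) := at'.fderiv_apply_const _
  have tfst : Tendsto (fun z : ℂ × ℂ => z.1) (𝓝 (0, 0)) (𝓝 0) := continuous_fst.tendsto (0, 0)
  have tsnd : Tendsto (fun z : ℂ × ℂ => z.2) (𝓝 (0, 0)) (𝓝 0) := continuous_snd.tendsto (0, 0)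
  have dρ := hρ.eventually_analyticAt
  have slice1 : ∀ {z : ℂ × ℂ} {p : ℂ × ℂ → Prop}, (∀ᶠ w in 𝓝 z, p w) → ∀ᶠ s in 𝓝 z.1, p (s, z.2) := by
    intro z p h
    have : Tendsto (fun s : ℂ => (s, z.2)) (𝓝 z.1) (𝓝 z) :=
      (by fun_prop : Continuous fun s : ℂ => (s, z.2)).tendsto z.1
    exact this.eventually h
  have slice2 : ∀ {z : ℂ × ℂ} {p : ℂ × ℂ → Prop}, (∀ᶠ w in 𝓝 z, p w) → ∀ᶠ s in 𝓝 z.2, p (z.1, s) := by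
    intro z p h
    have : Tendsto (fun s : ℂ => (z.1, s)) (𝓝 z.2) (𝓝 z) :=
      (by fun_prop : Continuous fun s : ℂ => (z.1, s)).tendsto z.2
    exact this.eventually h
  have d1 : ∀ᶠ z : ℂ × ℂ in 𝓝 (0, 0), deriv ρ z.1 = q z + (z.1 - z.2) * qs z := by
    filter_upwards [he.eventually_nhds, hq.eventually_analyticAt, tfst.eventually dρ] with z h1 h2 h3
    have e1 : (fun s => ρ s - ρ z.2) =ᶠ[𝓝 z.1] fun s => (s - z.2) * q (s, z.2) := slice1 h1
    have e2 : HasDerivAt (fun s => ρ s - ρ z.2) (deriv ρ z.1) z.1 :=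
      h3.differentiableAt.hasDerivAt.sub_const _
    have e3 := ((hasDerivAt_id z.1).sub_const z.2).fun_mul (hasDerivAt_fst h2.differentiableAt)
    rw [e2.unique (e3.congr_of_eventuallyEq e1)]
    simp [hqs]
  have d2 : ∀ᶠ z : ℂ × ℂ in 𝓝 (0, 0), deriv ρ z.2 = q z - (z.1 - z.2) * qt z := by
    filter_upwards [he.eventually_nhds, hq.eventually_analyticAt, tsnd.eventually dρ] with z h1 h2 h3
    have e1 : (fun s => ρ z.1 - ρ s) =ᶠ[𝓝 z.2] fun s => (z.1 - s) * q (z.1, s) := slice2 h1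
    have e2 : HasDerivAt (fun s => ρ z.1 - ρ s) (-deriv ρ z.2) z.2 :=
      h3.differentiableAt.hasDerivAt.const_sub _
    have e3 := ((hasDerivAt_id z.2).const_sub z.1).fun_mul (hasDerivAt_snd h2.differentiableAt)
    have e4 := e2.unique (e3.congr_of_eventuallyEq e1)
    simp only [id] at e4
    linear_combination -e4
  -- Differentiating `d2` in the first variable, where its left side is constant, yields another
  -- factor `z.1 - z.2`. It removes the simple pole left in the product of `d1` and `d2`.
  have d3 : ∀ᶠ z : ℂ × ℂ in 𝓝 (0, 0), qs z - qt z = (z.1 - z.2) * qst z := by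
    filter_upwards [d2.eventually_nhds, hq.eventually_analyticAt, at'.eventually_analyticAt]
      with z h1 h2 h3
    have e1 : (fun _ => deriv ρ z.2) =ᶠ[𝓝 z.1] fun s => q (s, z.2) - (s - z.2) * qt (s, z.2) :=
      slice1 h1
    have e3 := (hasDerivAt_fst h2.differentiableAt).fun_sub
      (((hasDerivAt_id z.1).sub_const z.2).fun_mul (hasDerivAt_fst h3.differentiableAt))
    have e4 := (hasDerivAt_const z.1 (deriv ρ z.2)).unique (e3.congr_of_eventuallyEq e1)
    simp only [id] at e4
    linear_combination -e4
  have hq0 : q (0, 0) ≠ 0 := by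
    have := d1.self_of_nhds
    simp only [sub_self, zero_mul, add_zero] at this
    rwa [← this]
  have hqne : ∀ᶠ z in 𝓝 (0, 0), q z ≠ 0 := hq.continuousAt.eventually_ne hq0
  -- With `D = z.1 - z.2`, this is `((q + D qs) (q - D qt) - q²) / (D² q²)` after substituting `qs -
  -- qt = D qst`.
  refine ⟨?_, fun z => (q z * qst z - qs z * qt z) / q z ^ 2, ?_, ?_⟩
  · filter_upwards [he, hqne] with z h1 h2 h3 h4
    rw [h4, sub_self] at h1
    exact mul_ne_zero (sub_ne_zero.2 h3) h2 h1.symm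
  · exact ((hq.fun_mul ast).fun_sub (as.fun_mul at')).fun_div (hq.fun_pow 2) (pow_ne_zero 2 hq0)
  · filter_upwards [he, d1, d2, d3, hqne] with z h1 h2 h3 h4 h5 h6
    have h7 : z.1 - z.2 ≠ 0 := sub_ne_zero.2 h6
    rw [h1, h2, h3]
    field_simp
    linear_combination (z.1 - z.2) * q z * h4

/-! ### Taylor coefficients of functions with a double pole -/

theorem iteratedDeriv_double_pole (m : ℕ) (s : ℂ) : ∀ t, t ≠ s →
    iteratedDeriv m (fun t => 1 / (s - t) ^ 2) t = ((m + 1)! : ℂ) * ((s - t) ^ (m + 2))⁻¹ := by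
  induction m with
  | zero => intro t _; simp
  | succ m ih =>
    intro t ht
    rw [iteratedDeriv_succ]
    have e : iteratedDeriv m (fun t => 1 / (s - t) ^ 2) =ᶠ[𝓝 t]
        fun t => ((m + 1)! : ℂ) * ((s - t) ^ (m + 2))⁻¹ := by
      filter_upwards [isOpen_ne.mem_nhds ht] with u hu using ih u hu
    have h1 : s - t ≠ 0 := sub_ne_zero.2 ht.symm
    have h2 := (((((hasDerivAt_id t).const_sub s).fun_pow (m + 2)).fun_inv
      (pow_ne_zero _ h1)).const_mul ((m + 1)! : ℂ))
    simp only [id] at h2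
    rw [e.deriv_eq, h2.deriv, Nat.factorial_succ (m + 1)]
    push_cast
    field_simp
    ring

/-- Each derivative in the second direction is a component of `fderiv`, hence jointly analytic;
joint analyticity keeps the value at `t = 0` analytic in the first variable. -/
theorem AnalyticAt.iteratedDeriv_snd {h : ℂ × ℂ → ℂ} (hh : AnalyticAt ℂ h (0, 0)) (m : ℕ) :
    ∃ H : ℂ × ℂ → ℂ, AnalyticAt ℂ H (0, 0) ∧
      ∀ᶠ z : ℂ × ℂ in 𝓝 (0, 0), iteratedDeriv m (fun t => h (z.1, t)) z.2 = H z := by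
  induction m with
  | zero => exact ⟨h, hh, by simp⟩
  | succ m ih =>
    obtain ⟨H, hH, he⟩ := ih
    refine ⟨fun z => fderiv ℂ H z (0, 1), hH.fderiv_apply_const _, ?_⟩
    filter_upwards [he.eventually_nhds, hH.eventually_analyticAt] with z h1 h2
    rw [iteratedDeriv_succ]
    have e : iteratedDeriv m (fun t => h (z.1, t)) =ᶠ[𝓝 z.2] fun t => H (z.1, t) := by
      have : Tendsto (fun s : ℂ => (z.1, s)) (𝓝 z.2) (𝓝 z) :=
        (by fun_prop : Continuous fun s : ℂ => (z.1, s)).tendsto z.2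
      exact this.eventually h1
    rw [e.deriv_eq, (hasDerivAt_snd h2.differentiableAt).deriv]

/-- For fixed `s ≠ 0` everything is analytic in `t` near `0` and can be differentiated termwise. A
Taylor coefficient in `t` thereby turns the pole on the diagonal into a pole of order `m + 2` at `s
= 0`. -/
theorem exists_iteratedDeriv_double_pole {f : ℂ → ℂ → ℂ} {d : ℂ} {h : ℂ × ℂ → ℂ}
    (hh : AnalyticAt ℂ h (0, 0)) (hf : ∀ᶠ z : ℂ × ℂ in 𝓝 (0, 0), z.1 ≠ z.2 →
      f z.1 z.2 = d * (1 / (z.1 - z.2) ^ 2) + h z) (m : ℕ) :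
    ∃ R : ℂ → ℂ, AnalyticAt ℂ R 0 ∧ ∀ᶠ s in 𝓝[≠] (0 : ℂ),
      iteratedDeriv m (f s) 0 = d * (((m + 1)! : ℂ) * (s ^ (m + 2))⁻¹) + R s := by
  obtain ⟨H, hH, he⟩ := hh.iteratedDeriv_snd m
  have hsl : Tendsto (fun s : ℂ => (s, (0 : ℂ))) (𝓝 0) (𝓝 (0, 0)) :=
    (by fun_prop : Continuous fun s : ℂ => (s, (0 : ℂ))).tendsto 0
  refine ⟨fun s => H (s, 0), ?_, ?_⟩
  · exact hH.fun_comp (f := fun s : ℂ => (s, (0 : ℂ))) (x := 0) (by fun_prop)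
  · rw [eventually_nhdsWithin_iff]
    filter_upwards [hsl.eventually he, hsl.eventually hf.eventually_nhds,
      hsl.eventually hh.eventually_analyticAt] with s h1 h2 h3 hs
    have hs' : s ≠ 0 := by simpa using hs
    have hsl2 : Tendsto (fun t : ℂ => (s, t)) (𝓝 0) (𝓝 (s, 0)) :=
      (by fun_prop : Continuous fun t : ℂ => (s, t)).tendsto 0
    have e : f s =ᶠ[𝓝 0] (fun t => d * (1 / (s - t) ^ 2)) + fun t => h (s, t) := by
      filter_upwards [hsl2.eventually h2, isOpen_ne.mem_nhds hs'.symm] with t h4 h5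
      exact h4 h5.symm
    have a1 : AnalyticAt ℂ (fun t => 1 / (s - t) ^ 2) 0 :=
      analyticAt_const.fun_div (by fun_prop) (by simpa using hs')
    have a2 : AnalyticAt ℂ (fun t => h (s, t)) 0 :=
      h3.fun_comp (f := fun t : ℂ => (s, t)) (x := 0) (by fun_prop)
    rw [e.iteratedDeriv_eq, iteratedDeriv_add (analyticAt_const.fun_mul a1).contDiffAt a2.contDiffAt,
      iteratedDeriv_const_mul_field, iteratedDeriv_double_pole m s 0 hs'.symm, h1, sub_zero]

/-! ### Parametrisations and bidifferentials -/

theorem clm_apply_eq_mul (L : ℂ →L[ℂ] ℂ) (a : ℂ) : L a = a * L 1 := by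
  have h := L.map_smul a 1
  rwa [smul_eq_mul, smul_eq_mul, mul_one] at h

section Velocity

variable {X : Type*} [TopologicalSpace X] [ChartedSpace ℂ X]

theorem velocity_congr {γ γ' : ℂ → X} {s : ℂ} (h : γ =ᶠ[𝓝 s] γ') : velocity γ s = velocity γ' s := by
  have e : (mfderiv 𝓘(ℂ, ℂ) 𝓘(ℂ, ℂ) γ s : ℂ →L[ℂ] ℂ) = mfderiv 𝓘(ℂ, ℂ) 𝓘(ℂ, ℂ) γ' s :=
    h.mfderiv_eq
  exact congrArg (fun L : ℂ →L[ℂ] ℂ => L 1) e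

theorem velocity_comp {δ : ℂ → X} {ρ : ℂ → ℂ} {s : ℂ}
    (hδ : MDifferentiableAt 𝓘(ℂ, ℂ) 𝓘(ℂ, ℂ) δ (ρ s)) (hρ : DifferentiableAt ℂ ρ s) :
    velocity (fun u => δ (ρ u)) s = velocity δ (ρ s) * deriv ρ s := by
  have e := mfderiv_comp s hδ hρ.mdifferentiableAt
  rw [mfderiv_eq_fderiv] at e
  have e' : velocity (fun u => δ (ρ u)) s =
      (mfderiv 𝓘(ℂ, ℂ) 𝓘(ℂ, ℂ) δ (ρ s) : ℂ →L[ℂ] ℂ) (fderiv ℂ ρ s 1) :=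
    congrArg (fun L : ℂ →L[ℂ] ℂ => L 1) e
  rw [e', fderiv_eq_smul_deriv, one_smul, mul_comm]
  exact clm_apply_eq_mul _ _

/-- The value of `d f` at `p` on the unit tangent vector. -/
noncomputable def differentialAt (f : X → ℂ) (p : X) : ℂ :=
  let df : ℂ →L[ℂ] ℂ := mfderiv 𝓘(ℂ, ℂ) 𝓘(ℂ, ℂ) f p
  df 1

theorem deriv_comp_velocity {f : X → ℂ} {γ : ℂ → X} {s : ℂ}
    (hf : MDifferentiableAt 𝓘(ℂ, ℂ) 𝓘(ℂ, ℂ) f (γ s))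
    (hγ : MDifferentiableAt 𝓘(ℂ, ℂ) 𝓘(ℂ, ℂ) γ s) :
    differentialAt f (γ s) * velocity γ s = deriv (fun u => f (γ u)) s := by
  have e := mfderiv_comp s hf hγ
  rw [mfderiv_eq_fderiv] at e
  have e' : fderiv ℂ (fun u => f (γ u)) s 1 =
      (mfderiv 𝓘(ℂ, ℂ) 𝓘(ℂ, ℂ) f (γ s) : ℂ →L[ℂ] ℂ) (velocity γ s) :=
    congrArg (fun L : ℂ →L[ℂ] ℂ => L 1) e
  rw [fderiv_eq_smul_deriv, one_smul] at e'
  rw [e', mul_comm]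
  exact (clm_apply_eq_mul _ _).symm

variable [IsManifold 𝓘(ℂ, ℂ) ω X]

theorem mdifferentiableAt_chart {p q : X} (hq : q ∈ (chartAt ℂ p).source) :
    MDifferentiableAt 𝓘(ℂ, ℂ) 𝓘(ℂ, ℂ) (chartAt ℂ p) q :=
  mdifferentiableAt_atlas (chart_mem_atlas ℂ p) hq

theorem mdifferentiableAt_chart_symm {p : X} {z : ℂ} (hz : z ∈ (chartAt ℂ p).target) :
    MDifferentiableAt 𝓘(ℂ, ℂ) 𝓘(ℂ, ℂ) (chartAt ℂ p).symm z :=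
  mdifferentiableAt_atlas_symm (chart_mem_atlas ℂ p) hz

theorem velocity_chart_symm_ne_zero {p : X} {z : ℂ} (hz : z ∈ (chartAt ℂ p).target) :
    velocity (chartAt ℂ p).symm z ≠ 0 := by
  intro h0
  have h1 := deriv_comp_velocity (f := chartAt ℂ p) (γ := (chartAt ℂ p).symm)
    (mdifferentiableAt_chart ((chartAt ℂ p).map_target hz)) (mdifferentiableAt_chart_symm hz)
  have h2 : (fun u => chartAt ℂ p ((chartAt ℂ p).symm u)) =ᶠ[𝓝 z] id := by
    filter_upwards [(chartAt ℂ p).open_target.mem_nhds hz] with u hu using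
      (chartAt ℂ p).right_inv hu
  rw [h0, mul_zero, h2.deriv_eq, deriv_id] at h1
  exact zero_ne_one h1

end Velocity

namespace FSpectralCurve.SqrtCoordinates

variable {X : Type*} [TopologicalSpace X] [ChartedSpace ℂ X]
  {S : FSpectralCurve X} (c : S.SqrtCoordinates)

/-- The parametrisation `γ_α` read in the preferred chart at `α`. -/
noncomputable def rho (α : S.ram) (s : ℂ) : ℂ := chartAt ℂ (α : X) (c.γ α s)

theorem rho_zero (α : S.ram) : c.rho α 0 = chartAt ℂ (α : X) α := by rw [rho, c.γ_zero]

theorem tendsto_γ (α : S.ram) : Tendsto (c.γ α) (𝓝 0) (𝓝 (α : X)) := by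
  have h := ((c.γ_holomorphic α).self_of_nhds).continuousAt.tendsto
  rwa [c.γ_zero] at h

theorem eventually_mem_source (α : S.ram) :
    ∀ᶠ s in 𝓝 (0 : ℂ), c.γ α s ∈ (chartAt ℂ (α : X)).source :=
  (c.tendsto_γ α).eventually
    ((chartAt ℂ (α : X)).open_source.mem_nhds (mem_chart_source ℂ (α : X)))

theorem eventually_symm_rho (α : S.ram) :
    ∀ᶠ s in 𝓝 (0 : ℂ), (chartAt ℂ (α : X)).symm (c.rho α s) = c.γ α s := by
  filter_upwards [c.eventually_mem_source α] with s hs using (chartAt ℂ (α : X)).left_inv hs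

/-- The other ramification points form a finite, hence closed, set not containing `α`, and `x` takes
a value different from `x α` at `γ_α(s)` for `s ≠ 0`. Identities between germs therefore need
checking only off the ramification points. -/
theorem eventually_not_mem_ram [T2Space X] (α : S.ram) :
    ∀ᶠ s in 𝓝[≠] (0 : ℂ), c.γ α s ∉ S.ram := by
  classical
  have h1 : ∀ᶠ s in 𝓝 (0 : ℂ), c.γ α s ∉ S.ram.erase α := by
    refine (c.tendsto_γ α).eventually (p := fun p => p ∉ S.ram.erase (α : X)) ?_
    exact (S.ram.erase α).finite_toSet.isClosed.isOpen_compl.mem_nhds (by simp)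
  filter_upwards [h1.filter_mono nhdsWithin_le_nhds, (c.x_γ α).filter_mono nhdsWithin_le_nhds,
    self_mem_nhdsWithin] with s h1 h2 h3 h4
  refine h1 (Finset.mem_erase.2 ⟨fun h5 => ?_, h4⟩)
  rw [h5] at h2
  have : s ^ 2 / 2 = 0 := by linear_combination -h2
  simp at this
  exact h3 this

theorem theta_neg (α : S.ram) (s : ℂ) : c.theta α (-s) = c.theta α s := by
  simp only [theta, deltaOmega01, sigmaPull, neg_neg]
  congr 1
  ring

variable [IsManifold 𝓘(ℂ, ℂ) ω X]

theorem rho_analytic (α : S.ram) : AnalyticAt ℂ (c.rho α) 0 := by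
  rw [Complex.analyticAt_iff_eventually_differentiableAt]
  filter_upwards [c.γ_holomorphic α, c.eventually_mem_source α] with s h1 h2
  exact mdifferentiableAt_iff_differentiableAt.1 ((mdifferentiableAt_chart h2).comp s h1)

theorem tendsto_rho (α : S.ram) : Tendsto (c.rho α) (𝓝 0) (𝓝 (chartAt ℂ (α : X) α)) := by
  have := (c.rho_analytic α).continuousAt.tendsto
  rwa [c.rho_zero] at this

/-- Differentiate `x (γ s) = x α + s ^ 2 / 2` twice at `0`: with `dx = 0` at `α`, a vanishing `ρ'`
would give `0 = 1`. So `γ` is a genuine local coordinate. -/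
theorem deriv_rho_ne_zero (α : S.ram) : deriv (c.rho α) 0 ≠ 0 := by
  intro h0
  obtain ⟨hx, hx0⟩ := (S.mem_ram α).1 α.2
  set f := inChart (α : X) S.x with hf
  rw [← c.rho_zero] at hx hx0
  have hρ := c.rho_analytic α
  have e : (fun s => f (c.rho α s)) =ᶠ[𝓝 0] fun s => S.x α + s ^ 2 / 2 := by
    filter_upwards [c.eventually_symm_rho α, c.x_γ α] with s h1 h2
    rw [← h2, hf, inChart, h1]
  have hd : ∀ᶠ s in 𝓝 0, deriv f (c.rho α s) * deriv (c.rho α) s = s := by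
    filter_upwards [e.eventually_nhds, hρ.eventually_analyticAt,
      hρ.continuousAt.eventually hx.eventually_analyticAt] with s h1 h2 h3
    have h4 := h3.differentiableAt.hasDerivAt.comp s h2.differentiableAt.hasDerivAt
    have h5 : HasDerivAt (fun s : ℂ => S.x α + s ^ 2 / 2) s s := by
      have := (((hasDerivAt_id s).pow 2).div_const 2).const_add (S.x α)
      simpa using this
    exact h4.unique (h5.congr_of_eventuallyEq h1)
  have h6 := (hx.deriv.differentiableAt.hasDerivAt.comp (0 : ℂ) hρ.differentiableAt.hasDerivAt).fun_mul
    hρ.deriv.differentiableAt.hasDerivAt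
  have h7 := h6.unique ((hasDerivAt_id (0 : ℂ)).congr_of_eventuallyEq hd)
  simp [h0, hx0] at h7

theorem eventually_velocity (α : S.ram) : ∀ᶠ s in 𝓝 (0 : ℂ), velocity (c.γ α) s =
    velocity (chartAt ℂ (α : X)).symm (c.rho α s) * deriv (c.rho α) s := by
  have ht : ∀ᶠ s in 𝓝 (0 : ℂ), c.rho α s ∈ (chartAt ℂ (α : X)).target :=
    (c.tendsto_rho α).eventually
      ((chartAt ℂ (α : X)).open_target.mem_nhds (mem_chart_target ℂ (α : X)))
  filter_upwards [(c.eventually_symm_rho α).eventually_nhds, (c.rho_analytic α).eventually_analyticAt,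
    ht] with s h1 h2 h3
  rw [← velocity_comp (mdifferentiableAt_chart_symm h3) h2.differentiableAt]
  exact velocity_congr (by filter_upwards [h1] with u hu using hu.symm)

theorem pullBidiff_γ (b : X → X → ℂ) (α β : S.ram) : ∀ᶠ z : ℂ × ℂ in 𝓝 (0, 0),
    pullBidiff (c.γ α) (c.γ β) b z =
      pullBidiff (chartAt ℂ (α : X)).symm (chartAt ℂ (β : X)).symm b (c.rho α z.1, c.rho β z.2) *
        deriv (c.rho α) z.1 * deriv (c.rho β) z.2 := by
  have tfst : Tendsto (fun z : ℂ × ℂ => z.1) (𝓝 (0, 0)) (𝓝 0) := continuous_fst.tendsto (0, 0)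
  have tsnd : Tendsto (fun z : ℂ × ℂ => z.2) (𝓝 (0, 0)) (𝓝 0) := continuous_snd.tendsto (0, 0)
  filter_upwards [tfst.eventually (c.eventually_symm_rho α), tsnd.eventually (c.eventually_symm_rho β),
    tfst.eventually (c.eventually_velocity α), tsnd.eventually (c.eventually_velocity β)]
    with z h1 h2 h3 h4
  simp only [pullBidiff]
  rw [h1, h2, h3, h4]
  ring

/-- At equal indices `exists_double_pole` carries the polar term from the chart to the coordinate
`s`; at different indices the two points are distinct and the bidifferential is holomorphic there.
-/
theorem pullBidiff_polar [DecidableEq S.ram] {b : X → X → ℂ} (hb : IsFundamentalBidiff b)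
    (α β : S.ram) : ∃ h : ℂ × ℂ → ℂ, AnalyticAt ℂ h (0, 0) ∧ ∀ᶠ z : ℂ × ℂ in 𝓝 (0, 0),
      z.1 ≠ z.2 → pullBidiff (c.γ α) (c.γ β) b z =
        (if α = β then 1 else 0) * (1 / (z.1 - z.2) ^ 2) + h z := by
  have tfst : Tendsto (fun z : ℂ × ℂ => z.1) (𝓝 (0, 0)) (𝓝 0) := continuous_fst.tendsto (0, 0)
  have tsnd : Tendsto (fun z : ℂ × ℂ => z.2) (𝓝 (0, 0)) (𝓝 0) := continuous_snd.tendsto (0, 0)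
  have afst : AnalyticAt ℂ (fun z : ℂ × ℂ => c.rho α z.1) (0, 0) :=
    (c.rho_analytic α).fun_comp (f := fun z : ℂ × ℂ => z.1) (x := (0, 0)) analyticAt_fst
  have asnd : AnalyticAt ℂ (fun z : ℂ × ℂ => c.rho β z.2) (0, 0) :=
    (c.rho_analytic β).fun_comp (f := fun z : ℂ × ℂ => z.2) (x := (0, 0)) analyticAt_snd
  have adfst : AnalyticAt ℂ (fun z : ℂ × ℂ => deriv (c.rho α) z.1) (0, 0) :=
    (c.rho_analytic α).deriv.fun_comp (f := fun z : ℂ × ℂ => z.1) (x := (0, 0)) analyticAt_fst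
  have adsnd : AnalyticAt ℂ (fun z : ℂ × ℂ => deriv (c.rho β) z.2) (0, 0) :=
    (c.rho_analytic β).deriv.fun_comp (f := fun z : ℂ × ℂ => z.2) (x := (0, 0)) analyticAt_snd
  have apair : AnalyticAt ℂ (fun z : ℂ × ℂ => (c.rho α z.1, c.rho β z.2)) (0, 0) :=
    afst.prod asnd
  by_cases hαβ : α = β
  · subst hαβ
    obtain ⟨h, hh, he⟩ := hb.2 α
    obtain ⟨hinj, k, hk, hke⟩ := exists_double_pole (c.rho_analytic α) (c.deriv_rho_ne_zero α)
    have hcomp : AnalyticAt ℂ (fun z : ℂ × ℂ => h (c.rho α z.1, c.rho α z.2)) (0, 0) :=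
      hh.comp_of_eq apair (by simp only [c.rho_zero])
    have tpair : Tendsto (fun z : ℂ × ℂ => (c.rho α z.1, c.rho α z.2)) (𝓝 (0, 0))
        (𝓝 (chartAt ℂ (α : X) α, chartAt ℂ (α : X) α)) := by
      have := apair.continuousAt.tendsto
      simpa only [c.rho_zero] using this
    refine ⟨fun z => k z + h (c.rho α z.1, c.rho α z.2) * deriv (c.rho α) z.1 * deriv (c.rho α) z.2,
      hk.fun_add ((hcomp.fun_mul adfst).fun_mul adsnd), ?_⟩
    -- The expansion in the chart requires distinct arguments there, which is the local injectivity
    -- `h3`.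
    filter_upwards [c.pullBidiff_γ b α α, tpair.eventually he, hinj, hke] with z h1 h2 h3 h4 h5
    rw [h1, h2 (h3 h5), if_pos rfl, one_mul, ← add_assoc, ← h4 h5]
    ring
  · have hne : (α : X) ≠ β := fun h => hαβ (Subtype.ext h)
    have h1 := hb.1 α β hne
    have h1' := h1.comp_of_eq apair (by simp only [c.rho_zero])
    refine ⟨_, (h1'.fun_mul adfst).fun_mul adsnd, ?_⟩
    filter_upwards [c.pullBidiff_γ b α β] with z h2 _
    rw [if_neg hαβ, zero_mul, zero_add, h2]
    rfl

theorem pullForm_snd_analytic {b : X → X → ℂ} (hb : IsFundamentalBidiff b) (α : S.ram) {z₀ : X}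
    (hz : z₀ ≠ α) : AnalyticAt ℂ (pullForm (c.γ α) (b z₀)) 0 := by
  have h1 := hb.1 z₀ α hz
  -- The holomorphy hypothesis pulls back both variables, the goal only the second; the constant
  -- velocity at `z₀` is non-zero and is divided out.
  set v := velocity (chartAt ℂ z₀).symm (chartAt ℂ z₀ z₀) with hv
  have hv0 : v ≠ 0 := velocity_chart_symm_ne_zero (mem_chart_target ℂ z₀)
  have h2 : AnalyticAt ℂ (fun t => (chartAt ℂ z₀ z₀, c.rho α t)) 0 :=
    analyticAt_const.prod (c.rho_analytic α)
  refine (((h1.comp_of_eq h2 (by simp only [c.rho_zero])).fun_mul (c.rho_analytic α).deriv).fun_mul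
    (analyticAt_const (v := v⁻¹))).congr ?_
  filter_upwards [c.eventually_symm_rho α, c.eventually_velocity α] with t h3 h4
  simp only [Function.comp_apply, pullBidiff, pullForm]
  rw [h3, h4, ← hv, (chartAt ℂ z₀).left_inv (mem_chart_source ℂ z₀)]
  field_simp

theorem pullForm_fst_analytic {b : X → X → ℂ} (hb : IsFundamentalBidiff b) (α : S.ram) {z₀ : X}
    (hz : z₀ ≠ α) : AnalyticAt ℂ (pullForm (c.γ α) (fun p => b p z₀)) 0 := by
  have h1 := hb.1 α z₀ hz.symm
  set v := velocity (chartAt ℂ z₀).symm (chartAt ℂ z₀ z₀) with hv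
  have hv0 : v ≠ 0 := velocity_chart_symm_ne_zero (mem_chart_target ℂ z₀)
  have h2 : AnalyticAt ℂ (fun t => (c.rho α t, chartAt ℂ z₀ z₀)) 0 :=
    (c.rho_analytic α).prod analyticAt_const
  refine (((h1.comp_of_eq h2 (by simp only [c.rho_zero])).fun_mul (c.rho_analytic α).deriv).fun_mul
    (analyticAt_const (v := v⁻¹))).congr ?_
  filter_upwards [c.eventually_symm_rho α, c.eventually_velocity α] with t h3 h4
  simp only [Function.comp_apply, pullBidiff, pullForm]
  rw [h3, h4, ← hv, (chartAt ℂ z₀).left_inv (mem_chart_source ℂ z₀)]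
  field_simp

/-! ### The kernel -/

/-- Since `x ∘ γ` is `s ^ 2 / 2` up to a constant, `dx` pulls back to `s ds`. -/
theorem pullForm_omega01 (α : S.ram) : ∀ᶠ s in 𝓝 (0 : ℂ),
    pullForm (c.γ α) S.omega01 s = inChart (α : X) S.y (c.rho α s) * s := by
  obtain ⟨hx, -⟩ := (S.mem_ram α).1 α.2
  have hρ := c.tendsto_rho α
  filter_upwards [(c.x_γ α).eventually_nhds, c.eventually_symm_rho α, c.γ_holomorphic α,
    c.eventually_mem_source α, hρ.eventually hx.eventually_analyticAt] with s h1 h2 h3 h4 h5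
  have hxs : MDifferentiableAt 𝓘(ℂ, ℂ) 𝓘(ℂ, ℂ) S.x (c.γ α s) := by
    have h6 : MDifferentiableAt 𝓘(ℂ, ℂ) 𝓘(ℂ, ℂ)
        (inChart (α : X) S.x ∘ chartAt ℂ (α : X)) (c.γ α s) :=
      MDifferentiableAt.comp (c.γ α s) (I' := 𝓘(ℂ, ℂ))
        (h5.differentiableAt.mdifferentiableAt) (mdifferentiableAt_chart h4)
    refine h6.congr_of_eventuallyEq ?_
    filter_upwards [(chartAt ℂ (α : X)).open_source.mem_nhds h4] with p hp
    rw [Function.comp_apply, inChart, (chartAt ℂ (α : X)).left_inv hp]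
  have h7 := deriv_comp_velocity hxs h3
  have h8 : HasDerivAt (fun s : ℂ => S.x α + s ^ 2 / 2) s s := by
    have := (((hasDerivAt_id s).pow 2).div_const 2).const_add (S.x α)
    simpa using this
  have e : (fun u => S.x (c.γ α u)) =ᶠ[𝓝 s] fun s : ℂ => S.x α + s ^ 2 / 2 := h1
  rw [e.deriv_eq, h8.deriv] at h7
  rw [pullForm, omega01, inChart, h2, mul_assoc]
  exact congrArg _ h7

/-- With `Y` the pullback of `y`, the denominator is `s (Y s - Y (-s)) = s ^ 2 Z s`, where `Z 0 = 2
Y' 0` is non-zero because `dy` does not vanish at `α` and `s` is a coordinate. -/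
theorem theta_mem (α : S.ram) : pgerm (c.theta α) ∈ ordGe (-2) := by
  obtain ⟨hy, hy0⟩ := S.dy_ne_zero α α.2
  rw [← c.rho_zero] at hy hy0
  have hρ := c.rho_analytic α
  set Y : ℂ → ℂ := fun s => inChart (α : X) S.y (c.rho α s) with hY
  have hYa : AnalyticAt ℂ Y 0 := hy.fun_comp hρ
  have hYd : deriv Y 0 ≠ 0 := by
    have := hy.differentiableAt.hasDerivAt.comp (0 : ℂ) hρ.differentiableAt.hasDerivAt
    have e : deriv Y 0 = _ := this.deriv
    rw [e]
    exact mul_ne_zero hy0 (c.deriv_rho_ne_zero α)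
  have hZ : AnalyticAt ℂ (fun s => Y s - Y (-s)) 0 := hYa.fun_sub hYa.comp_neg_zero
  obtain ⟨Z, hZa, hZe⟩ := hZ.exists_eq_sum_add_pow_mul (n := 1)
  simp only [Finset.sum_range_one, iteratedDeriv_zero, neg_zero, sub_self, smul_eq_mul] at hZe
  have hZ0 : Z 0 ≠ 0 := by
    have h1 : HasDerivAt (fun s => Y s - Y (-s)) (deriv Y 0 + deriv Y 0) 0 := by
      have h2 : HasDerivAt Y (deriv Y 0) (-0) := by
        rw [neg_zero]
        exact hYa.differentiableAt.hasDerivAt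
      have h3 := h2.comp (0 : ℂ) (hasDerivAt_neg (0 : ℂ))
      simpa [Function.comp_def] using hYa.differentiableAt.hasDerivAt.fun_sub h3
    have h4 : HasDerivAt (fun s => Y s - Y (-s)) (Z 0) 0 := by
      have h5 := (hasDerivAt_id (0 : ℂ)).fun_mul hZa.differentiableAt.hasDerivAt
      simp only [id, one_mul, zero_mul, add_zero] at h5
      refine h5.congr_of_eventuallyEq (.of_forall fun s => ?_)
      change Y s - Y (-s) = s * Z s
      rw [hZe]
      simp
    rw [h4.unique h1]
    intro h0
    exact hYd (add_self_eq_zero.1 h0)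
  refine ⟨fun s => -2 / Z s, analyticAt_const.fun_div hZa hZ0, Germ.coe_eq.2 ?_⟩
  have h1 := c.pullForm_omega01 α
  filter_upwards [h1.filter_mono nhdsWithin_le_nhds,
    (tendsto_neg_zero.eventually h1).filter_mono nhdsWithin_le_nhds, self_mem_nhdsWithin,
    (hZa.continuousAt.eventually_ne hZ0).filter_mono nhdsWithin_le_nhds] with s h2 h3 h4 h5
  have h4' : s ≠ 0 := by simpa using h4
  have h6 : c.deltaOmega01 α s = s ^ 2 * Z s := by
    rw [deltaOmega01, sigmaPull, h2, h3]
    have := hZe s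
    simp only [hY] at this
    simp at this
    linear_combination s * this
  rw [theta, h6]
  have h7 : s ^ (-2 : ℤ) = (s ^ 2)⁻¹ := by
    rw [zpow_neg]
    rfl
  rw [h7]
  field_simp

/-- Along `(s, -s)` the diagonal is met only at `s = 0`, so the double pole restricts to a pole
there. This covers the base term `D`, where no projector is applied first. -/
theorem diagPull_meromorphic {b : X → X → ℂ} (hb : IsFundamentalBidiff b) (α : S.ram) :
    MeromorphicAt (c.diagPull α b) 0 := by
  classical
  obtain ⟨h, hh, he⟩ := c.pullBidiff_polar hb α α
  have h1 : AnalyticAt ℂ (fun s : ℂ => (s, -s)) 0 := by fun_prop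
  have h2 : AnalyticAt ℂ (fun s => h (s, -s)) 0 := hh.comp_of_eq h1 (by simp)
  have t : Tendsto (fun s : ℂ => (s, -s)) (𝓝[≠] 0) (𝓝 (0, 0)) := by
    have := h1.continuousAt.tendsto.mono_left (nhdsWithin_le_nhds (s := {0}ᶜ))
    simpa using this
  have hm : MeromorphicAt (fun s => -(1 / (s - -s) ^ 2 + h (s, -s))) 0 :=
    (MeromorphicAt.fun_add (by fun_prop) h2.meromorphicAt).fun_neg
  refine hm.congr ?_
  filter_upwards [t.eventually he, self_mem_nhdsWithin] with s h3 h4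
  have h5 : s ≠ -s := fun h => h4 (self_eq_neg.1 h)
  have h6 := h3 h5
  rw [if_pos rfl, one_mul] at h6
  rw [← h6]
  simp only [pullBidiff, diagPull, pullForm, sigmaPull]
  ring

end FSpectralCurve.SqrtCoordinates

/-! ### Odd primitives -/

/-- The odd part of the primitive. -/
noncomputable def oddPrim (g : ℂ → ℂ) (s : ℂ) : ℂ := (1 / 2 : ℂ) * (primZero g s - primZero g (-s))

theorem oddPrim_neg (g : ℂ → ℂ) (s : ℂ) : oddPrim g (-s) = -oddPrim g s := by
  rw [oddPrim, oddPrim, neg_neg]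
  ring

theorem oddPrim_analytic {g : ℂ → ℂ} (hg : AnalyticAt ℂ g 0) : AnalyticAt ℂ (oddPrim g) 0 :=
  analyticAt_const.fun_mul
    ((primZero_analytic hg).1.fun_sub (primZero_analytic hg).1.comp_neg_zero)

theorem deriv_oddPrim {g : ℂ → ℂ} (hg : AnalyticAt ℂ g 0) :
    deriv (oddPrim g) =ᶠ[𝓝 0] fun s => (1 / 2 : ℂ) * (g s + g (-s)) := by
  obtain ⟨h1, h2⟩ := primZero_analytic hg
  have h3 := h1.eventually_analyticAt
  filter_upwards [h2, tendsto_neg_zero.eventually h2, h3, tendsto_neg_zero.eventually h3]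
    with s e1 e2 d1 d2
  have d2' : HasDerivAt (fun u => primZero g (-u)) (-deriv (primZero g) (-s)) s := by
    have := d2.differentiableAt.hasDerivAt.comp s (hasDerivAt_neg s)
    rwa [mul_neg_one] at this
  have := ((d1.differentiableAt.hasDerivAt.fun_sub d2').const_mul (1 / 2 : ℂ)).deriv
  rw [e1, e2, sub_neg_eq_add] at this
  exact this

/-- Passing to the odd part does not affect derivatives of odd order at `0`, and one derivative
undoes the primitive. -/
theorem iteratedDeriv_oddPrim {g : ℂ → ℂ} (hg : AnalyticAt ℂ g 0) (j : ℕ) :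
    iteratedDeriv (2 * j + 1) (oddPrim g) 0 = iteratedDeriv (2 * j) g 0 := by
  obtain ⟨h1, h2⟩ := primZero_analytic hg
  have e1 : iteratedDeriv (2 * j + 1) (primZero g) 0 = iteratedDeriv (2 * j) g 0 := by
    have h3 : deriv (primZero g) =ᶠ[𝓝 0] g := h2
    rw [iteratedDeriv_succ', h3.iteratedDeriv_eq]
  have e2 : oddPrim g = fun s => (1 / 2 : ℂ) * (primZero g s - primZero g (-s)) := rfl
  rw [e2, iteratedDeriv_const_mul_field,
    iteratedDeriv_fun_sub h1.contDiffAt h1.comp_neg_zero.contDiffAt, iteratedDeriv_comp_neg, neg_zero,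
    e1, Odd.neg_one_pow ⟨j, rfl⟩]
  simp
  ring

theorem res_mul_inv_pow {ph : ℂ → ℂ} (hph : AnalyticAt ℂ ph 0) (n : ℕ) :
    res (pgerm fun s => ph s * (s ^ (n + 1))⁻¹) = iteratedDeriv n ph 0 / (n ! : ℂ) := by
  obtain ⟨R, hR, e⟩ := hph.exists_eq_sum_add_pow_mul (n := n + 1)
  have e1 : pgerm (fun s => ph s * (s ^ (n + 1))⁻¹) =
      (∑ i ∈ Finset.range (n + 1), (iteratedDeriv i ph 0 / (i ! : ℂ)) •
        pgerm fun s => (s ^ (n - i + 1))⁻¹) + pgerm R := by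
    simp only [← pgerm_const_mul, ← pgerm_sum]
    rw [← pgerm_add]
    refine pgerm_eq fun s hs => ?_
    rw [e s, add_mul, Finset.sum_mul]
    congr 1
    · refine Finset.sum_congr rfl fun i hi => ?_
      have hi' : i ≤ n := Nat.lt_succ_iff.1 (Finset.mem_range.1 hi)
      have : s ^ (n + 1) = s ^ i * s ^ (n - i + 1) := by
        rw [← pow_add]
        congr 1
        omega
      simp only [smul_eq_mul]
      rw [this]
      field_simp
    · simp only [smul_eq_mul]
      field_simp
  rw [e1, map_add, res_analytic hR, map_sum, add_zero]
  simp only [map_smul, res_inv_pow]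
  rw [Finset.sum_eq_single n]
  · simp
  · intro i hi hin
    have hi' : i ≤ n := Nat.lt_succ_iff.1 (Finset.mem_range.1 hi)
    rw [if_neg (by omega), smul_zero]
  · intro h
    exact absurd (Finset.mem_range.2 (Nat.lt_succ_self n)) h

/-- Only odd Taylor coefficients of `ph` occur, so only the odd principal part of `χ` is paired with
them; the remainder `s ^ (2 * M) R` cancels the whole pole. -/
theorem res_odd_mul {ph : ℂ → ℂ} (hph : AnalyticAt ℂ ph 0) (hodd : ∀ s, ph (-s) = -ph s)
    {χ : Germ (𝓝[≠] (0 : ℂ)) ℂ} {M : ℕ} (hχ : χ ∈ ordGe (-(2 * M : ℕ))) :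
    res (pgerm ph * χ) = ∑ j ∈ Finset.range M,
      (iteratedDeriv (2 * j + 1) ph 0 / ((2 * j + 1)! : ℂ)) * oddCoeff j χ := by
  -- A one-point index set turns the Taylor expansion for families into one for a single function.
  obtain ⟨c, R, hR, e⟩ := Vplus_exists_taylor
    (ofOdd (fun _ : Unit => ph) (fun _ => hph) fun _ => .of_forall hodd) () M
  have e' : ph =ᶠ[𝓝 0] fun s => (∑ j ∈ Finset.range M, c j * s ^ (2 * j + 1)) + s ^ (2 * M) * R s :=
    (germRep_ofOdd _ _ ()).symm.trans e
  have hc : ∀ j < M, iteratedDeriv (2 * j + 1) ph 0 / ((2 * j + 1)! : ℂ) = c j := by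
    intro j hj
    rw [← res_mul_inv_pow hph, ← res_taylor_mul hj c hR]
    congr 1
    refine pgerm_congr ?_
    filter_upwards [e'] with s hs
    rw [hs]
  have e1 : pgerm ph * χ = (∑ j ∈ Finset.range M, c j • (pgerm (fun s => s ^ (2 * j + 1)) * χ)) +
      pgerm (fun s => s ^ (2 * M)) * χ * pgerm R := by
    have : pgerm ph = (∑ j ∈ Finset.range M, c j • pgerm fun s => s ^ (2 * j + 1)) +
        pgerm (fun s => s ^ (2 * M)) * pgerm R := by
      rw [pgerm_congr e']
      simp only [← pgerm_const_mul, ← pgerm_sum]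
      rfl
    rw [this, add_mul, Finset.sum_mul]
    congr 1
    · refine Finset.sum_congr rfl fun j _ => ?_
      rw [mul_comm, germ_mul_smul, mul_comm]
    · ring
  have e2 : res (pgerm (fun s => s ^ (2 * M)) * χ * pgerm R) = 0 := by
    refine res_of_mem_ordGe_zero (ordGe_anti ?_ (mem_ordGe_mul (mem_ordGe_mul (pow_mem_ordGe _) hχ)
      (analytic_mem_ordGe hR)))
    simp
  rw [e1, map_add, e2, map_sum, add_zero]
  refine Finset.sum_congr rfl fun j hj => ?_
  rw [hc j (Finset.mem_range.1 hj), map_smul, smul_eq_mul]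
  rfl

/-- `ph χ` minus its reflection is holomorphic by `exists_odd_part`, while the reflection has the
opposite residue; so twice the residue is zero. -/
theorem res_even_mul {ph χ : ℂ → ℂ} (hph : AnalyticAt ℂ ph 0) (heven : ∀ s, ph (-s) = ph s)
    (hχ : HasOddPolarPart χ) : res (pgerm fun s => ph s * χ s) = 0 := by
  obtain ⟨h, hh, e⟩ := hχ.exists_odd_part
  have hm : MeromorphicAt χ 0 := hχ.1
  have h1 : res (pgerm fun s => ph (-s) * χ (-s)) = -res (pgerm fun s => ph s * χ s) :=
    res_comp_neg (f := fun s => ph s * χ s) (hph.meromorphicAt.fun_mul hm)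
  have h2 : res (pgerm (fun s => ph s * χ s) - pgerm fun s => ph (-s) * χ (-s)) = 0 := by
    have e1 : pgerm (fun s => ph s * χ s) - pgerm (fun s => ph (-s) * χ (-s)) =
        pgerm fun s => ph s * (s * h s) := by
      refine Germ.coe_eq.2 ?_
      filter_upwards [e] with s hs
      rw [← hs]
      rw [heven s]
      ring
    rw [e1]
    exact res_analytic (hph.fun_mul (analyticAt_id.fun_mul hh))
  rw [map_sub, h1, sub_neg_eq_add, add_self_eq_zero] at h2
  exact h2

namespace FSpectralCurve.SqrtCoordinates

variable {X : Type*} [TopologicalSpace X] [ChartedSpace ℂ X]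
  {S : FSpectralCurve X} (c : S.SqrtCoordinates)

/-! ### The basic forms -/

/-- The form `ξ_b` with polar part `s ^ (-2 k - 2) ds` at `β`, for `b = (β, k)`: the Taylor
coefficient of the integrated bidifferential at `β`. -/
noncomputable def xi (k : Kind) (b : S.ram × ℕ) (z₀ : X) : ℂ :=
  iteratedDeriv (2 * b.2 + 1) (c.halfInt k b.1 z₀) 0 / ((2 * b.2 + 1)! : ℂ)

theorem halfInt_eq (k : Kind) (α : S.ram) (z₀ : X) :
    c.halfInt k α z₀ = oddPrim (pullForm (c.γ α) (S.bidiff k z₀)) := rfl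

/-- The linear combination of the forms `ξ_b` with given principal part, at `z₀`. -/
noncomputable def Xi (k : Kind) (z₀ : X) : PrincipalPart S.ram →ₗ[ℂ] ℂ :=
  Finsupp.linearCombination ℂ fun b => c.xi k b z₀

/-- The germs of the linear combinations of the forms `ξ_b`. -/
noncomputable abbrev Lam (k : Kind) : PrincipalPart S.ram →ₗ[ℂ] LocForm S.ram :=
  liftPP fun b => c.toLoc (c.xi k b)

theorem toLoc_add (f g : X → ℂ) : c.toLoc (fun z => f z + g z) = c.toLoc f + c.toLoc g := by
  funext α
  refine pgerm_eq fun s _ => ?_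
  simp only [restr, pullForm]
  ring

theorem toLoc_const_mul (a : ℂ) (f : X → ℂ) : c.toLoc (fun z => a * f z) = a • c.toLoc f := by
  funext α
  refine pgerm_eq fun s _ => ?_
  simp only [restr, pullForm]
  exact mul_assoc _ _ _

theorem toLoc_sum {ι : Type*} (t : Finset ι) (f : ι → X → ℂ) :
    c.toLoc (fun z => ∑ i ∈ t, f i z) = ∑ i ∈ t, c.toLoc (f i) := by
  classical
  induction t using Finset.induction_on with
  | empty =>
    funext α
    refine pgerm_eq fun s _ => ?_
    simp [restr, pullForm]
  | insert i t hi ih =>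
    simp only [Finset.sum_insert hi]
    rw [toLoc_add, ih]

theorem toLoc_Xi (k : Kind) (v : PrincipalPart S.ram) :
    c.toLoc (fun z => c.Xi k z v) = c.Lam k v := by
  simp only [Xi, Lam, liftPP, Finsupp.linearCombination_apply, Finsupp.sum, smul_eq_mul]
  rw [toLoc_sum]
  simp only [toLoc_const_mul]

theorem toLoc_congr [T2Space X] {f g : X → ℂ} (h : ∀ z ∉ S.ram, f z = g z) :
    c.toLoc f = c.toLoc g := by
  funext α
  refine Germ.coe_eq.2 ?_
  filter_upwards [c.eventually_not_mem_ram α] with s hs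
  simp only [restr, pullForm, h _ hs]

/-- The derivative of order `2 k` of `1 / (s - t) ^ 2` at `t = 0` is `(2 k + 1)!` times `s ^ (-2 k -
2)`, and the factorial cancels. Stated for an abstract `g` so as to apply with the bidifferential's
variables in either order. -/
theorem sub_sing_mem [T2Space X] [DecidableEq S.ram] {f : X → ℂ} {b : S.ram × ℕ} {g : X → ℂ → ℂ}
    (hf : ∀ z ∉ S.ram, f z = iteratedDeriv (2 * b.2) (g z) 0 / ((2 * b.2 + 1)! : ℂ))
    (hg : ∀ α, ∃ h : ℂ × ℂ → ℂ, AnalyticAt ℂ h (0, 0) ∧ ∀ᶠ z : ℂ × ℂ in 𝓝 (0, 0),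
      z.1 ≠ z.2 → g (c.γ α z.1) z.2 * velocity (c.γ α) z.1 =
        (if α = b.1 then 1 else 0) * (1 / (z.1 - z.2) ^ 2) + h z) :
    c.toLoc f - sing b ∈ ordLoc S.ram 0 := by
  refine mem_ordLoc.2 fun α => ?_
  obtain ⟨h, hh, he⟩ := hg α
  obtain ⟨R, hR, e⟩ := exists_iteratedDeriv_double_pole
    (f := fun s t => velocity (c.γ α) s * g (c.γ α s) t) hh
    (he.mono fun z h1 h2 => by rw [mul_comm, h1 h2]) (2 * b.2)
  refine mem_ordGe_zero.2 ⟨fun s => R s * (((2 * b.2 + 1)! : ℂ))⁻¹, hR.fun_mul analyticAt_const, ?_⟩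
  have hfac : ((2 * b.2 + 1)! : ℂ) ≠ 0 := Nat.cast_ne_zero.2 (Nat.factorial_ne_zero _)
  have e1 : c.toLoc f α = pgerm fun s => (if α = b.1 then 1 else 0) * (s ^ (2 * b.2 + 2))⁻¹ +
      R s * (((2 * b.2 + 1)! : ℂ))⁻¹ := by
    refine Germ.coe_eq.2 ?_
    filter_upwards [e, c.eventually_not_mem_ram α] with s h1 h2
    rw [iteratedDeriv_const_mul_field] at h1
    simp only [restr, pullForm]
    rw [hf _ h2, div_mul_eq_mul_div, mul_comm, h1]
    field_simp
  rw [Pi.sub_apply, e1, sub_eq_iff_eq_add, pgerm_add, add_comm, add_right_inj]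
  by_cases hα : α = b.1
  · subst hα
    simp [sing]
  · rw [sing, Pi.single_eq_of_ne hα]
    simp [hα]
    rfl

variable [IsManifold 𝓘(ℂ, ℂ) ω X]

theorem bidiff_snd_analytic (k : Kind) (α : S.ram) {z₀ : X} (hz : z₀ ∉ S.ram) :
    AnalyticAt ℂ (pullForm (c.γ α) (S.bidiff k z₀)) 0 :=
  c.pullForm_snd_analytic (S.bidiff_fundamental k) α fun h => hz (h ▸ α.2)

theorem bidiff_fst_analytic (k : Kind) (α : S.ram) {z : X} (hz : z ∉ S.ram) :
    AnalyticAt ℂ (pullForm (c.γ α) fun p => S.bidiff k p z) 0 :=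
  c.pullForm_fst_analytic (S.bidiff_fundamental k) α fun h => hz (h ▸ α.2)

theorem xi_eq (k : Kind) (b : S.ram × ℕ) {z₀ : X} (hz : z₀ ∉ S.ram) : c.xi k b z₀ =
    iteratedDeriv (2 * b.2) (pullForm (c.γ b.1) (S.bidiff k z₀)) 0 / ((2 * b.2 + 1)! : ℂ) := by
  rw [xi, halfInt_eq, iteratedDeriv_oddPrim (c.bidiff_snd_analytic k b.1 hz)]

/-- The input `z`: the odd part of the primitive of `ω_{0,2}^disc(· | z)`. -/
noncomputable def inp (z : X) : Vplus S.ram :=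
  open Classical in
  if h : z ∉ S.ram then
    ofOdd (fun α => oddPrim (pullForm (c.γ α) fun p => S.bidiff Kind.disc p z))
      (fun α => oddPrim_analytic (c.bidiff_fst_analytic Kind.disc α h))
      fun _ => .of_forall (oddPrim_neg _)
  else 0

theorem germRep_inp {z : X} (hz : z ∉ S.ram) (α : S.ram) : germRep ((c.inp z).1 α) =ᶠ[𝓝 0]
    oddPrim (pullForm (c.γ α) fun p => S.bidiff Kind.disc p z) := by
  rw [inp, dif_pos hz]
  exact germRep_ofOdd _ _ α

theorem plusCoeff_inp (b : S.ram × ℕ) {z : X} (hz : z ∉ S.ram) : plusCoeff b (c.inp z) =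
    iteratedDeriv (2 * b.2) (pullForm (c.γ b.1) fun p => S.bidiff Kind.disc p z) 0 /
      ((2 * b.2 + 1)! : ℂ) := by
  rw [← iteratedDeriv_oddPrim (c.bidiff_fst_analytic Kind.disc b.1 hz),
    ← res_mul_inv_pow (oddPrim_analytic (c.bidiff_fst_analytic Kind.disc b.1 hz))]
  refine congrArg res (pgerm_congr ?_)
  filter_upwards [c.germRep_inp hz b.1] with s hs
  rw [hs]

theorem toLoc_xi_sub_sing_mem [T2Space X] [DecidableEq S.ram] (k : Kind) (b : S.ram × ℕ) :
    c.toLoc (c.xi k b) - sing b ∈ ordLoc S.ram 0 := by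
  refine c.sub_sing_mem (fun z hz => c.xi_eq k b hz) fun α => ?_
  obtain ⟨h, hh, he⟩ := c.pullBidiff_polar (S.bidiff_fundamental k) α b.1
  refine ⟨h, hh, ?_⟩
  filter_upwards [he] with z h1 h2
  rw [← h1 h2, pullForm, pullBidiff]
  ring

/-- The double pole is unchanged when the variables are swapped. It follows that pairing this form
with an odd germ `f` returns the coefficient of `f` itself, which is what lets residues replace `inp
z` by `f`. -/
theorem toLoc_plusCoeff_inp_sub_sing_mem [T2Space X] [DecidableEq S.ram] (b : S.ram × ℕ) :
    c.toLoc (fun z => plusCoeff b (c.inp z)) - sing b ∈ ordLoc S.ram 0 := by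
  refine c.sub_sing_mem (fun z hz => c.plusCoeff_inp b hz) fun α => ?_
  obtain ⟨h, hh, he⟩ := c.pullBidiff_polar (S.bidiff_fundamental Kind.disc) b.1 α
  have hsw : AnalyticAt ℂ (fun z : ℂ × ℂ => (z.2, z.1)) (0, 0) := analyticAt_snd.prod analyticAt_fst
  refine ⟨fun z => h (z.2, z.1), hh.comp_of_eq hsw rfl, ?_⟩
  have t : Tendsto (fun z : ℂ × ℂ => (z.2, z.1)) (𝓝 (0, 0)) (𝓝 (0, 0)) := hsw.continuousAt.tendsto
  filter_upwards [t.eventually he] with z h1 h2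
  rw [if_congr eq_comm rfl rfl, ← sub_sq_comm, ← h1 h2.symm, pullForm, pullBidiff]

/-! ### Residue pairings -/

/-- The half integral is odd in `s`, so `res_odd_mul` applies at each ramification point; a bound
`n` on the pole orders is also a bound `2 n`, as needed there. -/
theorem sum_res_halfInt (k : Kind) {z₀ : X} (hz : z₀ ∉ S.ram) {χ : LocForm S.ram}
    (hχ : χ ∈ merLoc S.ram) :
    ∑ α : S.ram, res (pgerm (c.halfInt k α z₀) * χ α) = c.Xi k z₀ (pp χ) := by
  obtain ⟨n, hn⟩ := exists_mem_ordLoc hχ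
  have h1 : ∀ α : S.ram, res (pgerm (c.halfInt k α z₀) * χ α) =
      ∑ j ∈ Finset.range n, c.xi k (α, j) z₀ * pp χ (α, j) := by
    intro α
    rw [halfInt_eq, res_odd_mul (M := n) (oddPrim_analytic (c.bidiff_snd_analytic k α hz))
      (oddPrim_neg _) (ordGe_anti (by push_cast; omega) (mem_ordLoc.1 hn α))]
    refine Finset.sum_congr rfl fun j _ => ?_
    rw [pp_apply hχ, xi, halfInt_eq]
  simp only [h1]
  rw [← Finset.sum_product', Xi, Finsupp.linearCombination_apply, Finsupp.sum_of_support_subset (s :=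
    (Finset.univ : Finset S.ram) ×ˢ Finset.range n)]
  · refine Finset.sum_congr rfl fun b _ => ?_
    rw [smul_eq_mul, mul_comm]
  · intro b hb
    refine Finset.mem_product.2 ⟨Finset.mem_univ _, Finset.mem_range.2 ?_⟩
    by_contra h
    exact Finsupp.mem_support_iff.1 hb
      (mem_ppLt.1 (pp_mem_ppLt (N := n) hn (by omega)) b (not_lt.1 h))
  · simp

/-- The projector uses the full primitive from `α`. Its odd part is the half integral, and its even
part has no residue against a form with odd polar part by `res_even_mul`. -/
theorem projAux_eq (k : Kind) {χ : S.ram → ℂ → ℂ} (hχ : ∀ α, HasOddPolarPart (χ α)) {z₀ : X}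
    (hz : z₀ ∉ S.ram) : c.projAux k χ z₀ = c.Xi k z₀ (pp fun α => pgerm (χ α)) := by
  rw [← c.sum_res_halfInt k hz (oddLoc_le_merLoc (mem_oddLoc.2 fun α => mem_oddPolar.2 (hχ α)))]
  refine Finset.sum_congr rfl fun α _ => ?_
  have ha := c.bidiff_snd_analytic k α hz
  set g := pullForm (c.γ α) (S.bidiff k z₀)
  have h1 := (primZero_analytic ha).1
  have hm : MeromorphicAt (χ α) 0 := (hχ α).1
  rw [← res_coe (h1.meromorphicAt.fun_mul hm)]
  have h2 := res_even_mul (ph := fun s => (1 / 2 : ℂ) * (primZero g s + primZero g (-s)))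
    (analyticAt_const.fun_mul (h1.fun_add h1.comp_neg_zero))
    (fun s => by rw [neg_neg, add_comm]) (hχ α)
  refine Eq.trans ?_ (add_zero (res (pgerm (c.halfInt k α z₀) * pgerm (χ α))))
  refine Eq.trans ?_ (congrArg (res (pgerm (c.halfInt k α z₀) * pgerm (χ α)) + ·) h2)
  refine Eq.trans ?_ (map_add res _ _)
  refine congrArg res (pgerm_eq fun s _ => ?_)
  simp only [halfInt]
  change _ = (1 / 2 : ℂ) * (primZero g s - primZero g (-s)) * χ α s + _
  ring

end FSpectralCurve.SqrtCoordinates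

/-! ### Functions of finite multisets of odd germs -/

section Multilinear

variable {I : Type*}

/-- The bilinear map `(χ, χ') ↦` principal part of `χ χ' Θ`. -/
noncomputable def quad [Finite I] (Θ : LocForm I) : LocForm I →ₗ[ℂ] LocForm I →ₗ[ℂ] PrincipalPart I :=
  LinearMap.mk₂ ℂ (fun χ χ' => pp (χ * χ' * Θ))
    (fun χ₁ χ₂ χ' => by rw [add_mul, add_mul, map_add])
    (fun a χ χ' => by
      rw [← map_smul]
      congr 1
      funext α
      change (a • χ α) * χ' α * Θ α = a • (χ α * χ' α * Θ α)
      rw [mul_assoc, mul_comm, germ_mul_smul, mul_comm, mul_assoc])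
    (fun χ χ₁ χ₂ => by rw [mul_add, add_mul, map_add])
    (fun a χ χ' => by
      rw [← map_smul]
      congr 1
      funext α
      change χ α * (a • χ' α) * Θ α = a • (χ α * χ' α * Θ α)
      rw [germ_mul_smul, mul_comm, germ_mul_smul, mul_comm])

theorem quad_apply [Finite I] (Θ χ χ' : LocForm I) : quad Θ χ χ' = pp (χ * χ' * Θ) := rfl

theorem quad_comm [Finite I] (Θ χ χ' : LocForm I) : quad Θ χ χ' = quad Θ χ' χ := by
  rw [quad_apply, quad_apply, mul_comm χ]

theorem quad_mem_ppLt [Finite I] {Θ χ χ' : LocForm I} (hΘ : Θ ∈ ordLoc I (-2)) {n m : ℤ} (h : χ ∈ ordLoc I n)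
    (h' : χ' ∈ ordLoc I m) {N : ℕ} (hN : 1 ≤ 2 * N + n + m) : quad Θ χ χ' ∈ ppLt I N :=
  pp_mem_ppLt (mem_ordLoc_mul (mem_ordLoc_mul h h') hΘ) (by omega)

/-- After multiplication by `θ` the product has at most a simple pole, invisible to the odd
principal part. -/
theorem quad_eq_zero [Finite I] {Θ χ χ' : LocForm I} (hΘ : Θ ∈ ordLoc I (-2)) {n m : ℤ} (h : χ ∈ ordLoc I n)
    (h' : χ' ∈ ordLoc I m) (hN : 1 ≤ n + m) : quad Θ χ χ' = 0 := by
  have := quad_mem_ppLt (N := 0) hΘ h h' (by omega)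
  ext b
  exact mem_ppLt.1 this b (Nat.zero_le _)

/-- Functions on multisets of `n` odd germs that are linear in each germ, depend on finitely many
Taylor coefficients, and have values with poles of bounded order. -/
structure IsAmplitudePP (F : Multiset (Vplus I) → PrincipalPart I) (n : ℕ) : Prop where
  bdd : ∀ᶠ N in atTop, ∀ m : Multiset (Vplus I), m.card = n → F m ∈ ppLt I N
  fin : ∀ k, n = k + 1 → ∀ᶠ N in atTop, ∀ m : Multiset (Vplus I), m.card = k →
    ∀ f ∈ VplusGt I N, F (f ::ₘ m) = 0
  lin : ∀ k, n = k + 1 → ∀ m : Multiset (Vplus I), m.card = k → ∀ (a : ℂ) (x y : Vplus I),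
    F ((x + a • y) ::ₘ m) = F (x ::ₘ m) + a • F (y ::ₘ m)

/-- The analogous notion for functions with values in the germs of forms. -/
structure IsAmplitudeLoc (F : Multiset (Vplus I) → LocForm I) (n : ℕ) : Prop where
  bdd : ∀ᶠ N : ℕ in atTop, ∀ m : Multiset (Vplus I), m.card = n → F m ∈ ordLoc I (-N)
  fin : ∀ k, n = k + 1 → ∀ M : ℤ, ∀ᶠ N in atTop, ∀ m : Multiset (Vplus I), m.card = k →
    ∀ f ∈ VplusGt I N, F (f ::ₘ m) ∈ ordLoc I M
  lin : ∀ k, n = k + 1 → ∀ m : Multiset (Vplus I), m.card = k → ∀ (a : ℂ) (x y : Vplus I),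
    F ((x + a • y) ::ₘ m) = F (x ::ₘ m) + a • F (y ::ₘ m)

theorem IsAmplitudePP.congr {F G : Multiset (Vplus I) → PrincipalPart I} {n : ℕ}
    (hF : IsAmplitudePP F n) (h : ∀ m : Multiset (Vplus I), m.card = n → G m = F m) :
    IsAmplitudePP G n where
  bdd := hF.bdd.mono fun N hN m hm => by rw [h m hm]; exact hN m hm
  fin k hk := (hF.fin k hk).mono fun N hN m hm f hf => by
    rw [h _ (by rw [Multiset.card_cons, hm, hk])]; exact hN m hm f hf
  lin k hk m hm a x y := by
    have e : ∀ f : Vplus I, (f ::ₘ m).card = n := fun f => by rw [Multiset.card_cons, hm, hk]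
    rw [h _ (e _), h _ (e _), h _ (e _), hF.lin k hk m hm]

theorem IsAmplitudeLoc.congr {F G : Multiset (Vplus I) → LocForm I} {n : ℕ}
    (hF : IsAmplitudeLoc F n) (h : ∀ m : Multiset (Vplus I), m.card = n → G m = F m) :
    IsAmplitudeLoc G n where
  bdd := hF.bdd.mono fun N hN m hm => by rw [h m hm]; exact hN m hm
  fin k hk M := (hF.fin k hk M).mono fun N hN m hm f hf => by
    rw [h _ (by rw [Multiset.card_cons, hm, hk])]; exact hN m hm f hf
  lin k hk m hm a x y := by
    have e : ∀ f : Vplus I, (f ::ₘ m).card = n := fun f => by rw [Multiset.card_cons, hm, hk]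
    rw [h _ (e _), h _ (e _), h _ (e _), hF.lin k hk m hm]

theorem IsAmplitudePP.add {F G : Multiset (Vplus I) → PrincipalPart I} {n : ℕ}
    (hF : IsAmplitudePP F n) (hG : IsAmplitudePP G n) : IsAmplitudePP (fun m => F m + G m) n where
  bdd := by
    filter_upwards [hF.bdd, hG.bdd] with N h1 h2 m hm using add_mem (h1 m hm) (h2 m hm)
  fin k hk := by
    filter_upwards [hF.fin k hk, hG.fin k hk] with N h1 h2 m hm f hf
    rw [h1 m hm f hf, h2 m hm f hf, add_zero]
  lin k hk m hm a x y := by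
    rw [hF.lin k hk m hm, hG.lin k hk m hm, smul_add]
    abel

theorem IsAmplitudePP.smul {F : Multiset (Vplus I) → PrincipalPart I} {n : ℕ}
    (hF : IsAmplitudePP F n) (r : ℂ) : IsAmplitudePP (fun m => r • F m) n where
  bdd := hF.bdd.mono fun N h1 m hm => Submodule.smul_mem _ _ (h1 m hm)
  fin k hk := (hF.fin k hk).mono fun N h1 m hm f hf => by rw [h1 m hm f hf, smul_zero]
  lin k hk m hm a x y := by rw [hF.lin k hk m hm, smul_add, smul_comm]

theorem isAmplitudePP_zero (n : ℕ) : IsAmplitudePP (I := I) (fun _ => 0) n where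
  bdd := .of_forall fun _ _ _ => zero_mem _
  fin _ _ := .of_forall fun _ _ _ _ _ => rfl
  lin _ _ _ _ _ _ _ := by simp

theorem IsAmplitudePP.sum {ι : Type*} (t : Finset ι) {F : ι → Multiset (Vplus I) → PrincipalPart I}
    {n : ℕ} (hF : ∀ i ∈ t, IsAmplitudePP (F i) n) : IsAmplitudePP (fun m => ∑ i ∈ t, F i m) n := by
  classical
  induction t using Finset.induction_on with
  | empty => simpa using isAmplitudePP_zero n
  | insert i t hi ih =>
    simp only [Finset.sum_insert hi]
    exact (hF i (Finset.mem_insert_self _ _)).add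
      (ih fun j hj => hF j (Finset.mem_insert_of_mem hj))

theorem isAmplitudePP_const_zero (v : PrincipalPart I) : IsAmplitudePP (fun _ => v) 0 where
  bdd := by
    obtain ⟨N, hN⟩ := exists_mem_ppLt v
    filter_upwards [eventually_ge_atTop N] with M hM m _ using ppLt_mono hM hN
  fin k hk := by omega
  lin k hk := by omega

/-- On a multiset with one element the sum is the differential of that element; writing a sum avoids
extracting it. -/
theorem isAmplitudeLoc_diff : IsAmplitudeLoc (I := I) (fun m => (m.map diffPlus).sum) 1 where
  bdd := .of_forall fun N m hm => by
    obtain ⟨f, rfl⟩ := Multiset.card_eq_one.1 hm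
    simp only [Multiset.map_singleton, Multiset.sum_singleton]
    exact ordLoc_anti (by omega) (diffPlus_mem f)
  fin k hk M := by
    filter_upwards [eventually_ge_atTop M.toNat] with N hN m hm f hf
    obtain rfl : k = 0 := by omega
    rw [Multiset.card_eq_zero.1 hm]
    simp only [Multiset.map_cons, Multiset.map_zero, Multiset.sum_cons, Multiset.sum_zero, add_zero]
    exact ordLoc_anti (by omega) (diffPlus_mem_of_mem_VplusGt hf)
  lin k hk m hm a x y := by
    obtain rfl : k = 0 := by omega
    rw [Multiset.card_eq_zero.1 hm]
    simp

theorem IsAmplitudePP.lift [DecidableEq I] {ξ : I × ℕ → LocForm I}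
    (hξ : ∀ b, ξ b - sing b ∈ ordLoc I 0) {F : Multiset (Vplus I) → PrincipalPart I} {n : ℕ}
    (hF : IsAmplitudePP F n) : IsAmplitudeLoc (fun m => liftPP ξ (F m)) n where
  bdd := by
    obtain ⟨N, hN⟩ := hF.bdd.exists
    filter_upwards [eventually_ge_atTop (2 * N)] with M hM m hm
    exact ordLoc_anti (by omega) (liftPP_mem_ordLoc hξ (hN m hm))
  fin k hk M := (hF.fin k hk).mono fun N hN m hm f hf => by
    rw [hN m hm f hf, map_zero]
    exact zero_mem _
  lin k hk m hm a x y := by rw [hF.lin k hk m hm, map_add, map_smul]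

theorem Multiset.card_of_mem_antidiagonal {α : Type*} {m : Multiset α} {p : Multiset α × Multiset α}
    (h : p ∈ m.antidiagonal) : p.1.card + p.2.card = m.card := by
  rw [← Multiset.mem_antidiagonal.1 h, Multiset.card_add]

/-- Pole orders add up, and a new entry goes to one of the two factors. If that entry vanishes to
high order, its factor vanishes beyond the pole of the other one, so the product is killed; for this
reason `IsAmplitudeLoc.fin` asks for every order `M`. -/
theorem IsAmplitudeLoc.antidiagonal [Finite I] {Θ : LocForm I} (hΘ : Θ ∈ ordLoc I (-2))
    {F G : Multiset (Vplus I) → LocForm I} {n : ℕ} (hF : ∀ i ≤ n, IsAmplitudeLoc F i)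
    (hG : ∀ i ≤ n, IsAmplitudeLoc G i) :
    IsAmplitudePP (fun m => (m.antidiagonal.map fun p => quad Θ (F p.1) (G p.2)).sum) n := by
  have bF : ∀ᶠ N : ℕ in atTop, ∀ i ∈ Finset.range (n + 1), ∀ m : Multiset (Vplus I), m.card = i →
      F m ∈ ordLoc I (-N) := (Filter.eventually_all_finset _).2 fun i hi =>
    (hF i (Nat.lt_succ_iff.1 (Finset.mem_range.1 hi))).bdd
  have bG : ∀ᶠ N : ℕ in atTop, ∀ i ∈ Finset.range (n + 1), ∀ m : Multiset (Vplus I), m.card = i →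
      G m ∈ ordLoc I (-N) := (Filter.eventually_all_finset _).2 fun i hi =>
    (hG i (Nat.lt_succ_iff.1 (Finset.mem_range.1 hi))).bdd
  -- One pole bound for both factors and all sizes of the parts of the splitting.
  obtain ⟨N, hNF, hNG⟩ := (bF.and bG).exists
  constructor
  · filter_upwards [eventually_ge_atTop (2 * N + 1)] with M hM m hm
    refine multiset_sum_mem _ fun v hv => ?_
    obtain ⟨p, hp, rfl⟩ := Multiset.mem_map.1 hv
    have hc := Multiset.card_of_mem_antidiagonal hp
    exact quad_mem_ppLt hΘ (hNF p.1.card (Finset.mem_range.2 (by omega)) _ rfl)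
      (hNG p.2.card (Finset.mem_range.2 (by omega)) _ rfl) (by omega)
  · rintro k rfl
    -- Order `N + 1` against a pole of order `N` leaves `1`, the threshold of `quad_eq_zero`.
    have fF : ∀ᶠ K in atTop, ∀ i ∈ Finset.range (k + 1), ∀ m : Multiset (Vplus I), m.card = i →
        ∀ f ∈ VplusGt I K, F (f ::ₘ m) ∈ ordLoc I (N + 1) := (Filter.eventually_all_finset _).2
      fun i hi => (hF (i + 1) (Nat.succ_le_of_lt (Finset.mem_range.1 hi))).fin i rfl _
    have fG : ∀ᶠ K in atTop, ∀ i ∈ Finset.range (k + 1), ∀ m : Multiset (Vplus I), m.card = i →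
        ∀ f ∈ VplusGt I K, G (f ::ₘ m) ∈ ordLoc I (N + 1) := (Filter.eventually_all_finset _).2
      fun i hi => (hG (i + 1) (Nat.succ_le_of_lt (Finset.mem_range.1 hi))).fin i rfl _
    filter_upwards [fF, fG] with K hF' hG' m hm f hf
    rw [Multiset.antidiagonal_cons, Multiset.map_add, Multiset.sum_add, Multiset.map_map,
      Multiset.map_map]
    rw [Multiset.sum_eq_zero, Multiset.sum_eq_zero, add_zero]
    · intro v hv
      obtain ⟨p, hp, rfl⟩ := Multiset.mem_map.1 hv
      have hc := Multiset.card_of_mem_antidiagonal hp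
      exact quad_eq_zero hΘ (hF' p.1.card (Finset.mem_range.2 (by omega)) _ rfl f hf)
        (hNG p.2.card (Finset.mem_range.2 (by omega)) _ rfl) (by omega)
    · intro v hv
      obtain ⟨p, hp, rfl⟩ := Multiset.mem_map.1 hv
      have hc := Multiset.card_of_mem_antidiagonal hp
      exact quad_eq_zero hΘ (hNF p.1.card (Finset.mem_range.2 (by omega)) _ rfl)
        (hG' p.2.card (Finset.mem_range.2 (by omega)) _ rfl f hf) (by omega)
  · rintro k rfl m hm a x y
    simp only [Multiset.antidiagonal_cons, Multiset.map_add, Multiset.sum_add, Multiset.map_map]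
    have e1 : m.antidiagonal.map ((fun p => quad Θ (F p.1) (G p.2)) ∘
        Prod.map id (Multiset.cons (x + a • y))) =
        m.antidiagonal.map fun p => quad Θ (F p.1) (G (x ::ₘ p.2)) +
          a • quad Θ (F p.1) (G (y ::ₘ p.2)) := by
      refine Multiset.map_congr rfl fun p hp => ?_
      have hc := Multiset.card_of_mem_antidiagonal hp
      change quad Θ (F p.1) (G ((x + a • y) ::ₘ p.2)) = _
      rw [(hG (p.2.card + 1) (by omega)).lin _ rfl _ rfl, map_add, map_smul]
    have e2 : m.antidiagonal.map ((fun p => quad Θ (F p.1) (G p.2)) ∘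
        Prod.map (Multiset.cons (x + a • y)) id) =
        m.antidiagonal.map fun p => quad Θ (F (x ::ₘ p.1)) (G p.2) +
          a • quad Θ (F (y ::ₘ p.1)) (G p.2) := by
      refine Multiset.map_congr rfl fun p hp => ?_
      have hc := Multiset.card_of_mem_antidiagonal hp
      change quad Θ (F ((x + a • y) ::ₘ p.1)) (G p.2) = _
      rw [(hF (p.1.card + 1) (by omega)).lin _ rfl _ rfl, map_add, map_smul, LinearMap.add_apply,
        LinearMap.smul_apply]
    have hs : ∀ g : Multiset (Vplus I) × Multiset (Vplus I) → PrincipalPart I,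
        (m.antidiagonal.map fun p => a • g p).sum = a • (m.antidiagonal.map g).sum := fun g => by
      rw [Multiset.smul_sum, Multiset.map_map]
      rfl
    rw [e1, e2, Multiset.sum_map_add, Multiset.sum_map_add, hs, hs, smul_add]
    simp only [Function.comp_def, Prod.map_fst, Prod.map_snd, id]
    abel

variable [DecidableEq I]

/-- Monomials of high degree are in the kernel of `F` uniformly in the other entries, so the trace
is a sum over one fixed finite set and the properties pass to it term by term. -/
theorem IsAmplitudePP.finsum_mono [Finite I] {Θ : LocForm I} (hΘ : Θ ∈ ordLoc I (-2))
    {ξ : I × ℕ → LocForm I} (hξ : ∀ b, ξ b - sing b ∈ ordLoc I 0)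
    {F : Multiset (Vplus I) → PrincipalPart I} {n : ℕ} (hF : IsAmplitudePP F (n + 1)) :
    IsAmplitudePP (fun m => ∑ᶠ b : I × ℕ, quad Θ (liftPP ξ (F (monoGerm b ::ₘ m)))
      (liftPP ξ (Finsupp.single b 1))) n := by
  cases nonempty_fintype I
  obtain ⟨K, hK⟩ := (hF.fin n rfl).exists
  have hsum : ∀ m : Multiset (Vplus I), m.card = n →
      ∑ᶠ b : I × ℕ, quad Θ (liftPP ξ (F (monoGerm b ::ₘ m))) (liftPP ξ (Finsupp.single b 1)) =
      ∑ b ∈ Finset.univ ×ˢ Finset.range (K + 1), quad Θ (liftPP ξ (F (monoGerm b ::ₘ m)))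
        (liftPP ξ (Finsupp.single b 1)) := by
    intro m hm
    refine finsum_eq_sum_of_support_subset _ fun b hb => ?_
    by_contra h
    refine hb ?_
    beta_reduce
    have : K < b.2 := by
      by_contra h'
      exact h (by simpa using h')
    rw [hK m hm _ (monoGerm_mem_VplusGt this), map_zero, map_zero, LinearMap.zero_apply]
  refine IsAmplitudePP.congr (IsAmplitudePP.sum (Finset.univ ×ˢ Finset.range (K + 1))
    (F := fun b m => quad Θ (liftPP ξ (F (monoGerm b ::ₘ m))) (liftPP ξ (Finsupp.single b 1)))
    fun b _ => ?_) hsum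
  have hs : (Finsupp.single b 1 : PrincipalPart I) ∈ ppLt I (b.2 + 1) := by
    refine mem_ppLt.2 fun a ha => Finsupp.single_eq_of_ne ?_
    rintro rfl
    omega
  have hl := liftPP_mem_ordLoc hξ hs
  constructor
  · obtain ⟨N, hN⟩ := hF.bdd.exists
    filter_upwards [eventually_ge_atTop (N + b.2 + 2)] with M hM m hm
    exact quad_mem_ppLt hΘ (liftPP_mem_ordLoc hξ (hN _ (by rw [Multiset.card_cons, hm]))) hl (by
      push_cast
      omega)
  · rintro k rfl
    filter_upwards [hF.fin _ rfl] with N hN m hm f hf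
    rw [Multiset.cons_swap, hN _ (by rw [Multiset.card_cons, hm]) f hf, map_zero, map_zero,
      LinearMap.zero_apply]
  · rintro k rfl m hm a x y
    rw [Multiset.cons_swap, hF.lin _ rfl _ (by rw [Multiset.card_cons, hm]), map_add, map_smul,
      map_add, map_smul, LinearMap.add_apply, LinearMap.smul_apply, Multiset.cons_swap x,
      Multiset.cons_swap y]

end Multilinear

namespace FSpectralCurve.SqrtCoordinates

variable {X : Type*} [TopologicalSpace X] [ChartedSpace ℂ X]
  {S : FSpectralCurve X} (c : S.SqrtCoordinates)

/-! ### Principal parts of the amplitudes -/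

/-- The weighted germs `w^α θ^α` (connected) and `θ^α` (disconnected). -/
noncomputable def wtheta (k : Kind) : LocForm S.ram :=
  fun α => pgerm fun s => weight S k α * c.theta α s

/-- The principal part of the form `D`. -/
noncomputable def ampD : PrincipalPart S.ram :=
  (-(1 / 2) : ℂ) • pp fun α => pgerm (c.diagPull α (S.bidiff Kind.conn)) * c.wtheta Kind.conn α

/-- A factor of the disconnected term: `d f` for `(0, {f})`, else the form with given principal
part. -/
noncomputable def slot (F : ℕ → Multiset (Vplus S.ram) → PrincipalPart S.ram) (h : ℕ)
    (m : Multiset (Vplus S.ram)) : LocForm S.ram :=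
  if h = 0 ∧ m.card = 1 then (m.map diffPlus).sum else c.Lam Kind.disc (F h m)

/-- The disconnected term of the recursion. -/
noncomputable def discStep (F : ℕ → Multiset (Vplus S.ram) → PrincipalPart S.ram) (g : ℕ)
    (m : Multiset (Vplus S.ram)) : PrincipalPart S.ram :=
  (1 / 2 : ℂ) • ∑ h ∈ Finset.range (g + 1), (m.antidiagonal.map fun p =>
    quad (c.wtheta Kind.disc) (c.slot F h p.1) (c.slot F (g - h) p.2)).sum

theorem slot_zero_zero {F : ℕ → Multiset (Vplus S.ram) → PrincipalPart S.ram} (hF : F 0 0 = 0) :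
    c.slot F 0 0 = 0 := by
  simp [slot, hF]

theorem wtheta_mem [IsManifold 𝓘(ℂ, ℂ) ω X] (k : Kind) : c.wtheta k ∈ ordLoc S.ram (-2) := by
  refine mem_ordLoc.2 fun α => ?_
  rw [wtheta, pgerm_const_mul]
  exact Submodule.smul_mem _ _ (c.theta_mem α)

/-- A term in which one factor carries all of `(g, m)` has the other factor at `(0, ∅)`, where the
slot vanishes. So the step uses only values with strictly smaller `2 h + |m'|`. -/
theorem discStep_congr {F F' : ℕ → Multiset (Vplus S.ram) → PrincipalPart S.ram}
    (hF : F 0 0 = 0) (hF' : F' 0 0 = 0) {g : ℕ} {m : Multiset (Vplus S.ram)}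
    (h : ∀ h m', 2 * h + m'.card < 2 * g + m.card → F h m' = F' h m') :
    c.discStep F g m = c.discStep F' g m := by
  have key : ∀ i m', 2 * i + m'.card < 2 * g + m.card → c.slot F i m' = c.slot F' i m' := by
    intro i m' hi
    rw [slot, slot, h i m' hi]
  rw [discStep, discStep]
  congr 1
  refine Finset.sum_congr rfl fun i hi => congrArg _ (Multiset.map_congr rfl fun p hp => ?_)
  have hc := Multiset.card_of_mem_antidiagonal hp
  have hi' := Finset.mem_range.1 hi
  by_cases h1 : 2 * i + p.1.card < 2 * g + m.card
  · by_cases h2 : 2 * (g - i) + p.2.card < 2 * g + m.card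
    · rw [key _ _ h1, key _ _ h2]
    · have e1 : i = 0 := by omega
      have e2 : p.1 = 0 := Multiset.card_eq_zero.1 (by omega)
      rw [e1, e2, slot_zero_zero c hF, slot_zero_zero c hF', map_zero, LinearMap.zero_apply,
        LinearMap.zero_apply]
  · have e1 : g - i = 0 := by omega
    have e2 : p.2 = 0 := Multiset.card_eq_zero.1 (by omega)
    rw [e1, e2, slot_zero_zero c hF, slot_zero_zero c hF', map_zero, map_zero]

variable [DecidableEq S.ram]

/-- The connected term of the recursion. -/
noncomputable def connStep (F : ℕ → Multiset (Vplus S.ram) → PrincipalPart S.ram) :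
    ℕ → Multiset (Vplus S.ram) → PrincipalPart S.ram
  | 0, _ => 0
  | g + 1, m => if g = 0 ∧ m.card = 0 then c.ampD else (1 / 2 : ℂ) • ∑ᶠ b : S.ram × ℕ,
      quad (c.wtheta Kind.conn) (c.Lam Kind.conn (F g (monoGerm b ::ₘ m)))
        (c.Lam Kind.conn (Finsupp.single b 1))

/-- Iteration of the recursion. -/
noncomputable def ampIter : ℕ → ℕ → Multiset (Vplus S.ram) → PrincipalPart S.ram
  | 0 => fun _ _ => 0
  | N + 1 => fun g m => c.connStep (ampIter N) g m + c.discStep (ampIter N) g m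

/-- The principal parts of the amplitudes. -/
noncomputable def amp (g : ℕ) (m : Multiset (Vplus S.ram)) : PrincipalPart S.ram :=
  c.ampIter (2 * g + m.card + 1) g m

theorem connStep_congr {F F' : ℕ → Multiset (Vplus S.ram) → PrincipalPart S.ram} {g : ℕ}
    {m : Multiset (Vplus S.ram)}
    (h : ∀ h m', 2 * h + m'.card < 2 * g + m.card → F h m' = F' h m') :
    c.connStep F g m = c.connStep F' g m := by
  cases g with
  | zero => rfl
  | succ g =>
    simp only [connStep]
    congr 3
    funext b
    rw [h g _ (by rw [Multiset.card_cons]; omega)]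

theorem ampIter_zero_zero (N : ℕ) : c.ampIter N 0 0 = 0 := by
  induction N with
  | zero => rfl
  | succ N ih => simp [ampIter, connStep, discStep, slot_zero_zero c ih]

/-- Both steps only consult strictly smaller values of `2 g + |m|`, so the iteration is stationary
once its index exceeds that number. -/
theorem ampIter_eq {N N' g : ℕ} {m : Multiset (Vplus S.ram)} (h : 2 * g + m.card < N)
    (h' : 2 * g + m.card < N') : c.ampIter N g m = c.ampIter N' g m := by
  induction N generalizing N' g m with
  | zero => omega
  | succ N ih =>
    obtain _ | N' := N'
    · omega
    have e : ∀ h m', 2 * h + m'.card < 2 * g + m.card → c.ampIter N h m' = c.ampIter N' h m' :=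
      fun i m' hi => ih (by omega) (by omega)
    simp only [ampIter]
    rw [c.connStep_congr e, c.discStep_congr (c.ampIter_zero_zero N) (c.ampIter_zero_zero N') e]

theorem amp_zero_zero : c.amp 0 0 = 0 := c.ampIter_zero_zero _

/-- The iterate of index `2 g + |m|` already agrees with `amp` wherever the steps consult it, so
unfolding one iteration gives the fixed-point equation. -/
theorem amp_eq (g : ℕ) (m : Multiset (Vplus S.ram)) :
    c.amp g m = c.connStep c.amp g m + c.discStep c.amp g m := by
  have e : ∀ h m', 2 * h + m'.card < 2 * g + m.card →
      c.ampIter (2 * g + m.card) h m' = c.amp h m' := fun i m' hi => c.ampIter_eq hi (by omega)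
  rw [← c.connStep_congr e, ← c.discStep_congr (c.ampIter_zero_zero _) c.amp_zero_zero e]
  rfl

theorem amp_zero_singleton (f : Vplus S.ram) : c.amp 0 {f} = 0 := by
  rw [amp_eq]
  rw [connStep, discStep, ← Multiset.cons_zero f, Multiset.antidiagonal_cons]
  simp [c.slot_zero_zero c.amp_zero_zero]

variable [IsManifold 𝓘(ℂ, ℂ) ω X]

variable [T2Space X]

theorem isAmplitudePP_connStep {F : ℕ → Multiset (Vplus S.ram) → PrincipalPart S.ram} {g n : ℕ}
    (hF : ∀ h i, 2 * h + i < 2 * g + n → IsAmplitudePP (F h) i) :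
    IsAmplitudePP (c.connStep F g) n := by
  cases g with
  | zero => exact isAmplitudePP_zero n
  | succ g =>
    by_cases h : g = 0 ∧ n = 0
    · obtain ⟨rfl, rfl⟩ := h
      exact (isAmplitudePP_const_zero c.ampD).congr fun m hm => by simp [connStep, hm]
    · refine (((hF g (n + 1) (by omega)).finsum_mono (c.wtheta_mem Kind.conn)
        (c.toLoc_xi_sub_sing_mem Kind.conn)).smul (1 / 2)).congr fun m hm => ?_
      rw [connStep, hm, if_neg h]

theorem isAmplitudePP_discStep {F : ℕ → Multiset (Vplus S.ram) → PrincipalPart S.ram} {g n : ℕ}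
    (hF0 : F 0 0 = 0) (hF : ∀ h i, 2 * h + i < 2 * g + n → IsAmplitudePP (F h) i) :
    IsAmplitudePP (c.discStep F g) n := by
  have key : ∀ G : ℕ → Multiset (Vplus S.ram) → PrincipalPart S.ram,
      (∀ h i, IsAmplitudePP (G h) i) → IsAmplitudePP (c.discStep G g) n := by
    intro G hG
    have hs : ∀ h i, IsAmplitudeLoc (c.slot G h) i := by
      intro h i
      by_cases h1 : h = 0 ∧ i = 1
      · obtain ⟨rfl, rfl⟩ := h1
        exact isAmplitudeLoc_diff.congr fun m hm => by simp [slot, hm]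
      · refine ((hG h i).lift (c.toLoc_xi_sub_sing_mem Kind.disc)).congr fun m hm => ?_
        rw [slot, hm, if_neg h1]
    exact (IsAmplitudePP.sum _ fun h _ => IsAmplitudeLoc.antidiagonal (c.wtheta_mem Kind.disc)
      (fun i _ => hs h i) fun i _ => hs (g - h) i).smul _
  classical
  -- Cutting `F` off where nothing is known about it makes all its components amplitudes;
  -- `discStep_congr` shows that the cut-off does not change the step.
  refine (key (fun h m => if 2 * h + m.card < 2 * g + n then F h m else 0) fun h i => ?_).congr
    fun m hm => ?_
  · by_cases hi : 2 * h + i < 2 * g + n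
    · exact (hF h i hi).congr fun m hm => by simp [hm, hi]
    · exact (isAmplitudePP_zero i).congr fun m hm => by simp [hm, hi]
  · refine c.discStep_congr hF0 (by simp [hF0]) fun h m' hh => ?_
    rw [hm] at hh
    rw [if_pos hh]

theorem isAmplitudePP_amp (g n : ℕ) : IsAmplitudePP (c.amp g) n := by
  induction hN : 2 * g + n using Nat.strong_induction_on generalizing g n with
  | _ N ih =>
    subst hN
    have h := fun h i hi => ih (2 * h + i) hi h i rfl
    exact ((c.isAmplitudePP_connStep h).add (c.isAmplitudePP_discStep c.amp_zero_zero h)).congr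
      fun m _ => c.amp_eq g m

theorem isAmplitudePP_connStep_amp (g n : ℕ) : IsAmplitudePP (c.connStep c.amp g) n :=
  c.isAmplitudePP_connStep fun h i _ => c.isAmplitudePP_amp h i

theorem isAmplitudePP_discStep_amp (g n : ℕ) : IsAmplitudePP (c.discStep c.amp g) n :=
  c.isAmplitudePP_discStep c.amp_zero_zero fun h i _ => c.isAmplitudePP_amp h i

end FSpectralCurve.SqrtCoordinates

namespace FSpectralCurve.SqrtCoordinates

variable {X : Type*} [TopologicalSpace X] [ChartedSpace ℂ X]
  {S : FSpectralCurve X} (c : S.SqrtCoordinates)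

/-! ### The residue operators in terms of principal parts -/

theorem wtheta_disc (α : S.ram) : c.wtheta Kind.disc α = pgerm (c.theta α) :=
  pgerm_eq fun _ _ => one_mul _

theorem diagPull_eq (α : S.ram) (χ : X → X → ℂ) (s : ℂ) : c.diagPull α χ s =
    -(χ (c.γ α s) (c.γ α (-s)) * velocity (c.γ α) (-s) * velocity (c.γ α) s) := by
  simp only [diagPull, pullForm, sigmaPull]
  ring

variable [IsManifold 𝓘(ℂ, ℂ) ω X]

theorem toLoc_bidiff_mem (k : Kind) {z : X} (hz : z ∉ S.ram) :
    c.toLoc (fun p => S.bidiff k p z) ∈ ordLoc S.ram 0 :=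
  mem_ordLoc.2 fun α => analytic_mem_ordGe (c.bidiff_fst_analytic k α hz)

/-- By definition of `θ` the kernel is `-½ θ` times the half integral, so `sum_res_halfInt` applies
to the rest of the integrand. -/
theorem kernelOp_eq (k : Kind) {χ : X → X → ℂ} (hχ : ∀ α, MeromorphicAt (c.diagPull α χ) 0) {z₀ : X}
    (hz : z₀ ∉ S.ram) : c.kernelOp k χ z₀ = c.Xi k z₀ ((-(1 / 2) : ℂ) •
      pp fun α => pgerm (c.diagPull α χ) * c.wtheta k α) := by
  have hθ : ∀ α, MeromorphicAt (c.theta α) 0 := fun α =>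
    coe_mem_merGerm.1 (ordGe_le_merGerm _ (c.theta_mem α))
  rw [← map_smul, ← c.sum_res_halfInt k hz]
  · refine Finset.sum_congr rfl fun α _ => ?_
    have e : (fun s => weight S k α * c.kernel k α z₀ s * c.diagPull α χ s) = fun s =>
        c.halfInt k α z₀ s * ((-(1 / 2) : ℂ) * (c.diagPull α χ s * (weight S k α * c.theta α s))) := by
      funext s
      rw [kernel, theta]
      ring
    rw [e, ← res_coe]
    · rfl
    · rw [halfInt_eq]
      exact (oddPrim_analytic (c.bidiff_snd_analytic k α hz)).meromorphicAt.fun_mul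
        ((MeromorphicAt.const _ _).fun_mul ((hχ α).fun_mul ((MeromorphicAt.const _ _).fun_mul (hθ α))))
  · exact Submodule.smul_mem _ _ (mem_merLoc.2 fun α => merGerm_mul (coe_mem_merGerm.2 (hχ α))
      (mem_merLoc.1 (ordLoc_le_merLoc _ (c.wtheta_mem k)) α))

theorem proj_eq (k : Kind) {χ : X → ℂ} (hχ : c.toLoc χ ∈ oddLoc S.ram) {z₀ : X} (hz : z₀ ∉ S.ram) :
    c.proj k χ z₀ = c.Xi k z₀ (pp (c.toLoc χ)) :=
  c.projAux_eq k (fun α => mem_oddPolar.1 (mem_oddLoc.1 hχ α)) hz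

theorem oddCoeff_wtheta_mul (k : Kind) {a b : X → ℂ} (ha : c.toLoc a ∈ oddLoc S.ram)
    (hb : c.toLoc b ∈ oddLoc S.ram) (α : S.ram) (j : ℕ) :
    oddCoeff j (pgerm fun s => c.restr a α s * c.restr b α (-s) * (weight S k α * c.theta α s)) =
    oddCoeff j (pgerm fun s => c.restr a α s * c.restr b α s * (weight S k α * c.theta α s)) :=
  oddCoeff_mul_comp_neg (mem_ordLoc.1 (c.wtheta_mem k) α) (fun s => by rw [c.theta_neg])
    (mem_oddPolar.1 (mem_oddLoc.1 ha α)) (mem_oddPolar.1 (mem_oddLoc.1 hb α)) j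

/-- The two forms differ by one with an odd coefficient `h`. Replacing `h s` by `h (-s) = -h s`
leaves the pairing unchanged by `oddCoeff_mul_comp_neg`, so the pairing is zero. This turns the
factors `ω_{0,2}(· | z_i)` into differentials of inputs. -/
theorem quad_bidiff {z : X} (hz : z ∉ S.ram) {χ : LocForm S.ram} (hχ : χ ∈ oddLoc S.ram) :
    quad (c.wtheta Kind.disc) (c.toLoc fun p => S.bidiff Kind.disc p z) χ =
      quad (c.wtheta Kind.disc) (diffPlus (c.inp z)) χ := by
  rw [← sub_eq_zero, quad_comm _ _ χ, quad_comm _ _ χ, ← map_sub, quad_comm]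
  set g : S.ram → ℂ → ℂ := fun α => pullForm (c.γ α) fun p => S.bidiff Kind.disc p z with hg
  have ha : ∀ α, AnalyticAt ℂ (g α) 0 := fun α => c.bidiff_fst_analytic Kind.disc α hz
  have e : (c.toLoc fun p => S.bidiff Kind.disc p z) - diffPlus (c.inp z) =
      fun α => pgerm fun s => (1 / 2 : ℂ) * (g α s - g α (-s)) := by
    funext α
    have h1 : diffPlus (c.inp z) α = pgerm fun s => (1 / 2 : ℂ) * (g α s + g α (-s)) :=
      pgerm_congr ((c.germRep_inp hz α).deriv.trans (deriv_oddPrim (ha α)))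
    rw [Pi.sub_apply, h1]
    refine pgerm_eq fun s _ => ?_
    change g α s - _ = _
    ring
  have hm := mem_merLoc_mul (mem_merLoc_mul (sub_mem
    (ordLoc_le_merLoc _ (c.toLoc_bidiff_mem Kind.disc hz)) (ordLoc_le_merLoc _
      (diffPlus_mem (c.inp z)))) (oddLoc_le_merLoc hχ)) (ordLoc_le_merLoc _ (c.wtheta_mem Kind.disc))
  ext ⟨α, j⟩
  rw [quad_apply, pp_apply hm, e]
  have hh : AnalyticAt ℂ (fun s => (1 / 2 : ℂ) * (g α s - g α (-s))) 0 :=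
    analyticAt_const.fun_mul ((ha α).fun_sub (ha α).comp_neg_zero)
  set h : ℂ → ℂ := fun s => (1 / 2 : ℂ) * (g α s - g α (-s))
  have hn : ∀ s, h (-s) = -h s := fun s => by
    simp only [h, neg_neg]
    ring
  obtain ⟨f, hf, hf'⟩ : ∃ f, χ α = pgerm f ∧ HasOddPolarPart f :=
    ⟨germRep (χ α), (coe_germRep _).symm, mem_oddPolar_iff_germRep.1 (mem_oddLoc.1 hχ α)⟩
  have key := oddCoeff_mul_comp_neg (mem_ordLoc.1 (c.wtheta_mem Kind.disc) α)
    (fun s => by rw [c.theta_neg]) hf' (oddPolar_of_analyticAt hh) j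
  have e1 : (pgerm fun s => f s * h (-s) * (weight S Kind.disc α * c.theta α s)) =
      -pgerm fun s => f s * h s * (weight S Kind.disc α * c.theta α s) :=
    pgerm_eq fun s _ => by
      change _ = -(_ * _)
      rw [hn]
      ring
  have e2 : ((fun α => pgerm fun s => (1 / 2 : ℂ) * (g α s - g α (-s))) * χ * c.wtheta Kind.disc) α =
      pgerm fun s => f s * h s * (weight S Kind.disc α * c.theta α s) := by
    change pgerm h * χ α * _ = _
    rw [hf, mul_comm (pgerm h)]
    rfl
  rw [e1, map_neg, neg_eq_self] at key
  exact (congrArg (oddCoeff j) e2).trans key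

variable [T2Space X]

/-- Pulling back under `σ` gives `-a(s) b(-s)`; this sign cancels the one in `kernelOp_eq`, and
`oddCoeff_mul_comp_neg` replaces `b(-s)` by `b(s)`. The expansion of `χ` is required only off the
ramification points. -/
theorem kernelOp_sum (k : Kind) {ι : Type*} (t : Finset ι) {a b : ι → X → ℂ}
    (ha : ∀ i ∈ t, c.toLoc (a i) ∈ oddLoc S.ram) (hb : ∀ i ∈ t, c.toLoc (b i) ∈ oddLoc S.ram)
    {χ : X → X → ℂ} (hχ : ∀ u ∉ S.ram, ∀ v ∉ S.ram, χ u v = ∑ i ∈ t, a i u * b i v) {z₀ : X}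
    (hz : z₀ ∉ S.ram) : c.kernelOp k χ z₀ =
      c.Xi k z₀ ((1 / 2 : ℂ) • ∑ i ∈ t, quad (c.wtheta k) (c.toLoc (a i)) (c.toLoc (b i))) := by
  have e : ∀ α, c.diagPull α χ =ᶠ[𝓝[≠] 0] fun s =>
      ∑ i ∈ t, -(c.restr (a i) α s * c.restr (b i) α (-s)) := by
    intro α
    filter_upwards [c.eventually_not_mem_ram α,
      tendsto_neg_punctured.eventually (c.eventually_not_mem_ram α)] with s h1 h2
    rw [diagPull_eq, hχ _ h1 _ h2, Finset.sum_mul, Finset.sum_mul, Finset.sum_neg_distrib]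
    congr 1
    refine Finset.sum_congr rfl fun i _ => ?_
    simp only [restr, pullForm]
    ring
  have hma : ∀ i ∈ t, ∀ α, MeromorphicAt (c.restr (a i) α) 0 := fun i hi α =>
    (mem_oddPolar.1 (mem_oddLoc.1 (ha i hi) α)).1
  have hmb : ∀ i ∈ t, ∀ α, MeromorphicAt (c.restr (b i) α) 0 := fun i hi α =>
    (mem_oddPolar.1 (mem_oddLoc.1 (hb i hi) α)).1
  have hm : ∀ i ∈ t, ∀ α, MeromorphicAt (fun s => -(c.restr (a i) α s * c.restr (b i) α (-s))) 0 :=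
    fun i hi α => ((hma i hi α).fun_mul (hmb i hi α).comp_neg_zero).fun_neg
  rw [c.kernelOp_eq k (fun α => (MeromorphicAt.fun_sum fun i hi => hm i hi α).congr (e α).symm) hz]
  congr 1
  have e1 : (fun α => pgerm (c.diagPull α χ) * c.wtheta k α) = ∑ i ∈ t, fun α =>
      pgerm (fun s => -(c.restr (a i) α s * c.restr (b i) α (-s))) * c.wtheta k α := by
    funext α
    rw [Finset.sum_apply, ← Finset.sum_mul, ← pgerm_sum]
    congr 1
    exact Germ.coe_eq.2 (e α)
  rw [e1, map_sum, neg_smul, ← smul_neg, ← Finset.sum_neg_distrib]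
  congr 1
  refine Finset.sum_congr rfl fun i hi => ?_
  have hw := ordLoc_le_merLoc _ (c.wtheta_mem k)
  rw [quad_apply, ← map_neg]
  ext ⟨α, j⟩
  rw [pp_apply, pp_apply]
  · refine Eq.trans (congrArg (oddCoeff j) ?_) (c.oddCoeff_wtheta_mul k (ha i hi) (hb i hi) α j)
    change -(pgerm _ * pgerm _) = _
    refine pgerm_eq fun s _ => ?_
    change -(-(_ * _) * (_ * _)) = _
    ring
  · exact mem_merLoc_mul (mem_merLoc_mul (oddLoc_le_merLoc (ha i hi)) (oddLoc_le_merLoc (hb i hi))) hw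
  · exact neg_mem (mem_merLoc.2 fun α => merGerm_mul (coe_mem_merGerm.2 (hm i hi α))
      (mem_merLoc.1 hw α))

end FSpectralCurve.SqrtCoordinates

/-! ### Multisets of the values of a tuple -/

section Tuple

variable {W : Type*}

/-- The multiset of the entries of a tuple. -/
def tupleMs {n : ℕ} (f : Fin n → W) : Multiset W := ∑ i, {f i}

theorem card_tupleMs {n : ℕ} (f : Fin n → W) : (tupleMs f).card = n := by
  simp [tupleMs]

theorem tupleMs_cons {n : ℕ} (a : W) (f : Fin n → W) :
    tupleMs (Fin.cons a f : Fin (n + 1) → W) = a ::ₘ tupleMs f := by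
  simp [tupleMs, Fin.sum_univ_succ]

theorem tupleMs_snoc {n : ℕ} (f : Fin n → W) (a : W) :
    tupleMs (Fin.snoc f a : Fin (n + 1) → W) = a ::ₘ tupleMs f := by
  simp [tupleMs, Fin.sum_univ_castSucc, add_comm]

theorem tupleMs_comp_perm {n : ℕ} (f : Fin n → W) (τ : Equiv.Perm (Fin n)) :
    tupleMs (f ∘ τ) = tupleMs f :=
  Equiv.sum_comp τ fun i => ({f i} : Multiset W)

theorem tupleMs_subFamily {n : ℕ} (f : Fin n → W) (J : Finset (Fin n)) :
    tupleMs (subFamily f J) = ∑ i ∈ J, {f i} := by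
  conv_rhs => rw [← Finset.map_orderEmbOfFin_univ J rfl, Finset.sum_map]
  rfl

/-- Induction on `s`: the new index lies in the complement or in `J`, matching the two halves of
`Multiset.antidiagonal_cons`. The antidiagonal counts splittings with multiplicity, so repeated
entries cause no discrepancy. -/
theorem sum_powerset_eq_sum_antidiagonal {ι M : Type*} [DecidableEq ι] [AddCommMonoid M]
    (f : ι → W) (Q : Multiset W → Multiset W → M) (s : Finset ι) :
    ∑ J ∈ s.powerset, Q (∑ i ∈ J, {f i}) (∑ i ∈ s \ J, {f i}) =
      ((∑ i ∈ s, ({f i} : Multiset W)).antidiagonal.map fun p => Q p.1 p.2).sum := by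
  induction s using Finset.induction_on generalizing Q with
  | empty => simp
  | insert a s ha ih =>
    rw [Finset.sum_powerset_insert ha, Finset.sum_insert ha, Multiset.singleton_add,
      Multiset.antidiagonal_cons, Multiset.map_add, Multiset.sum_add, Multiset.map_map,
      Multiset.map_map]
    congr 1
    · refine Eq.trans ?_ (ih fun x y => Q x (f a ::ₘ y))
      refine Finset.sum_congr rfl fun J hJ => ?_
      have hJa : a ∉ J := fun h => ha (Finset.mem_powerset.1 hJ h)
      rw [Finset.insert_sdiff_of_notMem _ hJa, Finset.sum_insert (by simp [ha]),
        Multiset.singleton_add]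
    · refine Eq.trans ?_ (ih fun x y => Q (f a ::ₘ x) y)
      refine Finset.sum_congr rfl fun J hJ => ?_
      have hJa : a ∉ J := fun h => ha (Finset.mem_powerset.1 hJ h)
      rw [Finset.insert_sdiff_insert, Finset.sdiff_insert_of_notMem ha, Finset.sum_insert hJa,
        Multiset.singleton_add]

theorem sum_subFamily_eq_sum_antidiagonal {M : Type*} [AddCommMonoid M] {n : ℕ} (f : Fin n → W)
    (Q : Multiset W → Multiset W → M) :
    ∑ J : Finset (Fin n), Q (tupleMs (subFamily f J)) (tupleMs (subFamily f Jᶜ)) =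
      ((tupleMs f).antidiagonal.map fun p => Q p.1 p.2).sum := by
  simp only [tupleMs_subFamily]
  exact sum_powerset_eq_sum_antidiagonal f Q Finset.univ

end Tuple

/-! ### Finite expansion of an amplitude in one entry -/

section Expansion

variable {I : Type*}

/-- The dependence of an amplitude on one of its entries, as a linear map. -/
def IsAmplitudePP.linearMap {F : Multiset (Vplus I) → PrincipalPart I} {n : ℕ}
    (hF : IsAmplitudePP F (n + 1)) {m : Multiset (Vplus I)} (hm : m.card = n) :
    Vplus I →ₗ[ℂ] PrincipalPart I :=
  have h0 : F (0 ::ₘ m) = 0 := by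
    -- With `a = -1` and `x = y = 0` the linearity axiom reads `F 0 = F 0 - F 0`.
    have h := hF.lin n rfl m hm (-1) 0 0
    simpa using h
  { toFun := fun f => F (f ::ₘ m)
    map_add' := fun x y => by simpa using hF.lin n rfl m hm 1 x y
    map_smul' := fun a y => by simpa [h0] using hF.lin n rfl m hm a 0 y }

/-- An odd germ minus its Taylor polynomial vanishes to high order, hence is in the kernel of the
linear dependence on that entry. -/
theorem IsAmplitudePP.exists_expansion [Fintype I] [DecidableEq I]
    {F : Multiset (Vplus I) → PrincipalPart I} {n : ℕ} (hF : IsAmplitudePP F (n + 1)) :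
    ∀ᶠ N in atTop, ∀ m : Multiset (Vplus I), m.card = n →
      (∀ f : Vplus I, F (f ::ₘ m) = ∑ b ∈ Finset.univ ×ˢ Finset.range (N + 1),
        plusCoeff b f • F (monoGerm b ::ₘ m)) ∧
      ∀ b : I × ℕ, N < b.2 → F (monoGerm b ::ₘ m) = 0 := by
  filter_upwards [hF.fin n rfl] with N hN m hm
  refine ⟨fun f => ?_, fun b hb => hN m hm _ (monoGerm_mem_VplusGt hb)⟩
  have h := hN m hm _ (sub_sum_monoGerm_mem f N)
  change hF.linearMap hm _ = 0 at h
  rw [map_sub, map_sum, sub_eq_zero] at h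
  refine h.trans (Finset.sum_congr rfl fun b _ => ?_)
  rw [map_smul]
  rfl

end Expansion

namespace FSpectralCurve.SqrtCoordinates

variable {X : Type*} [TopologicalSpace X] [ChartedSpace ℂ X]
  {S : FSpectralCurve X} (c : S.SqrtCoordinates)

/-! ### The multidifferentials -/

theorem Lam_single (k : Kind) (b : S.ram × ℕ) :
    c.Lam k (Finsupp.single b 1) = c.toLoc (c.xi k b) := by
  simp

theorem Xi_single (k : Kind) (z : X) (b : S.ram × ℕ) :
    c.Xi k z (Finsupp.single b 1) = c.xi k b z := by
  simp [Xi]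

theorem toLoc_Xi_add (v v' : PrincipalPart S.ram) :
    c.toLoc (fun z => c.Xi Kind.conn z v + c.Xi Kind.disc z v') =
      c.Lam Kind.conn v + c.Lam Kind.disc v' := by
  rw [toLoc_add, toLoc_Xi, toLoc_Xi]

theorem omega_zero_one {z₀ : X} (w : Fin 1 → X) : c.omega 0 1 z₀ w = S.bidiff Kind.disc z₀ (w 0) := by
  rw [omega]
  simp

variable [IsManifold 𝓘(ℂ, ℂ) ω X] [T2Space X] [DecidableEq S.ram]

theorem pp_Lam (k : Kind) (v : PrincipalPart S.ram) : pp (c.Lam k v) = v :=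
  pp_liftPP (c.toLoc_xi_sub_sing_mem k) v

theorem Lam_mem (k : Kind) (v : PrincipalPart S.ram) : c.Lam k v ∈ oddLoc S.ram :=
  liftPP_mem_oddLoc (c.toLoc_xi_sub_sing_mem k) v

theorem pp_toLoc_plusCoeff_inp (b : S.ram × ℕ) :
    pp (c.toLoc fun z => plusCoeff b (c.inp z)) = Finsupp.single b 1 := by
  rw [pp_congr (c.toLoc_plusCoeff_inp_sub_sing_mem b), pp_sing]

theorem toLoc_plusCoeff_inp_mem (b : S.ram × ℕ) :
    (c.toLoc fun z => plusCoeff b (c.inp z)) ∈ oddLoc S.ram := by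
  rw [← sub_add_cancel (c.toLoc fun z => plusCoeff b (c.inp z)) (sing b)]
  exact add_mem (ordLoc_zero_le_oddLoc (c.toLoc_plusCoeff_inp_sub_sing_mem b)) (sing_mem_oddLoc b)

/-- A projector retains only principal parts, and lifts of either kind have the principal part they
were built from; so the two contributions add up. -/
theorem proj_Xi_add (k : Kind) {χ : X → ℂ} {v v' : PrincipalPart S.ram}
    (hχ : ∀ z ∉ S.ram, χ z = c.Xi Kind.conn z v + c.Xi Kind.disc z v') {z₀ : X} (hz : z₀ ∉ S.ram) :
    c.proj k χ z₀ = c.Xi k z₀ (v + v') := by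
  have e := (c.toLoc_congr hχ).trans (c.toLoc_Xi_add v v')
  rw [c.proj_eq k (e ▸ add_mem (c.Lam_mem _ v) (c.Lam_mem _ v')) hz, e, map_add, pp_Lam, pp_Lam]

/-- Expanding the input `inp v` in Taylor coefficients writes `Φ` as a finite sum of products.
Projection in `v` turns the `b`-th coefficient into `xi conn b`, projection in `u` merges the two
lifts, and `kernelOp_sum` yields the trace. -/
theorem kernelOp_proj2 {F G : Multiset (Vplus S.ram) → PrincipalPart S.ram} {n : ℕ}
    (hF : IsAmplitudePP F (n + 1)) (hG : IsAmplitudePP G (n + 1)) {m : Multiset (Vplus S.ram)}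
    (hm : m.card = n) {Φ : X → X → ℂ} (hΦ : ∀ u ∉ S.ram, ∀ v ∉ S.ram, Φ u v =
      c.Xi Kind.conn u (F (c.inp v ::ₘ m)) + c.Xi Kind.disc u (G (c.inp v ::ₘ m))) {z₀ : X}
    (hz : z₀ ∉ S.ram) : c.kernelOp Kind.conn (c.proj2 Kind.conn Φ) z₀ =
      c.Xi Kind.conn z₀ ((1 / 2 : ℂ) • ∑ᶠ b : S.ram × ℕ, quad (c.wtheta Kind.conn)
        (c.Lam Kind.conn (F (monoGerm b ::ₘ m) + G (monoGerm b ::ₘ m)))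
        (c.Lam Kind.conn (Finsupp.single b 1))) := by
  obtain ⟨N, hNF, hNG⟩ := (hF.exists_expansion.and hG.exists_expansion).exists
  obtain ⟨eF, zF⟩ := hNF m hm
  obtain ⟨eG, zG⟩ := hNG m hm
  set t : Finset (S.ram × ℕ) := Finset.univ ×ˢ Finset.range (N + 1)
  -- The inner projector acts on `v`, with the values at `u` as constants.
  have e1 : ∀ u ∉ S.ram, ∀ z' ∉ S.ram, c.proj Kind.conn (fun v => Φ u v) z' =
      ∑ b ∈ t, (c.Xi Kind.conn u (F (monoGerm b ::ₘ m)) + c.Xi Kind.disc u (G (monoGerm b ::ₘ m))) *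
        c.xi Kind.conn b z' := by
    intro u hu z' hz'
    have e : c.toLoc (fun v => Φ u v) = ∑ b ∈ t, (c.Xi Kind.conn u (F (monoGerm b ::ₘ m)) +
        c.Xi Kind.disc u (G (monoGerm b ::ₘ m))) • c.toLoc fun v => plusCoeff b (c.inp v) := by
      simp only [← toLoc_const_mul, ← toLoc_sum]
      refine c.toLoc_congr fun v hv => ?_
      rw [hΦ u hu v hv, eF, eG, map_sum, map_sum, ← Finset.sum_add_distrib]
      refine Finset.sum_congr rfl fun b _ => ?_
      rw [map_smul, map_smul, smul_eq_mul, smul_eq_mul]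
      ring
    rw [c.proj_eq _ _ hz', e, map_sum, map_sum]
    · refine Finset.sum_congr rfl fun b _ => ?_
      rw [map_smul, map_smul, pp_toLoc_plusCoeff_inp, Xi_single, smul_eq_mul]
    · rw [e]
      exact sum_mem fun b _ => Submodule.smul_mem _ _ (c.toLoc_plusCoeff_inp_mem b)
  have e2 : ∀ z ∉ S.ram, ∀ z' ∉ S.ram, c.proj2 Kind.conn Φ z z' = ∑ b ∈ t,
      c.Xi Kind.conn z (F (monoGerm b ::ₘ m) + G (monoGerm b ::ₘ m)) * c.xi Kind.conn b z' := by
    intro z hz z' hz'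
    rw [proj2, c.proj_Xi_add Kind.conn (v := ∑ b ∈ t, c.xi Kind.conn b z' • F (monoGerm b ::ₘ m))
      (v' := ∑ b ∈ t, c.xi Kind.conn b z' • G (monoGerm b ::ₘ m)) _ hz, ← Finset.sum_add_distrib,
      map_sum]
    · refine Finset.sum_congr rfl fun b _ => ?_
      rw [← smul_add, map_smul, smul_eq_mul, mul_comm]
    · intro u hu
      rw [e1 u hu z' hz', map_sum, map_sum, ← Finset.sum_add_distrib]
      refine Finset.sum_congr rfl fun b _ => ?_
      rw [map_smul, map_smul, smul_eq_mul, smul_eq_mul]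
      ring
  rw [c.kernelOp_sum Kind.conn t (fun b _ => ?_) (fun b _ => ?_) e2 hz]
  · rw [finsum_eq_sum_of_support_subset (s := t)]
    · congr 2
      refine Finset.sum_congr rfl fun b _ => ?_
      rw [toLoc_Xi, Lam_single]
    · intro b hb
      by_contra h
      have hb' : N < b.2 := by
        by_contra h'
        exact h (by simpa [t] using h')
      refine hb ?_
      beta_reduce
      rw [zF b hb', zG b hb', add_zero, map_zero, map_zero, LinearMap.zero_apply]
  · rw [toLoc_Xi]
    exact c.Lam_mem _ _
  · rw [← Lam_single]
    exact c.Lam_mem _ _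

/-- The factors in the disconnected term of the recursion. -/
noncomputable def factor (h j : ℕ) (w : Fin j → X) (u : X) : ℂ :=
  if h = 0 ∧ j = 1 then c.omega h j u w else c.proj Kind.disc (fun p => c.omega h j p w) u

theorem slot_mem (F : ℕ → Multiset (Vplus S.ram) → PrincipalPart S.ram) (h : ℕ)
    (m : Multiset (Vplus S.ram)) : c.slot F h m ∈ oddLoc S.ram := by
  rw [slot]
  split_ifs with h1
  · refine multiset_sum_mem _ fun χ hχ => ?_
    obtain ⟨f, -, rfl⟩ := Multiset.mem_map.1 hχ
    exact ordLoc_zero_le_oddLoc (diffPlus_mem f)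
  · exact c.Lam_mem _ _

/-- A factor `ω_{0,2}` is not projected, so it equals the differential of its input only inside
`quad` (`quad_bidiff`); hence the conclusion concerns pairings. The other factors are projected, and
there the germs themselves agree. -/
theorem factor_spec {h j : ℕ} {w : Fin j → X} (hw : ∀ i, w i ∉ S.ram) (h0 : ¬(h = 0 ∧ j = 0))
    {F G : ℕ → Multiset (Vplus S.ram) → PrincipalPart S.ram}
    (IH : ¬(h = 0 ∧ j = 1) → ∀ p ∉ S.ram, c.omega h j p w =
      c.Xi Kind.conn p (F h (tupleMs (c.inp ∘ w))) + c.Xi Kind.disc p (G h (tupleMs (c.inp ∘ w)))) :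
    c.toLoc (c.factor h j w) ∈ oddLoc S.ram ∧ ∀ χ ∈ oddLoc S.ram,
      quad (c.wtheta Kind.disc) (c.toLoc (c.factor h j w)) χ = quad (c.wtheta Kind.disc)
        (c.slot (fun h m => F h m + G h m) h (tupleMs (c.inp ∘ w))) χ := by
  by_cases h1 : h = 0 ∧ j = 1
  · obtain ⟨rfl, rfl⟩ := h1
    have e : c.factor 0 1 w = fun p => S.bidiff Kind.disc p (w 0) := by
      funext p
      rw [factor, if_pos ⟨rfl, rfl⟩, omega_zero_one]
    have e' : c.slot (fun h m => F h m + G h m) 0 (tupleMs (c.inp ∘ w)) = diffPlus (c.inp (w 0)) := by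
      simp [slot, tupleMs]
    rw [e, e']
    exact ⟨ordLoc_zero_le_oddLoc (c.toLoc_bidiff_mem Kind.disc (hw 0)),
      fun χ hχ => c.quad_bidiff (hw 0) hχ⟩
  · have e : c.toLoc (c.factor h j w) = c.slot (fun h m => F h m + G h m) h (tupleMs (c.inp ∘ w)) := by
      rw [slot, card_tupleMs, if_neg h1, ← toLoc_Xi]
      refine c.toLoc_congr fun z hz => ?_
      rw [factor, if_neg h1, c.proj_Xi_add Kind.disc (IH h1) hz]
    rw [e]
    exact ⟨c.slot_mem _ _ _, fun _ _ => rfl⟩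

theorem kernelOp_disc {g n : ℕ} {z : Fin n → X} (hz : ∀ i, z i ∉ S.ram)
    {F G : ℕ → Multiset (Vplus S.ram) → PrincipalPart S.ram} (hF : F 0 0 + G 0 0 = 0)
    (IH : ∀ h j, ∀ w : Fin j → X, 2 * h + j < 2 * g + n → ¬(h = 0 ∧ j = 0) → ¬(h = 0 ∧ j = 1) →
      (∀ i, w i ∉ S.ram) → ∀ p ∉ S.ram, c.omega h j p w =
      c.Xi Kind.conn p (F h (tupleMs (c.inp ∘ w))) + c.Xi Kind.disc p (G h (tupleMs (c.inp ∘ w))))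
    {z₀ : X} (hz₀ : z₀ ∉ S.ram) :
    c.kernelOp Kind.disc (fun u v => ∑ h : Fin (g + 1), ∑ J : Finset (Fin n),
        if ¬ ((h : ℕ) = 0 ∧ J.card = 0) ∧ ¬ (g - (h : ℕ) = 0 ∧ Jᶜ.card = 0) then
          c.factor h J.card (subFamily z J) u * c.factor (g - h) Jᶜ.card (subFamily z Jᶜ) v
        else 0) z₀ =
      c.Xi Kind.disc z₀ (c.discStep (fun h m => F h m + G h m) g (tupleMs (c.inp ∘ z))) := by
  classical
  set P : Fin (g + 1) × Finset (Fin n) → Prop := fun q =>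
    ¬ ((q.1 : ℕ) = 0 ∧ q.2.card = 0) ∧ ¬ (g - (q.1 : ℕ) = 0 ∧ q.2ᶜ.card = 0) with hP
  have hsub : ∀ J : Finset (Fin n), c.inp ∘ subFamily z J = subFamily (c.inp ∘ z) J := fun _ => rfl
  have hcard : ∀ J : Finset (Fin n), J.card + Jᶜ.card = n := fun J => by
    rw [Finset.card_add_card_compl, Fintype.card_fin]
  have s1 : ∀ q, P q → _ := fun q hq => c.factor_spec (h := q.1) (w := subFamily z q.2)
    (fun i => hz _) hq.1 (F := F) (G := G) fun h1 => IH _ _ _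
      (by have := hcard q.2; have := q.1.2; have := hq.2; omega) hq.1 h1 fun i => hz _
  have s2 : ∀ q, P q → _ := fun q hq => c.factor_spec (h := g - q.1) (w := subFamily z q.2ᶜ)
    (fun i => hz _) hq.2 (F := F) (G := G) fun h1 => IH _ _ _
      (by have := hcard q.2; have := q.1.2; have := hq.1; omega) hq.2 h1 fun i => hz _
  rw [c.kernelOp_sum Kind.disc (Finset.univ.filter P)
    (a := fun q => c.factor q.1 q.2.card (subFamily z q.2))
    (b := fun q => c.factor (g - q.1) q.2ᶜ.card (subFamily z q.2ᶜ))
    (fun q hq => (s1 q (Finset.mem_filter.1 hq).2).1)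
    (fun q hq => (s2 q (Finset.mem_filter.1 hq).2).1) _ hz₀]
  · rw [discStep, Finset.sum_filter, Fintype.sum_prod_type, Finset.sum_range]
    congr 2
    refine Finset.sum_congr rfl fun h _ => ?_
    refine Eq.trans ?_ (sum_subFamily_eq_sum_antidiagonal (c.inp ∘ z) fun x y =>
      quad (c.wtheta Kind.disc) (c.slot (fun h m => F h m + G h m) h x)
        (c.slot (fun h m => F h m + G h m) (g - h) y))
    refine Finset.sum_congr rfl fun J _ => ?_
    split_ifs with hq
    · rw [(s1 _ hq).2 _ (s2 _ hq).1, quad_comm, (s2 _ hq).2 _ (c.slot_mem _ _ _), quad_comm]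
      rfl
    -- The excluded terms, those with a factor `ω_{0,1}`, correspond to splittings in which a slot
    -- at `(0, ∅)` is zero, so they may be restored.
    · have hz0 : ∀ (i : ℕ) (J : Finset (Fin n)), i = 0 ∧ J.card = 0 →
          c.slot (fun h m => F h m + G h m) i (tupleMs (subFamily (c.inp ∘ z) J)) = 0 := by
        rintro i J ⟨rfl, hJ⟩
        rw [Finset.card_eq_zero] at hJ
        subst hJ
        rw [tupleMs_subFamily, Finset.sum_empty]
        exact c.slot_zero_zero hF
      rcases not_and_or.1 hq with h1 | h1
      · rw [hz0 _ _ (not_not.1 h1), map_zero, LinearMap.zero_apply]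
      · rw [hz0 _ _ (not_not.1 h1), map_zero]
  · intro u _ v _
    rw [Finset.sum_filter, Fintype.sum_prod_type]

/-- Strong induction on `2 g + n`: `kernelOp_proj2` and `kernelOp_disc` convert the two residue
operators into the two steps for `amp`. The steps stay separate because they are lifted by basic
forms of different kinds. -/
theorem omega_eq {g n : ℕ} (h0 : ¬(g = 0 ∧ n = 0)) (h1 : ¬(g = 0 ∧ n = 1)) {z₀ : X}
    (hz₀ : z₀ ∉ S.ram) {z : Fin n → X} (hz : ∀ i, z i ∉ S.ram) : c.omega g n z₀ z =
      c.Xi Kind.conn z₀ (c.connStep c.amp g (tupleMs (c.inp ∘ z))) +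
      c.Xi Kind.disc z₀ (c.discStep c.amp g (tupleMs (c.inp ∘ z))) := by
  induction hN : 2 * g + n using Nat.strong_induction_on generalizing g n z₀ with
  | _ N ih =>
    subst hN
    have ea : (fun h m => c.connStep c.amp h m + c.discStep c.amp h m) = c.amp := by
      funext h m
      exact (c.amp_eq h m).symm
    rw [omega, if_neg h0, dif_neg h1]
    congr 1
    · cases g with
      | zero => simp [connStep]
      | succ g =>
        simp only [connStep, card_tupleMs]
        split_ifs with h
        · exact c.kernelOp_eq Kind.conn (c.diagPull_meromorphic (S.bidiff_fundamental _)) hz₀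
        -- The smaller amplitude is split into its connected and disconnected steps, whose lifts the
        -- induction hypothesis describes separately.
        · simp only [c.amp_eq g (monoGerm _ ::ₘ _)]
          refine c.kernelOp_proj2 (c.isAmplitudePP_connStep_amp g (n + 1))
            (c.isAmplitudePP_discStep_amp g (n + 1)) (card_tupleMs _) (fun u hu v hv => ?_) hz₀
          rw [ih (2 * g + (n + 1)) (by omega) (by omega) (by omega) hu (z := Fin.cons v z)
            (fun i => Fin.cases hv hz i) rfl]
          have : c.inp ∘ (Fin.cons v z : Fin (n + 1) → X) = Fin.cons (c.inp v) (c.inp ∘ z) :=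
            Fin.comp_cons _ _ _
          rw [this, tupleMs_cons]
    · rw [← ea, ← c.kernelOp_disc hz (by rw [← c.amp_eq, c.amp_zero_zero])
        (fun h j w hlt h0 h1 hw p hp => ih _ hlt h0 h1 hp hw rfl) hz₀]
      rfl

end FSpectralCurve.SqrtCoordinates

/-! ### Iterated residues -/

theorem IsAmplitudePP.cons {I : Type*} {F : Multiset (Vplus I) → PrincipalPart I} {n : ℕ}
    (hF : IsAmplitudePP F (n + 1)) (x : Vplus I) : IsAmplitudePP (fun m => F (x ::ₘ m)) n where
  bdd := hF.bdd.mono fun N hN m hm => hN _ (by rw [Multiset.card_cons, hm])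
  fin k hk := (hF.fin n rfl).mono fun N hN m hm f hf => by
    rw [Multiset.cons_swap]
    exact hN _ (by rw [Multiset.card_cons, hm, hk]) f hf
  lin k hk m hm a y z := by
    have h : (x ::ₘ m).card = n := by rw [Multiset.card_cons, hm, hk]
    rw [Multiset.cons_swap, hF.lin n rfl _ h, Multiset.cons_swap y, Multiset.cons_swap z]

theorem germRep_analytic {I : Type*} (f : Vplus I) (α : I) : AnalyticAt ℂ (germRep (f.1 α)) 0 := by
  obtain ⟨ph, h1, -, h3⟩ := Vplus_exists_rep f α
  exact h1.congr h3.symm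

/-- Against the holomorphic function `f` the error `η - sing b` has no residue, and the residue
against `sing b` extracts a Taylor coefficient. -/
theorem sum_res_germRep_mul {I : Type*} [Fintype I] [DecidableEq I] (f : Vplus I) {b : I × ℕ}
    {η : LocForm I} (h : η - sing b ∈ ordLoc I 0) :
    ∑ α, res (pgerm (germRep (f.1 α)) * η α) = plusCoeff b f := by
  have e : ∀ α, res (pgerm (germRep (f.1 α)) * η α) =
      res (pgerm (germRep (f.1 α)) * (sing b : LocForm I) α) := by
    intro α
    rw [← sub_eq_zero, ← map_sub, ← mul_sub]
    exact res_of_mem_ordGe_zero (ordGe_anti (by norm_num)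
      (mem_ordGe_mul (analytic_mem_ordGe (germRep_analytic f α)) (mem_ordLoc.1 h α)))
  simp only [e]
  rw [Finset.sum_eq_single b.1]
  · rw [sing, Pi.single_eq_same]
    rfl
  · intro α _ hα
    rw [sing, Pi.single_eq_of_ne hα, mul_zero, map_zero]
  · simp

namespace FSpectralCurve.SqrtCoordinates

variable {X : Type*} [TopologicalSpace X] [ChartedSpace ℂ X]
  {S : FSpectralCurve X} (c : S.SqrtCoordinates)
  [IsManifold 𝓘(ℂ, ℂ) ω X] [T2Space X]

theorem projLoc_eq (k : Kind) {χ : LocForm S.ram} (hχ : χ ∈ oddLoc S.ram) :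
    c.projLoc k χ = c.Lam k (pp χ) := by
  have e : (fun α => pgerm (germRep (χ α))) = χ := funext fun α => coe_germRep _
  rw [← toLoc_Xi]
  refine c.toLoc_congr fun z hz => ?_
  rw [c.projAux_eq k (fun α => mem_oddPolar_iff_germRep.1 (mem_oddLoc.1 hχ α)) hz, e]

variable [DecidableEq S.ram]

theorem sum_resZero_germRep_mul (f : Vplus S.ram) (t : Finset (S.ram × ℕ)) (a : S.ram × ℕ → ℂ)
    {χ : X → ℂ} (hχ : ∀ z ∉ S.ram, χ z = ∑ b ∈ t, a b * plusCoeff b (c.inp z)) :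
    ∑ α : S.ram, resZero (fun s => germRep (f.1 α) s * pullForm (c.γ α) χ s) =
      ∑ b ∈ t, a b * plusCoeff b f := by
  have e : c.toLoc χ = ∑ b ∈ t, a b • c.toLoc fun z => plusCoeff b (c.inp z) := by
    simp only [← toLoc_const_mul, ← toLoc_sum]
    exact c.toLoc_congr hχ
  have hm : c.toLoc χ ∈ oddLoc S.ram := by
    rw [e]
    exact sum_mem fun b _ => Submodule.smul_mem _ _ (c.toLoc_plusCoeff_inp_mem b)
  have e1 : ∀ α : S.ram, resZero (fun s => germRep (f.1 α) s * pullForm (c.γ α) χ s) =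
      ∑ b ∈ t, a b * res (pgerm (germRep (f.1 α)) * c.toLoc (fun z => plusCoeff b (c.inp z)) α) := by
    intro α
    refine (res_coe ((germRep_analytic f α).meromorphicAt.fun_mul
      (mem_oddPolar.1 (mem_oddLoc.1 hm α)).1)).symm.trans ?_
    change res (pgerm (germRep (f.1 α)) * c.toLoc χ α) = _
    rw [e, Finset.sum_apply, Finset.mul_sum, map_sum]
    refine Finset.sum_congr rfl fun b _ => ?_
    rw [Pi.smul_apply, germ_mul_smul, map_smul, smul_eq_mul]
  simp only [e1]
  rw [Finset.sum_comm]
  refine Finset.sum_congr rfl fun b _ => ?_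
  rw [← Finset.mul_sum, sum_res_germRep_mul f (c.toLoc_plusCoeff_inp_sub_sing_mem b)]

/-- Each residue involves a finite combination of the coefficients `plusCoeff b (inp z)` and
replaces them by those of `f 0`. The expansion of an amplitude is the same for both entries, so `inp
z` is replaced by `f 0`. -/
theorem iterRes_eq {n : ℕ} {F G : Multiset (Vplus S.ram) → PrincipalPart S.ram}
    (hF : IsAmplitudePP F n) (hG : IsAmplitudePP G n) (z₀ : X) {Φ : (Fin n → X) → ℂ}
    (hΦ : ∀ z, (∀ i, z i ∉ S.ram) → Φ z = c.Xi Kind.conn z₀ (F (tupleMs (c.inp ∘ z))) +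
      c.Xi Kind.disc z₀ (G (tupleMs (c.inp ∘ z)))) (f : Fin n → Vplus S.ram) :
    c.iterRes n Φ f = c.Xi Kind.conn z₀ (F (tupleMs f)) + c.Xi Kind.disc z₀ (G (tupleMs f)) := by
  induction n generalizing F G with
  | zero =>
    rw [iterRes, hΦ _ fun i => i.elim0]
    rfl
  | succ n ih =>
    obtain ⟨N, hNF, hNG⟩ := (hF.exists_expansion.and hG.exists_expansion).exists
    have eF := (hNF (tupleMs (Fin.tail f)) (card_tupleMs _)).1
    have eG := (hNG (tupleMs (Fin.tail f)) (card_tupleMs _)).1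
    rw [iterRes, c.sum_resZero_germRep_mul (f 0) (Finset.univ ×ˢ Finset.range (N + 1)) (fun b =>
      c.Xi Kind.conn z₀ (F (monoGerm b ::ₘ tupleMs (Fin.tail f))) +
      c.Xi Kind.disc z₀ (G (monoGerm b ::ₘ tupleMs (Fin.tail f))))]
    · have ef : tupleMs f = f 0 ::ₘ tupleMs (Fin.tail f) := by
        rw [← tupleMs_cons, Fin.cons_self_tail]
      rw [ef, eF, eG, map_sum, map_sum, ← Finset.sum_add_distrib]
      refine Finset.sum_congr rfl fun b _ => ?_
      rw [map_smul, map_smul, ← smul_add, smul_eq_mul, mul_comm]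
    · intro p hp
      -- The inner residues are taken with the outer point `p` fixed, so its input becomes a fixed
      -- entry of the amplitudes.
      rw [ih (hF.cons (c.inp p)) (hG.cons (c.inp p))]
      · rw [eF, eG, map_sum, map_sum, ← Finset.sum_add_distrib]
        refine Finset.sum_congr rfl fun b _ => ?_
        rw [map_smul, map_smul, ← smul_add, smul_eq_mul, mul_comm]
      · intro z hz
        rw [hΦ (Fin.cons p z) fun i => Fin.cases hp hz i, Fin.comp_cons, tupleMs_cons]

theorem smeared_eq {g n : ℕ} (h : 2 ≤ 2 * g + n) (f : Fin n → Vplus S.ram) {z₀ : X}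
    (hz : z₀ ∉ S.ram) : c.smeared g n f z₀ =
      c.Xi Kind.conn z₀ (c.connStep c.amp g (tupleMs f)) +
      c.Xi Kind.disc z₀ (c.discStep c.amp g (tupleMs f)) :=
  c.iterRes_eq (c.isAmplitudePP_connStep_amp g n) (c.isAmplitudePP_discStep_amp g n) z₀
    (fun _ hz' => c.omega_eq (by omega) (by omega) hz hz') f

/-- On forms with odd polar part the local projector is `Lam k ∘ pp`; conversely `Lam k v` has odd
polar part and is fixed by the projector. -/
theorem Vminus_eq (k : Kind) : c.Vminus k = LinearMap.range (c.Lam k) := by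
  refine le_antisymm (Submodule.span_le.2 ?_) ?_
  · rintro _ ⟨χ, hχ, rfl⟩
    exact ⟨pp χ, (c.projLoc_eq k (mem_oddLoc.2 fun α => mem_oddPolar_iff_germRep.2 (hχ α))).symm⟩
  · rintro _ ⟨v, rfl⟩
    refine Submodule.subset_span ⟨c.Lam k v, fun α =>
      mem_oddPolar_iff_germRep.1 (mem_oddLoc.1 (c.Lam_mem k v) α), ?_⟩
    rw [c.projLoc_eq k (c.Lam_mem k v), pp_Lam]

/-- Odd principal parts are identified with the elements of `V_-`. -/
noncomputable def LamEquiv (k : Kind) : PrincipalPart S.ram ≃ₗ[ℂ] c.Vminus k :=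
  (LinearEquiv.ofInjective (c.Lam k) (Function.LeftInverse.injective (c.pp_Lam k))).trans
    (LinearEquiv.ofEq _ _ (c.Vminus_eq k).symm)

theorem coe_LamEquiv (k : Kind) (v : PrincipalPart S.ram) :
    (c.LamEquiv k v : LocForm S.ram) = c.Lam k v := rfl

/-- The germ is a sum of a `conn` lift and a `disc` lift; either projector adds their principal
parts, which by `amp_eq` gives `amp`. The kind survives only in `LamEquiv k`. -/
theorem projLoc_toLoc_smeared (k : Kind) {g n : ℕ} (h : 2 ≤ 2 * g + n) (f : Fin n → Vplus S.ram) :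
    c.projLoc k (c.toLoc (c.smeared g n f)) = c.LamEquiv k (c.amp g (tupleMs f)) := by
  have e : c.toLoc (c.smeared g n f) = c.Lam Kind.conn (c.connStep c.amp g (tupleMs f)) +
      c.Lam Kind.disc (c.discStep c.amp g (tupleMs f)) := by
    rw [← toLoc_Xi_add]
    exact c.toLoc_congr fun z hz => c.smeared_eq h f hz
  rw [e, c.projLoc_eq k (add_mem (c.Lam_mem _ _) (c.Lam_mem _ _)), map_add, pp_Lam, pp_Lam, amp_eq]
  rfl

theorem toLoc_formD : c.toLoc c.formD = c.LamEquiv Kind.conn c.ampD := by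
  rw [coe_LamEquiv, ← toLoc_Xi]
  exact c.toLoc_congr fun z hz =>
    c.kernelOp_eq Kind.conn (c.diagPull_meromorphic (S.bidiff_fundamental _)) hz

end FSpectralCurve.SqrtCoordinates

/-! ### Up-morphisms and tensors in terms of principal parts -/

namespace FSpectralCurve.SqrtCoordinates

variable {X : Type*} [TopologicalSpace X] [ChartedSpace ℂ X]
  {S : FSpectralCurve X} (c : S.SqrtCoordinates)

/-- In `κ` only the half integral depends on `z_2`, and its Taylor coefficients are the basic forms
`xi`. The double factorial is the normalisation of `ε`. -/
theorem kappaCoeff_eq (χ : LocForm S.ram) (b : S.ram × ℕ) :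
    c.kappaCoeff χ b = ((2 * b.2 + 1)‼ : ℂ) •
      (χ * c.Lam Kind.conn (Finsupp.single b 1) * c.wtheta Kind.conn) := by
  rw [Lam_single]
  funext α
  have e : (χ * c.toLoc (c.xi Kind.conn b) * c.wtheta Kind.conn) α = pgerm fun s =>
      germRep (χ α) s * (c.xi Kind.conn b (c.γ α s) * velocity (c.γ α) s) *
        (S.w α * c.theta α s) := by
    change χ α * _ * _ = _
    conv_lhs => rw [← coe_germRep (χ α)]
    rfl
  rw [Pi.smul_apply, e, ← pgerm_const_mul]
  refine pgerm_eq fun s _ => ?_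
  have e1 : c.kappa χ α s b.1 = fun t => (germRep (χ α) s * S.w α * c.theta α s *
      velocity (c.γ α) s) * c.halfInt Kind.conn b.1 (c.γ α s) t := by
    funext t
    rw [kappa]
    ring
  rw [e1, iteratedDeriv_const_mul_field, xi]
  ring

variable [DecidableEq S.ram] [IsManifold 𝓘(ℂ, ℂ) ω X] [T2Space X]

theorem existsUnique_decomposition (k : Kind) {χ : LocForm S.ram} (hχ : χ ∈ merLoc S.ram) :
    ∃! p : c.Vminus k × Vplus S.ram × LocForm S.ram,
      IsEvenLocForm p.2.2 ∧ χ = (p.1 : LocForm S.ram) + locD (p.2.1 : LocFun S.ram) + p.2.2 := by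
  have hξ := c.toLoc_xi_sub_sing_mem k
  obtain ⟨f, e, he, h⟩ := exists_decomposition hξ hχ
  refine ⟨(c.LamEquiv k (pp χ), f, e), ⟨he, h⟩, ?_⟩
  rintro ⟨v, f', e'⟩ ⟨he', h'⟩
  obtain ⟨x, rfl⟩ := (c.LamEquiv k).surjective v
  obtain ⟨rfl, rfl, rfl⟩ := decomposition_unique hξ he' he (h'.symm.trans h)
  rfl

namespace UpDown

variable {c} (u : c.UpDown)

/-- The identification of the odd principal parts with the image of the up-morphisms. -/
noncomputable def ppEquiv : PrincipalPart S.ram ≃ₗ[ℂ] u.Vcheck :=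
  (c.LamEquiv Kind.conn).trans (u.U Kind.conn)

/-- The compatibility identifies `Δ^disc ∘ U^conn` with the `disc` projector, which sends `Lam conn
v` to `Lam disc v` since it retains only `pp`. Hence both up-morphisms induce the same map on
principal parts. -/
theorem U_LamEquiv (k : Kind) (v : PrincipalPart S.ram) : u.U k (c.LamEquiv k v) = u.ppEquiv v := by
  cases k with
  | conn => rfl
  | disc =>
    rw [← LinearEquiv.eq_symm_apply]
    refine Subtype.ext (Eq.trans ?_ (u.compat_disc (c.LamEquiv Kind.conn v)))
    rw [coe_LamEquiv, coe_LamEquiv, c.projLoc_eq _ (c.Lam_mem _ v), pp_Lam]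

theorem up_LamEquiv (k : Kind) (v : PrincipalPart S.ram) :
    u.up k (c.LamEquiv k v) = u.ppEquiv v := by
  rw [up, dif_pos (c.LamEquiv k v).2]
  exact u.U_LamEquiv k v

theorem down_eq (k : Kind) (v : u.Vcheck) : u.down k v = c.Lam k (u.ppEquiv.symm v) := by
  rw [down, ← coe_LamEquiv]
  congr 1
  rw [LinearEquiv.symm_apply_eq, U_LamEquiv, LinearEquiv.apply_symm_apply]

/-- In whatever decomposition is chosen, the differential and the even form have zero principal
part, so the `V_-` component is determined by `pp χ`. -/
theorem upBar_eq (k : Kind) {χ : LocForm S.ram} (hχ : χ ∈ merLoc S.ram) :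
    u.upBar k χ = u.ppEquiv (pp χ) := by
  obtain ⟨p, ⟨he, h⟩, -⟩ := c.existsUnique_decomposition k hχ
  have hex : ∃ v : c.Vminus k, ∃ f : Vplus S.ram, ∃ e : LocForm S.ram,
      IsEvenLocForm e ∧ χ = (v : LocForm S.ram) + locD (f : LocFun S.ram) + e :=
    ⟨p.1, p.2.1, p.2.2, he, h⟩
  rw [upBar, dif_pos hex]
  obtain ⟨f, e, he, h⟩ := hex.choose_spec
  obtain ⟨x, hx⟩ := (c.LamEquiv k).surjective hex.choose
  rw [← hx, U_LamEquiv]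
  rw [← hx, coe_LamEquiv, ← diffPlus_apply] at h
  rw [h, map_add pp, map_add pp, pp_Lam, pp_eq_zero (diffPlus_mem f) (by norm_num), he.pp_eq_zero, add_zero,
    add_zero]

theorem tensorF_eq (k : Kind) (g n : ℕ) (f : Fin n → Vplus S.ram) :
    u.tensorF k g n f = u.ppEquiv (c.amp g (tupleMs f)) := by
  rw [tensorF]
  split_ifs with h
  · rw [c.projLoc_toLoc_smeared k h, up_LamEquiv]
  -- In the unstable cases the zero convention for the tensors matches the vanishing of `amp` on the
  -- empty multiset and on singletons.
  · obtain rfl : g = 0 := by omega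
    have hn : n = 0 ∨ n = 1 := by omega
    rcases hn with rfl | rfl
    · have : tupleMs f = 0 := by simp [tupleMs]
      rw [this, amp_zero_zero, map_zero]
    · have : tupleMs f = {f 0} := by simp [tupleMs]
      rw [this, amp_zero_singleton, map_zero]

theorem exists_multilinearMap (k : Kind) (g n : ℕ) :
    ∃ M : MultilinearMap ℂ (fun _ : Fin n => Vplus S.ram) u.Vcheck,
      (∀ f, M f = u.tensorF k g n f) ∧
      ∀ (τ : Equiv.Perm (Fin n)) (f : Fin n → Vplus S.ram), M (f ∘ τ) = M f := by
  have key : ∀ (f : Fin n → Vplus S.ram) (i : Fin n), ∃ L : Vplus S.ram →ₗ[ℂ] u.Vcheck,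
      ∀ x, u.ppEquiv (c.amp g (tupleMs (Function.update f i x))) = L x := by
    intro f i
    obtain ⟨n, rfl⟩ : ∃ k, n = k + 1 := ⟨n - 1, by have := i.2; omega⟩
    -- As a multiset, an update at any position is a `cons` onto the other entries, so linearity in
    -- the first entry suffices.
    have e : ∀ x, tupleMs (Function.update f i x) = x ::ₘ ∑ j ∈ Finset.univ.erase i, {f j} := by
      intro x
      rw [tupleMs, ← Finset.add_sum_erase _ _ (Finset.mem_univ i), Function.update_self,
        Multiset.singleton_add]
      congr 1
      refine Finset.sum_congr rfl fun j hj => ?_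
      rw [Function.update_of_ne (Finset.ne_of_mem_erase hj)]
    have hc : (∑ j ∈ Finset.univ.erase i, ({f j} : Multiset (Vplus S.ram))).card = n := by
      simp
    exact ⟨u.ppEquiv.toLinearMap ∘ₗ (c.isAmplitudePP_amp g (n + 1)).linearMap hc, fun x => by
      rw [e]
      rfl⟩
  refine ⟨MultilinearMap.mk' (fun f => u.ppEquiv (c.amp g (tupleMs f))) (fun f i x y => ?_)
    fun f i a x => ?_, fun f => (u.tensorF_eq k g n f).symm, fun τ f => ?_⟩
  · obtain ⟨L, hL⟩ := key f i
    rw [hL, hL, hL, map_add]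
  · obtain ⟨L, hL⟩ := key f i
    rw [hL, hL, map_smul]
  · change u.ppEquiv (c.amp g (tupleMs (f ∘ τ))) = _
    rw [tupleMs_comp_perm]
    rfl

end UpDown

end FSpectralCurve.SqrtCoordinates

/-! ### Comparison of finite-dimensional filtrations -/

theorem exists_le_of_fg {V : Type*} [AddCommGroup V] [Module ℂ V] {Vle : ℕ → Submodule ℂ V}
    (hmono : Monotone Vle) (hex : ∀ v, ∃ d, v ∈ Vle d) {M : Submodule ℂ V} (hM : M.FG) :
    ∃ d, M ≤ Vle d := by
  obtain ⟨t, rfl⟩ := hM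
  choose r hr using hex
  exact ⟨t.sup r, Submodule.span_le.2 fun v hv => hmono (Finset.le_sup hv) (hr v)⟩

theorem exists_strictMono_ge (r : ℕ → ℕ) : ∃ ph : ℕ → ℕ, StrictMono ph ∧ ∀ d, r d ≤ ph d := by
  -- Partial sums dominate `r` and are monotone; the summand `d` makes the growth strict.
  refine ⟨fun d => d + ∑ i ∈ Finset.range (d + 1), r i, strictMono_nat_of_lt_succ fun d => ?_,
    fun d => ?_⟩
  · rw [Finset.sum_range_succ _ (d + 1)]
    omega
  · have := Finset.sum_range_succ r d
    change r d ≤ d + ∑ i ∈ Finset.range (d + 1), r i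
    omega

namespace FSpectralCurve.SqrtCoordinates.UpDown

variable {X : Type*} [TopologicalSpace X] [ChartedSpace ℂ X]
  {S : FSpectralCurve X} {c : S.SqrtCoordinates} [DecidableEq S.ram]
  [IsManifold 𝓘(ℂ, ℂ) ω X] [T2Space X] (u : c.UpDown)

/-! ### The F-Airy structure -/

theorem exists_ppEquiv_mem {Vle : ℕ → Submodule ℂ u.Vcheck} (hmono : Monotone Vle)
    (hex : ∀ v, ∃ d, v ∈ Vle d) (N : ℕ) : ∃ d, ∀ v ∈ ppLt S.ram N, u.ppEquiv v ∈ Vle d := by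
  have := ppLt_finite (I := S.ram) N
  obtain ⟨d, hd⟩ := exists_le_of_fg (V := u.Vcheck) hmono hex
    ((Module.Finite.iff_fg.1 this).map (u.ppEquiv : PrincipalPart S.ram →ₗ[ℂ] u.Vcheck))
  exact ⟨d, fun v hv => hd (Submodule.mem_map_of_mem hv)⟩

theorem exists_ppEquiv_symm_mem (M : Submodule ℂ u.Vcheck) [Module.Finite ℂ M] :
    ∃ N, ∀ v ∈ M, u.ppEquiv.symm v ∈ ppLt S.ram N := by
  have hM : M.FG := Module.Finite.iff_fg.1 inferInstance
  obtain ⟨N, hN⟩ := exists_le_of_fg (fun _ _ h => ppLt_mono h) exists_mem_ppLt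
    (hM.map (u.ppEquiv.symm : u.Vcheck →ₗ[ℂ] PrincipalPart S.ram))
  exact ⟨N, fun v hv => hN (Submodule.mem_map_of_mem hv)⟩

/-- The F-Airy structure of an F-spectral curve. -/
noncomputable def airy {Vle : ℕ → Submodule ℂ u.Vcheck} (hmono : Monotone Vle)
    (hfin : ∀ d, Module.Finite ℂ (Vle d)) (hex : ∀ v, ∃ d, v ∈ Vle d)
    (W : Submodule ℂ (Vplus S.ram)) :
    FAiryStructure (V := u.Vcheck) (W := W) Vle (fun d => (VplusGt S.ram d).comap W.subtype)
      (fun b : S.ram × ℕ => b.2) where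
  A := ((quad (c.wtheta Kind.disc)).compl₁₂ (diffPlus ∘ₗ W.subtype) (diffPlus ∘ₗ W.subtype)).compr₂
    u.ppEquiv.toLinearMap
  B := ((quad (c.wtheta Kind.disc)).compl₁₂ (diffPlus ∘ₗ W.subtype)
    (c.Lam Kind.disc ∘ₗ u.ppEquiv.symm.toLinearMap)).compr₂ u.ppEquiv.toLinearMap
  Cconn := LinearMap.pi fun b => ((2 * b.2 + 1)‼ : ℂ) • (u.ppEquiv.toLinearMap ∘ₗ
    (quad (c.wtheta Kind.conn)).flip (c.Lam Kind.conn (Finsupp.single b 1)) ∘ₗ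
      c.Lam Kind.conn ∘ₗ u.ppEquiv.symm.toLinearMap)
  Cdisc := ((quad (c.wtheta Kind.disc)).compl₁₂ (c.Lam Kind.disc ∘ₗ u.ppEquiv.symm.toLinearMap)
    (c.Lam Kind.disc ∘ₗ u.ppEquiv.symm.toLinearMap)).compr₂ u.ppEquiv.toLinearMap
  D := u.ppEquiv c.ampD
  A_symm _ _ := congrArg u.ppEquiv (quad_comm _ _ _)
  Cdisc_symm _ _ := congrArg u.ppEquiv (quad_comm _ _ _)
  finite_AD := by
    obtain ⟨N, hN⟩ := exists_mem_ppLt c.ampD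
    -- `N` accommodates `D`; the `1` accommodates `A`, as a product of two holomorphic differentials
    -- with `θ` has at most a double pole.
    obtain ⟨d, hd⟩ := u.exists_ppEquiv_mem hmono hex (max N 1)
    have hw := c.wtheta_mem Kind.disc
    refine ⟨d, hd _ (ppLt_mono (le_max_left _ _) hN), fun w w' => hd _ (ppLt_mono (le_max_right _ _)
      (quad_mem_ppLt hw (diffPlus_mem _) (diffPlus_mem _) (by norm_num))), fun w hw' w' => ?_⟩
    refine (congrArg u.ppEquiv (quad_eq_zero hw (diffPlus_mem_of_mem_VplusGt hw')
      (diffPlus_mem w'.1) (by omega))).trans (map_zero _)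
  finite_BC := by
    choose N hN using fun d => u.exists_ppEquiv_symm_mem (Vle d)
    choose r hr using fun N => u.exists_ppEquiv_mem hmono hex N
    -- Lifts of elements of `V_{≤ d}` have poles of order at most `2 N d`. The term `N d` makes
    -- inputs in `W_{> φ(d)}` cancel these poles; the index `2 N d + d + 2` dominates the bounds `N
    -- d + 1`, `N d + d + 2`, `2 N d + 1` for the values of `B`, `C^conn`, `C^disc`.
    obtain ⟨ph, h1, h2⟩ := exists_strictMono_ge fun d => max (N d) (r (2 * N d + d + 2))
    have hL : ∀ (k : Kind) {d} {v : u.Vcheck}, v ∈ Vle d →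
        c.Lam k (u.ppEquiv.symm v) ∈ ordLoc S.ram (-(2 * N d : ℕ)) := fun k d v hv =>
      liftPP_mem_ordLoc (c.toLoc_xi_sub_sing_mem k) (hN d v hv)
    have hmem : ∀ {d v M}, v ∈ ppLt S.ram M → M ≤ 2 * N d + d + 2 → u.ppEquiv v ∈ Vle (ph d) :=
      fun hv hM => hmono ((le_max_right _ _).trans (h2 _)) (hr _ _ (ppLt_mono hM hv))
    refine ⟨ph, h1, fun d => ⟨fun w v hv => ?_, fun w hw v hv => ?_, fun v hv b hb => ?_,
      fun v hv v' hv' => ?_⟩⟩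
    · exact hmem (quad_mem_ppLt (N := N d + 1) (c.wtheta_mem _) (diffPlus_mem w.1) (hL _ hv)
        (by push_cast; omega)) (by omega)
    · have := (le_max_left _ _).trans (h2 d)
      exact (congrArg u.ppEquiv (quad_eq_zero (c.wtheta_mem _) (diffPlus_mem_of_mem_VplusGt hw)
        (hL _ hv) (by push_cast; omega))).trans (map_zero _)
    -- Here `b.2 ≤ d` bounds the pole of the second factor by `2 d + 2`.
    · have hs : (Finsupp.single b 1 : PrincipalPart S.ram) ∈ ppLt S.ram (d + 1) := by
        refine mem_ppLt.2 fun a ha => Finsupp.single_eq_of_ne ?_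
        rintro rfl
        omega
      exact Submodule.smul_mem _ _ (hmem (quad_mem_ppLt (N := N d + d + 2) (c.wtheta_mem _) (hL _ hv)
        (liftPP_mem_ordLoc (c.toLoc_xi_sub_sing_mem _) hs) (by push_cast; omega)) (by omega))
    · exact hmem (quad_mem_ppLt (N := 2 * N d + 1) (c.wtheta_mem _) (hL _ hv) (hL _ hv')
        (by push_cast; omega)) (by omega)

end FSpectralCurve.SqrtCoordinates.UpDown

namespace FSpectralCurve.SqrtCoordinates

variable {X : Type*} [TopologicalSpace X] [ChartedSpace ℂ X]
  {S : FSpectralCurve X} (c : S.SqrtCoordinates)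

/-! ### The recursion -/

/-- The differential is present only for `h = 0` and `J` a singleton, so the double sum collapses to
a sum over single indices. -/
theorem sum_quad_diff {g n : ℕ} (f : Fin n → Vplus S.ram)
    (L : ℕ → Multiset (Vplus S.ram) → LocForm S.ram) (Θ : LocForm S.ram) :
    ∑ h ∈ Finset.range (g + 1), ∑ J : Finset (Fin n), quad Θ
      (if h = 0 ∧ (tupleMs (subFamily f J)).card = 1 then
        ((tupleMs (subFamily f J)).map diffPlus).sum else 0)
      (L (g - h) (tupleMs (subFamily f Jᶜ))) =
    ∑ m, quad Θ (diffPlus (f m)) (L g (tupleMs (subFamily f {m}ᶜ))) := by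
  classical
  rw [Finset.sum_range_succ', Finset.sum_eq_zero, zero_add]
  · have hs : (Finset.univ.filter fun J : Finset (Fin n) => J.card = 1) =
        Finset.univ.map ⟨fun m => {m}, Finset.singleton_injective⟩ := by
      ext J
      simp [Finset.card_eq_one, eq_comm]
    refine Eq.trans ?_ ((congrArg (fun s => ∑ J ∈ s, quad Θ
      ((tupleMs (subFamily f J)).map diffPlus).sum (L g (tupleMs (subFamily f Jᶜ)))) hs).trans ?_)
    · rw [Finset.sum_filter]
      refine Finset.sum_congr rfl fun J _ => ?_
      rw [card_tupleMs]
      by_cases h : J.card = 1 <;> simp [h]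
    · rw [Finset.sum_map]
      refine Finset.sum_congr rfl fun m _ => ?_
      rw [Function.Embedding.coeFn_mk, tupleMs_subFamily f {m}]
      simp
  · intro h _
    simp

variable [DecidableEq S.ram]

/-- Because `amp 0 {f}` vanishes, the two alternatives in the slot can be written as a sum.
Bilinearity can then separate the factors `ω_{0,2}` from the stable ones. -/
theorem slot_amp (h : ℕ) (m : Multiset (Vplus S.ram)) : c.slot c.amp h m =
    (if h = 0 ∧ m.card = 1 then (m.map diffPlus).sum else 0) + c.Lam Kind.disc (c.amp h m) := by
  rw [slot]
  split_ifs with h1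
  · obtain ⟨rfl, hm⟩ := h1
    obtain ⟨f, rfl⟩ := Multiset.card_eq_one.1 hm
    rw [amp_zero_singleton, map_zero, add_zero]
  · rw [zero_add]

/-- Expand both slots as differential plus lift. Two differentials would force `g = 0` and `n = 2`,
excluded by `hgn`; the two mixed sums are equal and absorb the factor `½`, giving `B`; two lifts
give `C^disc`. -/
theorem discStep_amp {g n : ℕ} (hgn : 3 ≤ 2 * g + n) (f : Fin n → Vplus S.ram) :
    c.discStep c.amp g (tupleMs f) =
      ∑ m, quad (c.wtheta Kind.disc) (diffPlus (f m))
        (c.Lam Kind.disc (c.amp g (tupleMs (subFamily f {m}ᶜ)))) +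
      (1 / 2 : ℂ) • ∑ h ∈ Finset.range (g + 1), ∑ J : Finset (Fin n), quad (c.wtheta Kind.disc)
        (c.Lam Kind.disc (c.amp h (tupleMs (subFamily f J))))
        (c.Lam Kind.disc (c.amp (g - h) (tupleMs (subFamily f Jᶜ)))) := by
  classical
  set Θ := c.wtheta Kind.disc
  set L : ℕ → Multiset (Vplus S.ram) → LocForm S.ram := fun h m => c.Lam Kind.disc (c.amp h m) with hL
  set E : ℕ → Multiset (Vplus S.ram) → LocForm S.ram := fun h m =>
    if h = 0 ∧ m.card = 1 then (m.map diffPlus).sum else 0 with hE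
  have hEE : ∀ h ∈ Finset.range (g + 1), ∀ J : Finset (Fin n),
      quad Θ (E h (tupleMs (subFamily f J))) (E (g - h) (tupleMs (subFamily f Jᶜ))) = 0 := by
    intro h hh J
    have h1 := Finset.mem_range.1 hh
    have h2 : J.card + Jᶜ.card = n := by rw [Finset.card_add_card_compl, Fintype.card_fin]
    simp only [hE, card_tupleMs]
    split_ifs with h3 h4
    · omega
    all_goals simp
  have e1 := sum_quad_diff (g := g) f L Θ
  have e2 : ∑ h ∈ Finset.range (g + 1), ∑ J : Finset (Fin n),
      quad Θ (L h (tupleMs (subFamily f J))) (E (g - h) (tupleMs (subFamily f Jᶜ))) =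
      ∑ m, quad Θ (diffPlus (f m)) (L g (tupleMs (subFamily f {m}ᶜ))) := by
    -- Reflecting `h ↦ g - h` and `J ↦ Jᶜ` exchanges the factors, and `quad` is symmetric.
    rw [← e1, ← Finset.sum_range_reflect]
    refine Finset.sum_congr rfl fun h hh => ?_
    have h1 := Finset.mem_range.1 hh
    have h2 : g + 1 - 1 - h = g - h := by omega
    have h3 : g - (g - h) = h := by omega
    rw [h2, h3, ← Equiv.sum_comp (compl_involutive.toPerm)]
    refine Finset.sum_congr rfl fun J _ => ?_
    rw [Function.Involutive.coe_toPerm, compl_compl, quad_comm]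
  rw [discStep]
  have e3 : ∀ h ∈ Finset.range (g + 1), ((tupleMs f).antidiagonal.map fun p =>
      quad Θ (c.slot c.amp h p.1) (c.slot c.amp (g - h) p.2)).sum =
      ∑ J : Finset (Fin n),
        quad Θ (E h (tupleMs (subFamily f J))) (L (g - h) (tupleMs (subFamily f Jᶜ))) +
      ∑ J : Finset (Fin n),
        quad Θ (L h (tupleMs (subFamily f J))) (E (g - h) (tupleMs (subFamily f Jᶜ))) +
      ∑ J : Finset (Fin n),
        quad Θ (L h (tupleMs (subFamily f J))) (L (g - h) (tupleMs (subFamily f Jᶜ))) := by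
    intro h hh
    rw [← sum_subFamily_eq_sum_antidiagonal f fun x y =>
      quad Θ (c.slot c.amp h x) (c.slot c.amp (g - h) y), ← Finset.sum_add_distrib,
      ← Finset.sum_add_distrib]
    refine Finset.sum_congr rfl fun J _ => ?_
    have hs : ∀ i m, c.slot c.amp i m = E i m + L i m := c.slot_amp
    rw [hs, hs, map_add, map_add, LinearMap.add_apply, LinearMap.add_apply, hEE h hh J]
    abel
  rw [Finset.sum_congr rfl e3, Finset.sum_add_distrib, Finset.sum_add_distrib, e2, e1, smul_add,
    ← two_smul ℂ, smul_smul, show (1 / 2 : ℂ) * 2 = 1 by norm_num, one_smul]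

variable [IsManifold 𝓘(ℂ, ℂ) ω X] [T2Space X]

theorem amp_monoGerm_cons (g : ℕ) (b : S.ram × ℕ) (m : Multiset (Vplus S.ram)) :
    c.amp g (monoGerm b ::ₘ m) = ((2 * b.2 + 1)‼ : ℂ) • c.amp g (epsGerm b ::ₘ m) :=
  ((c.isAmplitudePP_amp g (m.card + 1)).linearMap rfl).map_smul _ _

namespace UpDown

variable {c} (u : c.UpDown) {Vle : ℕ → Submodule ℂ u.Vcheck} (hmono : Monotone Vle)
    (hfin : ∀ d, Module.Finite ℂ (Vle d)) (hex : ∀ v, ∃ d, v ∈ Vle d)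
    (W : Submodule ℂ (Vplus S.ram))

theorem airy_B_ppEquiv (w : W) (v : PrincipalPart S.ram) :
    (u.airy hmono hfin hex W).B w (u.ppEquiv v) =
      u.ppEquiv (quad (c.wtheta Kind.disc) (diffPlus w) (c.Lam Kind.disc v)) := by
  change u.ppEquiv (quad _ _ (c.Lam _ (u.ppEquiv.symm (u.ppEquiv v)))) = _
  rw [LinearEquiv.symm_apply_apply]
  rfl

theorem airy_Cconn_ppEquiv (v : PrincipalPart S.ram) (b : S.ram × ℕ) :
    (u.airy hmono hfin hex W).Cconn (u.ppEquiv v) b = ((2 * b.2 + 1)‼ : ℂ) •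
      u.ppEquiv (quad (c.wtheta Kind.conn) (c.Lam Kind.conn v)
        (c.Lam Kind.conn (Finsupp.single b 1))) := by
  change ((2 * b.2 + 1)‼ : ℂ) • u.ppEquiv (quad _ (c.Lam _ (u.ppEquiv.symm (u.ppEquiv v))) _) = _
  rw [LinearEquiv.symm_apply_apply]

theorem airy_Cdisc_ppEquiv (v v' : PrincipalPart S.ram) :
    (u.airy hmono hfin hex W).Cdisc (u.ppEquiv v) (u.ppEquiv v') =
      u.ppEquiv (quad (c.wtheta Kind.disc) (c.Lam Kind.disc v) (c.Lam Kind.disc v')) := by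
  change u.ppEquiv (quad _ (c.Lam _ (u.ppEquiv.symm (u.ppEquiv v)))
    (c.Lam _ (u.ppEquiv.symm (u.ppEquiv v')))) = _
  rw [LinearEquiv.symm_apply_apply, LinearEquiv.symm_apply_apply]

theorem connTerm_airy (hW : ∀ b : S.ram × ℕ, epsGerm b ∈ W) {g n : ℕ} (hgn : 3 ≤ 2 * g + n)
    (w : Fin n → W) : (u.airy hmono hfin hex W).connTerm (fun b => ⟨epsGerm b, hW b⟩)
      (fun g n f => u.tensorF Kind.disc g n (fun i => f i)) g n w =
      (2 : ℂ) • u.ppEquiv (c.connStep c.amp g (tupleMs fun i => (w i : Vplus S.ram))) := by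
  cases g with
  | zero => simp [FAiryStructure.connTerm, connStep]
  | succ g =>
    -- The bound `hgn` excludes the type of `F_{1,1}`, where the connected step is `ampD` rather
    -- than a trace.
    have h : ¬(g = 0 ∧ n = 0) := by omega
    rw [FAiryStructure.connTerm, connStep, card_tupleMs, if_neg h, map_smul, smul_smul,
      show (2 : ℂ) * (1 / 2) = 1 by norm_num, one_smul]
    refine Eq.trans ?_ (AddEquiv.map_finsum u.ppEquiv.toAddEquiv _).symm
    refine finsum_congr fun b => ?_
    have e : (fun i => (((Fin.snoc w ⟨epsGerm b, hW b⟩ : Fin (n + 1) → W) i : W) : Vplus S.ram)) =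
        Fin.snoc (fun i => (w i : Vplus S.ram)) (epsGerm b) :=
      Fin.comp_snoc (fun x : W => (x : Vplus S.ram)) w _
    -- The double factorial in `C^conn` is exactly the ratio between `monoGerm b`, used in the
    -- connected step, and `epsGerm b`, used in the trace.
    rw [e, tensorF_eq, tupleMs_snoc, amp_monoGerm_cons]
    rw [airy_Cconn_ppEquiv, map_smul, map_smul, LinearMap.smul_apply]
    exact (map_smul u.ppEquiv _ _).symm

theorem isAmplitudes_airy (hW : ∀ b : S.ram × ℕ, epsGerm b ∈ W) :
    (u.airy hmono hfin hex W).IsAmplitudes (fun b => ⟨epsGerm b, hW b⟩)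
      (fun g n f => u.tensorF Kind.disc g n (fun i => f i)) := by
  refine ⟨fun w => by simp [tensorF], fun w => by simp [tensorF], fun w => ?_, fun w => ?_,
    fun g n _ w => ?_, fun g n hgn w => ?_⟩
  · have e : tupleMs (fun i => (w i : Vplus S.ram)) = (w 0 : Vplus S.ram) ::ₘ {(w 1 : Vplus S.ram)} := by
      simp [tupleMs, Fin.sum_univ_two]
    beta_reduce
    rw [tensorF_eq, e, amp_eq]
    refine congrArg u.ppEquiv ?_
    rw [connStep, discStep, ← Multiset.cons_zero (w 1 : Vplus S.ram), Multiset.antidiagonal_cons,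
      Multiset.antidiagonal_cons]
    simp only [zero_add, Finset.range_one, Finset.sum_singleton, Multiset.antidiagonal_zero,
      Multiset.map_singleton, Multiset.map_add, Multiset.sum_add, Multiset.sum_singleton, Prod.map_apply,
      id, c.slot_zero_zero c.amp_zero_zero, map_zero, LinearMap.zero_apply, add_zero, zero_tsub]
    simp only [slot, Multiset.card_cons, Multiset.card_zero, zero_add, and_self, if_true,
      Multiset.map_cons, Multiset.map_zero, Multiset.sum_cons, Multiset.sum_zero, add_zero]
    -- Only the splittings with one entry on each side survive; by symmetry they are equal, and
    -- together they cancel the factor `½`.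
    rw [quad_comm _ (diffPlus (w 1 : Vplus S.ram)), ← two_smul ℂ, smul_smul]
    norm_num
  · have e : tupleMs (fun i => (w i : Vplus S.ram)) = 0 := by simp [tupleMs]
    beta_reduce
    rw [tensorF_eq, e, amp_eq]
    refine congrArg u.ppEquiv ?_
    -- For type `(1, 0)` the terms `h = 0` and `h = 1` both contain the vanishing slot at `(0, ∅)`,
    -- so only `ampD` remains.
    rw [connStep, discStep, Finset.sum_range_succ, Finset.sum_range_one]
    simp [c.slot_zero_zero c.amp_zero_zero]
  -- Finiteness of the trace is the dependence of `amp` on finitely many Taylor coefficients; the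
  -- non-zero double factorial passes from `monoGerm` to `epsGerm`.
  · obtain ⟨N, hN⟩ := (c.isAmplitudePP_amp g (n + 1)).exists_expansion.exists
    have h0 := (hN (tupleMs fun i => (w i : Vplus S.ram)) (card_tupleMs _)).2
    refine ((Finset.univ : Finset S.ram) ×ˢ Finset.range (N + 1)).finite_toSet.subset fun b hb => ?_
    by_contra hb'
    refine hb ?_
    have e : (fun i => (((Fin.snoc w ⟨epsGerm b, hW b⟩ : Fin (n + 1) → W) i : W) : Vplus S.ram)) =
        Fin.snoc (fun i => (w i : Vplus S.ram)) (epsGerm b) :=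
      Fin.comp_snoc (fun x : W => (x : Vplus S.ram)) w _
    have h1 := h0 b (by by_contra h'; exact hb' (by simpa using h'))
    rw [amp_monoGerm_cons, smul_eq_zero, or_iff_right (doubleFactorial_ne_zero _)] at h1
    change u.tensorF Kind.disc g (n + 1) _ = 0
    rw [e, tensorF_eq, tupleMs_snoc, h1, map_zero]
  · rw [u.connTerm_airy hmono hfin hex W hW hgn]
    simp only [tensorF_eq, airy_B_ppEquiv, airy_Cdisc_ppEquiv]
    rw [amp_eq, map_add, discStep_amp c hgn, map_add, map_smul, smul_smul,
      show (1 / 2 : ℂ) * 2 = 1 by norm_num, one_smul, ← add_assoc, map_sum, map_sum]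
    simp only [map_sum]
    congr 1
    exact add_comm _ _

end UpDown

end FSpectralCurve.SqrtCoordinates

/-! ### The explicit formulae and the conclusion -/

theorem mainTheorem8 {X : Type*} [TopologicalSpace X] [T2Space X] [ChartedSpace ℂ X]
    [IsManifold 𝓘(ℂ, ℂ) ω X] (S : FSpectralCurve X) (c : S.SqrtCoordinates) (u : c.UpDown)
    [DecidableEq S.ram] :
    -- the extension of the up-morphisms by zero is well defined
    (∀ (k : Kind) (χ : LocForm S.ram), IsMeromorphicLocForm χ →
      ∃! p : c.Vminus k × Vplus S.ram × LocForm S.ram,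
        IsEvenLocForm p.2.2 ∧ χ = (p.1 : LocForm S.ram) + locD (p.2.1 : LocFun S.ram) + p.2.2) ∧
    -- the up-morphisms are applied to elements of their domain, and the tensors
    -- do not depend on the kind used to compute them
    c.toLoc c.formD ∈ c.Vminus Kind.conn ∧
    (∀ (k : Kind) (g n : ℕ), 2 ≤ 2 * g + n → ∀ f : Fin n → Vplus S.ram,
      c.projLoc k (c.toLoc (c.smeared g n f)) ∈ c.Vminus k) ∧
    (∀ (g n : ℕ) (f : Fin n → Vplus S.ram),
      u.tensorF Kind.conn g n f = u.tensorF Kind.disc g n f) ∧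
    -- the tensors are multilinear and symmetric
    (∀ g n : ℕ, ∃ M : MultilinearMap ℂ (fun _ : Fin n => Vplus S.ram) u.Vcheck,
      (∀ f, M f = u.tensorF Kind.disc g n f) ∧
      ∀ (τ : Equiv.Perm (Fin n)) (f : Fin n → Vplus S.ram), M (f ∘ τ) = M f) ∧
    -- they are the amplitudes of the F-Airy structure given by the explicit formulae
    ∀ (Vle : ℕ → Submodule ℂ u.Vcheck), Monotone Vle → (∀ d, Module.Finite ℂ (Vle d)) →
      (∀ v, ∃ d, v ∈ Vle d) →
    ∀ (W : Submodule ℂ (Vplus S.ram)), u.Vcheck ≤ W →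
    ∀ (hW : ∀ b : S.ram × ℕ, epsGerm b ∈ W),
    ∃ T : FAiryStructure Vle (fun d => (VplusGt S.ram d).comap W.subtype)
        (fun b : S.ram × ℕ => b.2),
      (∀ f₁ f₂ : W, T.A f₁ f₂ = u.upBar Kind.disc
        (c.dotProd (locD (f₁ : Vplus S.ram)) (locD (f₂ : Vplus S.ram)))) ∧
      (∀ (f₁ : W) (f₂ : u.Vcheck), T.B f₁ f₂ = u.upBar Kind.disc
        (c.dotProd (locD (f₁ : Vplus S.ram)) (u.down Kind.disc f₂))) ∧
      (∀ (f : u.Vcheck) (b : S.ram × ℕ), T.Cconn f b = u.upBar Kind.conn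
        (c.kappaCoeff (u.down Kind.conn f) b)) ∧
      (∀ f₁ f₂ : u.Vcheck, T.Cdisc f₁ f₂ = u.upBar Kind.disc
        (c.dotProd (u.down Kind.disc f₁) (u.down Kind.disc f₂))) ∧
      T.D = u.up Kind.conn (c.toLoc c.formD) ∧
      T.IsAmplitudes (fun b => ⟨epsGerm b, hW b⟩)
        (fun g n f => u.tensorF Kind.disc g n (fun i => f i)) := by
  have hdot : ∀ χ χ' : LocForm S.ram, c.dotProd χ χ' = χ * χ' * c.wtheta Kind.disc := fun χ χ' =>
    funext fun α => congrArg (χ α * χ' α * ·) (c.wtheta_disc α).symm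
  have hw : ∀ k, c.wtheta k ∈ merLoc S.ram := fun k => ordLoc_le_merLoc _ (c.wtheta_mem k)
  have hL : ∀ k v, c.Lam k v ∈ merLoc S.ram := fun k v => oddLoc_le_merLoc (c.Lam_mem k v)
  have hd : ∀ f : Vplus S.ram, diffPlus f ∈ merLoc S.ram := fun f =>
    ordLoc_le_merLoc _ (diffPlus_mem f)
  refine ⟨fun k χ hχ => c.existsUnique_decomposition k (mem_merLoc.2 hχ), ?_, fun k g n h f => ?_,
    fun g n f => ?_, u.exists_multilinearMap Kind.disc, fun Vle hmono hfin hex W _ hW =>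
    ⟨u.airy hmono hfin hex W, fun f₁ f₂ => ?_, fun f₁ f₂ => ?_, fun f b => ?_, fun f₁ f₂ => ?_, ?_,
      u.isAmplitudes_airy hmono hfin hex W hW⟩⟩
  · rw [c.toLoc_formD]
    exact Subtype.prop _
  · rw [c.projLoc_toLoc_smeared k h]
    exact Subtype.prop _
  · rw [u.tensorF_eq, u.tensorF_eq]
  · rw [hdot, ← diffPlus_apply, ← diffPlus_apply,
      u.upBar_eq _ (mem_merLoc_mul (mem_merLoc_mul (hd _) (hd _)) (hw _))]
    rfl
  · rw [hdot, ← diffPlus_apply, u.down_eq,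
      u.upBar_eq _ (mem_merLoc_mul (mem_merLoc_mul (hd _) (hL _ _)) (hw _))]
    rfl
  · rw [c.kappaCoeff_eq, u.down_eq, u.upBar_eq _ (Submodule.smul_mem _ _
      (mem_merLoc_mul (mem_merLoc_mul (hL _ _) (hL _ _)) (hw _))), map_smul, map_smul]
    rfl
  · rw [hdot, u.down_eq, u.down_eq,
      u.upBar_eq _ (mem_merLoc_mul (mem_merLoc_mul (hL _ _) (hL _ _)) (hw _))]
    rfl
  · rw [c.toLoc_formD, u.up_LamEquiv]
    rfl
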